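/- **Definitions.** All metric spaces carry the metric topology, and subsets carry the restricted metric. An $n$-manifold is a topological $n$-manifold, possibly with boundary; $\partial X$ denotes its manifold boundary. A metric $n$-manifold is a metric space that is an $n$-manifold. Spaces of maps carry the sup-metric $d(f,g)=\sup_x d(f(x),g(x))\in[0,\infty]$ and its topology (the uniform topology). For a metric $n$-manifold $(X,d)$ and $F\subset X$, let $i_F:F\to X$ be the inclusion. Let $\mathcal E^u_*(F,X)$ be the space of uniform embeddings $f:F\to X$ (uniformly continuous injections with uniformly continuous inverse $f(F)\to F$) that are proper in the sense that $f^{-1}(\partial X)=F\cap\partial X$. For $\alpha>0$ put $\mathcal E^u_*(i_F,\alpha;F,X)=\{f\in\mathcal E^u_*(F,X): d(f,i_F)<\alpha\}$. For $H\subset F$ and a neighborhood $\mathcal W$ of $i_F$ in $\mathcal E^u_*(F,X)$, an *admissible deformation of $\mathcal W$ over $H$* is a continuous map $\phi:\mathcal W\times[0,1]\to\mathcal E^u_*(F,X)$, $\phi_t(f)=\phi(f,t)$, such that $\phi_t(i_F)=i_F$ for all $t$, and for each $f\in\mathcal W$: $\phi_0(f)=f$; $\phi_1(f)=\mathrm{id}$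 on $H$; and if $f=\mathrm{id}$ on $F\cap\partial X$, then $\phi_t(f)=\mathrm{id}$ on $F\cap\partial X$ for all $t$. A *proper product end* (of dimension $n$) is a metric $n$-manifold $(L,d)$ in which every closed bounded subset is compact, with a (fixed) homeomorphism $\theta:S\times[1,\infty)\to L$ for some compact $(n-1)$-manifold $S$; put $L_r=\theta(S\times[r,\infty))$ for $r\ge1$. A closed subset of $L$ is *cofinal* if its complement is relatively compact in $L$. $(L,d)$ has *property (ED)* if for every cofinal closed $F\subset L$ and every $\alpha>0$ there exist $\beta>0$, a cofinal closed $H\subset F$ and an admissible deformation over $H$ $$\phi:\mathcal E^u_*(i_F,\alpha;F,L)\times[0,1]\to\mathcal E^u_*(i_F,\beta;F,L)$$ with $\phi_t(f)=f$ on $\mathrm{Fr}_LF$ for all $(f,t)$. A *proper product end of a metric $n$-manifold $(M,d)$* is a closed subset $L\subset M$ with $\mathrm{Fr}_ML$ compact such that $(L,d|_L)$ is a proper product end of dimension $n$. It is *isolated* if for every $c>0$ there is a cofinal closed $F\subset L$ with $d(M-L,F)>c$, where $d(A,B)=\inf\{d(a,b):a\in A,\,b\in B\}$ and $\inf\emptyset=\infty$.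 $\mathcal H^u(M,d)$ is the group of homeomorphisms $h$ of $M$ onto itself with $h$ and $h^{-1}$ uniformly continuous; $\mathcal H^u(M,d)_b=\{h\in\mathcal H^u(M,d): d(h,\mathrm{id}_M)<\infty\}$; $\mathcal H^u(M,d;C)_b=\{h\in\mathcal H^u(M,d)_b: h=\mathrm{id}\text{ on }C\}$ for $C\subset M$; and $\mathcal H^u(\mathrm{id}_M,\alpha;M,d)=\{h\in\mathcal H^u(M,d): d(h,\mathrm{id}_M)<\alpha\}$. A *strong deformation retraction* of a space $Y$ onto a subspace $A$ is a continuous $\phi:Y\times[0,1]\to Y$ with $\phi_0=\mathrm{id}$, $\phi_1(Y)\subset A$, and $\phi_t(a)=a$ for all $a\in A$, $t\in[0,1]$. **Theorem.** Let $(M,d)$ be a metric $n$-manifold and let $L(1),\dots,L(m)\subset M$ be pairwise disjoint isolated proper product ends of $M$ such that each $(L(i),d|_{L(i)})$ has property (ED) and $L(i)_2\subset\mathrm{Int}_ML(i)$. Put $L_r=L(1)_r\cup\dots\cup L(m)_r$ for $r\ge1$. Then there exists a strong deformation retraction $\phi$ of $\mathcal H^u(M,d)_b$ onto $\mathcal H^u(M,d;L_3)_b$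 such that 1. for each $(h,t)\in\mathcal H^u(M,d)_b\times[0,1]$: (i) $\phi_t(h)=h$ on $h^{-1}(M-\mathrm{Int}_ML_2)-\mathrm{Int}_ML_2$; (ii) if $h=\mathrm{id}$ on $\partial M$, then $\phi_t(h)=\mathrm{id}$ on $\partial M$; 2. for each $\alpha>0$ there exists $\beta>0$ such that $\phi\big(\mathcal H^u(\mathrm{id}_M,\alpha;M,d)\times[0,1]\big)\subset\mathcal H^u(\mathrm{id}_M,\beta;M,d)$. -/

import Mathlib

open scoped UniformConvergence unitInterval

namespace EndDeformation

universe u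

/-! ### Topological manifolds with boundary -/

/-- The closed half space `{x ∈ ℝⁿ | xₙ ≥ 0}` (last coordinate nonnegative); for `n = 0` it is the
one-point space `ℝ⁰`. -/
def halfSpace (n : ℕ) : Set (EuclideanSpace ℝ (Fin n)) :=
  {x | ∀ i : Fin n, (i : ℕ) + 1 = n → 0 ≤ x i}

/-- Topological `n`-manifold, possibly with boundary: a Hausdorff space in which every point has
an open neighborhood homeomorphic to an open subset of the closed half space. No countability
axiom is imposed: the manifolds below are either metric spaces, hence paracompact, or compact,
hence second countable. -/
structure IsTopManifold (n : ℕ) (X : Type*) [TopologicalSpace X] : Prop where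
  t2 : T2Space X
  chart : ∀ x : X, ∃ e : OpenPartialHomeomorph X (halfSpace n), x ∈ e.source

/-- The manifold interior: the points with an open neighborhood homeomorphic to an open subset
of `ℝⁿ`. -/
def manifoldInterior (n : ℕ) (X : Type*) [TopologicalSpace X] : Set X :=
  {x | ∃ e : OpenPartialHomeomorph X (EuclideanSpace ℝ (Fin n)), x ∈ e.source}

/-- The manifold boundary `∂X`. -/
def manifoldBoundary (n : ℕ) (X : Type*) [TopologicalSpace X] : Set X :=
  (manifoldInterior n X)ᶜ

/-! ### Spaces of proper uniform embeddings

`F →ᵤ X` is the type of all functions `F → X` with the extended metric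
`edist f g = ⨆ x, edist (f x) (g x)` and the topology of uniform convergence; the spaces of
embeddings and homeomorphisms are subspaces of it. -/

section Embeddings

variable {X : Type u} [MetricSpace X]

/-- The inclusion map `i_F : F → X`. -/
def incl (F : Set X) : F →ᵤ X := UniformFun.ofFun (fun x : F => (x : X))

/-- The space `𝓔ᵘ_*(F, (X, d))` of proper uniform embeddings `f : F → X` into an `n`-manifold,
where proper means `f⁻¹(∂X) = F ∩ ∂X`. -/
def properEmb (n : ℕ) (F : Set X) : Set (F →ᵤ X) :=
  {f | IsUniformEmbedding (UniformFun.toFun f) ∧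
    ∀ x : F, UniformFun.toFun f x ∈ manifoldBoundary n X ↔ (x : X) ∈ manifoldBoundary n X}

/-- The open `α`-neighborhood `𝓔ᵘ_*(i_F, α; F, (X, d))` of the inclusion map. -/
def properEmbBall (n : ℕ) (F : Set X) (α : ℝ) : Set (F →ᵤ X) :=
  {f | f ∈ properEmb n F ∧ edist f (incl F) < ENNReal.ofReal α}

/-- `φ` is an admissible deformation of `W` over `H` in `𝓔ᵘ_*(F, (X, d))`. -/
structure IsAdmissibleDeformation (n : ℕ) {F : Set X} (W : Set (F →ᵤ X)) (H : Set X)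
    (φ : W × I → (F →ᵤ X)) : Prop where
  continuous : Continuous φ
  mem : ∀ p, φ p ∈ properEmb n F
  zero : ∀ f : W, φ (f, 0) = f
  one : ∀ f : W, ∀ x : F, (x : X) ∈ H → UniformFun.toFun (φ (f, 1)) x = x
  boundary : ∀ f : W,
    (∀ x : F, (x : X) ∈ manifoldBoundary n X → UniformFun.toFun (f : F →ᵤ X) x = x) →
    ∀ t : I, ∀ x : F, (x : X) ∈ manifoldBoundary n X → UniformFun.toFun (φ (f, t)) x = x
  incl : ∀ f : W, (f : F →ᵤ X) = incl F → ∀ t : I, φ (f, t) = f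

/-- The collection of cofinal closed subsets of `X`: closed subsets with relatively compact
complement. -/
def cofinalClosed (X : Type u) [TopologicalSpace X] : Set (Set X) :=
  {F | IsClosed F ∧ IsCompact (closure Fᶜ)}

/-- The end deformation property (ED) for uniform embeddings. -/
def HasED (n : ℕ) (X : Type u) [MetricSpace X] : Prop :=
  ∀ F ∈ cofinalClosed X, ∀ α : ℝ, 0 < α →
    ∃ β : ℝ, 0 < β ∧ ∃ H ∈ cofinalClosed X, H ⊆ F ∧
      ∃ φ : properEmbBall n F α × I → (F →ᵤ X),
        IsAdmissibleDeformation n (properEmbBall n F α) H φ ∧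
        (∀ p, φ p ∈ properEmbBall n F β) ∧
        ∀ (f : properEmbBall n F α) (t : I) (x : F), (x : X) ∈ frontier F →
          UniformFun.toFun (φ (f, t)) x = UniformFun.toFun (f : F →ᵤ X) x

end Embeddings

/-! ### Proper product ends -/

/-- The structure of an `n`-dimensional proper product end on a metric space `L`: `L` is a proper
metric `n`-manifold, with a fixed homeomorphism `θ : S × [1, ∞) ≈ L` for a compact
`(n - 1)`-manifold `S`. (Any such `S` embeds in `L`, so it may be taken in the universe of `L`.) -/
structure ProperProductEnd (n : ℕ) (L : Type u) [MetricSpace L] where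
  manifold : IsTopManifold n L
  proper : ProperSpace L
  S : Type u
  [topS : TopologicalSpace S]
  compactS : CompactSpace S
  dimS : ℕ
  dim_eq : n = dimS + 1
  manifoldS : IsTopManifold dimS S
  θ : (S × Set.Ici (1 : ℝ)) ≃ₜ L

attribute [instance] ProperProductEnd.topS

/-- A proper product end of the metric space `M`: a closed subset `L` with compact frontier which
is a proper product end for the restricted metric. -/
structure ProperProductEndIn (n : ℕ) (M : Type u) [MetricSpace M] where
  L : Set M
  isClosed : IsClosed L
  isCompact_frontier : IsCompact (frontier L)
  str : ProperProductEnd n L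

namespace ProperProductEndIn

variable {n : ℕ} {M : Type u} [MetricSpace M]

/-- The subset `L_r = θ(S × [r, ∞))`, as a subset of `M`. -/
def tail (E : ProperProductEndIn n M) (r : ℝ) : Set M :=
  {x | ∃ p : E.str.S × Set.Ici (1 : ℝ), r ≤ (p.2 : ℝ) ∧ (E.str.θ p : M) = x}

/-- The end is isolated: for every `c > 0` there is a cofinal closed subset `F` of `L` with
`d(M - L, F) > c`, where `d(A, B) = inf {d(a, b)}` and `inf ∅ = ∞`. -/
def IsIsolated (E : ProperProductEndIn n M) : Prop :=
  ∀ c : ℝ, 0 < c → ∃ F ∈ cofinalClosed E.L,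
    ENNReal.ofReal c < ⨅ x ∈ E.Lᶜ, ⨅ y ∈ F, edist x (y : M)

end ProperProductEndIn

/-! ### Groups of bounded uniform homeomorphisms -/

section Homeo

variable {M : Type u} [MetricSpace M]

/-- The set `𝓗ᵘ(M, d)` of uniform homeomorphisms of `M` onto itself, as a subspace of `M →ᵤ M`. -/
def unifHomeo (M : Type u) [MetricSpace M] : Set (M →ᵤ M) :=
  {h | ∃ e : M ≃ᵤ M, h = UniformFun.ofFun e}

/-- The identity map. -/
def idFun (M : Type u) : M →ᵤ M := UniformFun.ofFun id

/-- `𝓗ᵘ(M, d)_b`: uniform homeomorphisms at finite sup-distance from the identity. -/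
def bddUnifHomeo (M : Type u) [MetricSpace M] : Set (M →ᵤ M) :=
  {h | h ∈ unifHomeo M ∧ edist h (idFun M) < ⊤}

/-- `𝓗ᵘ(M, d; C)_b`: those that are the identity on `C`. -/
def bddUnifHomeoRel (C : Set M) : Set (M →ᵤ M) :=
  {h | h ∈ bddUnifHomeo M ∧ ∀ x ∈ C, UniformFun.toFun h x = x}

/-- The open `α`-neighborhood `𝓗ᵘ(id, α; M, d)` of the identity in `𝓗ᵘ(M, d)`. -/
def unifHomeoBall (M : Type u) [MetricSpace M] (α : ℝ) : Set (M →ᵤ M) :=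
  {h | h ∈ unifHomeo M ∧ edist h (idFun M) < ENNReal.ofReal α}

end Homeo

/-- `φ` is a strong deformation retraction of the subspace `Y` onto its subspace `A`. -/
structure IsStrongDeformationRetraction {Z : Type*} [TopologicalSpace Z] (Y A : Set Z)
    (φ : Y × I → Y) : Prop where
  subset : A ⊆ Y
  continuous : Continuous φ
  zero : ∀ y : Y, φ (y, 0) = y
  one : ∀ y : Y, (φ (y, 1) : Z) ∈ A
  fixed : ∀ y : Y, (y : Z) ∈ A → ∀ t : I, φ (y, t) = y

end EndDeformation

/-!
The ends can be treated separately: the retraction for an end `L` changes `h` only at points `x`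
such that `x` or `h x` is in the interior of `L_2`, so retractions for disjoint ends can be composed
at each time (`IsEndRetraction.comp`). For a single end the argument has three layers.

*Stages.* Property (ED) deforms embeddings of `L_c` into `L`, not homeomorphisms of `M`. If `h`
displaces points of `L_c` by less than the distance from `L_c` to `M - L`, then its restriction to
`L_c` is such an embedding, and the deformation `f_t` of it relative to the frontier can be extended
by `h` on the complement. The extension is bijective since `f_t (L_c) = h (L_c)` for all `t`: by
invariance of domain the image of the interior of `L_c` under `f_t` is open and closed in the
complement of the image of the frontier, and the paths `f_t x` stay in this complement
(`image_mem_nhds_of_manifold`, `range_eq_of_path`). It is uniformly continuous in both directions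
since, the end being isolated, the points outside of `L_c` which are close to `L_c` lie in a compact
set. This gives a deformation whose result is the identity on some `L_{c'}`, defined for all `h`
with displacement on `L_c` below a bound which may be large if `c` is; the displacement during the
deformation is bounded, but neither this bound nor `c'` can be prescribed
(`exists_isStage_of_hasED`). Conjugation by a homeomorphism which stretches the region between `c`
and a given `c'` makes `c'` arbitrary and the displacement arbitrarily small, for `h` sufficiently
close to the identity on `L_c` (`exists_isStage_of_lt`).

*Chains.* Hence there are levels `c j` and sizes `α j`, increasing in the integer `j`, with
`c j → 3` and `α j → 0` as `j → -∞` and with `α j` unbounded, and for each `j` a stage supported in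
`L_{c j}` which turns maps of displacement less than `2 α j` on `L_{c j}` into maps of displacement
at most `α (j + 1)` which are the identity on `L_{c (j + 1)}` (`StageChain`). For a map with
displacement `η > 0` on `L_3` only two stages, with `α j` about `η`, have an effect; each has its
own time interval and is cut off by a continuous function of `η`. Locally in `η` this is a
composition of three stages, since the result of a completed stage is fixed by the following one.
At `η = 0` continuity holds because the displacements produced are small
(`StageChain.continuous_deform`).

*Stretching back.* The result is the identity beyond a level `κ η` which depends continuously on
`η` and equals `3` at `η = 0` (`StageChain.exists_level`). Conjugating at the same time by a
homeomorphism which moves level `3` to level `3 + t (κ η - 3)` makes the result the identity on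
`L_3`.

Invariance of domain is deduced from the no-retraction theorem for `C¹` maps of a ball: for a
retraction `f` onto the sphere, the integral over the ball of the Jacobian of `x + t (f x - x)`
would be a polynomial in `t` which is the volume of the ball for small `t` and zero at `t = 1`.
-/

namespace EndDeformation

/-! ### Invariance of domain in Euclidean spaces -/

section InvarianceOfDomain

open MeasureTheory Metric Polynomial

variable {V : Type*} [NormedAddCommGroup V] [InnerProductSpace ℝ V] [FiniteDimensional ℝ V]

/-- Along a line through the identity the determinant is a polynomial of degree at most
the dimension. -/
lemma exists_polynomial_det_one_add_smul (A : V →L[ℝ] V) :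
    ∃ q : ℝ[X], q.degree < (Module.finrank ℝ V + 1 : ℕ) ∧
      ∀ t : ℝ, q.eval t = (ContinuousLinearMap.id ℝ V + t • A).det := by
  let b := Module.finBasis ℝ V
  let N : Matrix _ _ ℝ := LinearMap.toMatrix b b (A : V →ₗ[ℝ] V)
  refine ⟨Matrix.det ((X : ℝ[X]) • N.map C + (1 : Matrix _ _ ℝ).map C), ?_, fun t => ?_⟩
  · refine lt_of_le_of_lt degree_le_natDegree ?_
    have := natDegree_det_X_add_C_le N 1
    rw [Fintype.card_fin] at this
    exact_mod_cast Nat.lt_succ_of_le this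
  · have h1 : (ContinuousLinearMap.id ℝ V + t • A).det
        = Matrix.det (t • N + 1) := by
      have : ((ContinuousLinearMap.id ℝ V + t • A : V →L[ℝ] V) : V →ₗ[ℝ] V)
          = LinearMap.id + t • (A : V →ₗ[ℝ] V) := by ext; simp
      rw [ContinuousLinearMap.det, this, ← LinearMap.det_toMatrix b]
      simp [N, add_comm]
    rw [h1, ← coe_evalRingHom, RingHom.map_det]
    congr 1
    ext i j
    simp [Matrix.one_apply]
    split_ifs <;> simp [mul_comm]

variable [MeasurableSpace V] [BorelSpace V]

/-- If a `C¹` self-map of `V` fixes the sphere of radius `ρ` pointwise, then for small `t` the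
interpolation with the identity maps the closed ball bijectively onto itself and preserves
orientation, so the integral of its Jacobian is the volume of the ball. -/
lemma eventually_setIntegral_det_eq {f : V → V} (hf : ContDiff ℝ 1 f) {ρ : ℝ} (hρ : 0 < ρ)
    (hfix : ∀ x, ‖x‖ = ρ → f x = x) (hmaps : ∀ x ∈ closedBall (0 : V) ρ, ‖f x‖ ≤ ρ) :
    ∃ δ : ℝ, 0 < δ ∧ ∀ t : ℝ, 0 < t → t < δ →
      ∫ x in closedBall (0 : V) ρ,
        (ContinuousLinearMap.id ℝ V + t • (fderiv ℝ f x - ContinuousLinearMap.id ℝ V)).det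
        = (volume : Measure V).real (closedBall (0 : V) ρ) := by
  classical
  set B := closedBall (0 : V) ρ with hB
  set g : V → V := fun x => f x - x with hg
  have hgC : ContDiff ℝ 1 g := hf.sub contDiff_id
  have hgd : ∀ x, HasFDerivAt g (fderiv ℝ f x - ContinuousLinearMap.id ℝ V) x := fun x =>
    ((hf.differentiable one_ne_zero x).hasFDerivAt).sub (hasFDerivAt_id x)
  obtain ⟨K, hK⟩ := hgC.contDiffOn.exists_lipschitzOnWith one_ne_zero
    (convex_closedBall (0 : V) ρ) (isCompact_closedBall _ _)
  -- extension of `g` by zero outside of the ball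
  set G : V → V := fun x => if x ∈ B then g x else 0 with hG
  have hGB : ∀ x ∈ B, G x = g x := fun x hx => by simp [hG, hx]
  have hkey : ∀ x ∈ B, ∀ y ∉ B, ‖g x‖ ≤ K * ‖x - y‖ := by
    intro x hx y hy
    obtain ⟨z, hz, hzρ⟩ : ∃ z ∈ segment ℝ x y, ‖z‖ = ρ := by
      have hc : ContinuousOn (fun z : V => ‖z‖) (segment ℝ x y) := continuous_norm.continuousOn
      have := (convex_segment x y).isPreconnected.intermediate_value (left_mem_segment ℝ x y)
        (right_mem_segment ℝ x y) hc
      have hx' : ‖x‖ ≤ ρ := by simpa [hB] using hx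
      have hy' : ρ < ‖y‖ := by simpa [hB] using hy
      obtain ⟨z, hz, h⟩ := this ⟨hx', hy'.le⟩
      exact ⟨z, hz, h⟩
    have hzB : z ∈ B := by simp [hB, hzρ]
    have hgz : g z = 0 := by simp [hg, hfix z hzρ]
    have h1 := hK.norm_sub_le hx hzB
    rw [hgz, sub_zero] at h1
    refine h1.trans ?_
    gcongr
    have := dist_add_dist_of_mem_segment hz
    rw [← dist_eq_norm, ← dist_eq_norm]
    linarith [dist_nonneg (x := z) (y := y)]
  have hGL : LipschitzWith K G := by
    refine LipschitzWith.of_dist_le_mul fun x y => ?_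
    rw [dist_eq_norm, dist_eq_norm]
    by_cases hx : x ∈ B <;> by_cases hy : y ∈ B
    · simpa [hG, hx, hy] using hK.norm_sub_le hx hy
    · simpa [hG, hx, hy] using hkey x hx y hy
    · rw [norm_sub_rev, norm_sub_rev x]
      simpa [hG, hx, hy] using hkey y hy x hx
    · simp only [hG, hx, hy, if_false, sub_self, norm_zero]; positivity
  refine ⟨min 1 (1 / (K + 1)), by positivity, fun t ht0 htδ => ?_⟩
  have ht1 : t < 1 := htδ.trans_le (min_le_left _ _)
  have htK : t * K < 1 := by
    have : t < 1 / (K + 1) := htδ.trans_le (min_le_right _ _)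
    rw [lt_div_iff₀ (by positivity)] at this
    nlinarith
  set F : V → V := fun x => x + t • G x with hF
  obtain ⟨T, hT⟩ : ∃ T : NNReal, (T : ℝ) = t := ⟨t.toNNReal, Real.coe_toNNReal t ht0.le⟩
  have hFapp : ApproximatesLinearOn F (((ContinuousLinearEquiv.refl ℝ V) : V ≃L[ℝ] V) : V →L[ℝ] V)
      Set.univ (T * K) := by
    intro x _ y _
    have : F x - F y - ((ContinuousLinearEquiv.refl ℝ V : V ≃L[ℝ] V) : V →L[ℝ] V) (x - y)
        = t • (G x - G y) := by
      simp [hF, smul_sub]; abel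
    rw [this, norm_smul, Real.norm_of_nonneg ht0.le]
    have := hGL.norm_sub_le x y
    calc t * ‖G x - G y‖ ≤ t * (K * ‖x - y‖) := by gcongr
      _ = _ := by rw [NNReal.coe_mul, hT, mul_assoc]
  have hcond : Subsingleton V ∨ (T * K : NNReal) <
      ‖(((ContinuousLinearEquiv.refl ℝ V).symm : V ≃L[ℝ] V) : V →L[ℝ] V)‖₊⁻¹ := by
    rcases subsingleton_or_nontrivial V with h | h
    · exact Or.inl h
    · right
      have : ‖(((ContinuousLinearEquiv.refl ℝ V).symm : V ≃L[ℝ] V) : V →L[ℝ] V)‖₊ = 1 := by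
        have : (((ContinuousLinearEquiv.refl ℝ V).symm : V ≃L[ℝ] V) : V →L[ℝ] V)
          = ContinuousLinearMap.id ℝ V := by ext; simp
        rw [this, ← NNReal.coe_inj]; simp
      rw [this, inv_one, ← NNReal.coe_lt_coe]
      simpa [hT] using htK
  have hFbij : Function.Bijective F := (hFapp.toHomeomorph F hcond).bijective
  have hFB : ∀ x ∈ B, F x ∈ B := by
    intro x hx
    have e : F x = (1 - t) • x + t • f x := by
      simp only [hF, hGB x hx, hg, smul_sub, sub_smul, one_smul]; abel
    have hx' : x ∈ B := hx
    have hfx : f x ∈ B := by simpa [hB] using hmaps x hx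
    rw [e]
    exact convex_closedBall (0 : V) ρ hx' hfx (by linarith) ht0.le (by ring)
  have hFout : ∀ x ∉ B, F x = x := fun x hx => by simp [hF, hG, hx]
  have himg : F '' B = B := by
    refine Set.Subset.antisymm (Set.image_subset_iff.2 hFB) fun y hy => ?_
    obtain ⟨x, rfl⟩ := hFbij.2 y
    by_cases hx : x ∈ B
    · exact ⟨x, hx, rfl⟩
    · rw [hFout x hx] at hy; exact absurd hy hx
  set F' : V → V →L[ℝ] V := fun x =>
    ContinuousLinearMap.id ℝ V + t • (fderiv ℝ f x - ContinuousLinearMap.id ℝ V) with hF'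
  have hder : ∀ x ∈ B, HasFDerivWithinAt F (F' x) B x := by
    intro x hx
    have : HasFDerivWithinAt (fun x => x + t • g x) (F' x) B x :=
      ((hasFDerivAt_id x).add ((hgd x).const_smul t)).hasFDerivWithinAt
    exact this.congr (fun y hy => by simp [hF, hGB y hy]) (by simp [hF, hGB x hx])
  -- the Jacobian is nonzero along the segment `[0, t]`, hence positive
  have hgn : ∀ x ∈ B, ∀ v, ‖(fderiv ℝ f x - ContinuousLinearMap.id ℝ V) v‖ ≤ K * ‖v‖ := by
    have hb : ∀ x ∈ ball (0 : V) ρ, ‖fderiv ℝ f x - ContinuousLinearMap.id ℝ V‖ ≤ K := by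
      intro x hx
      exact (hgd x).le_of_lipschitzOn (closedBall_mem_nhds_of_mem hx) hK
    have hcl : IsClosed {x | ‖fderiv ℝ f x - ContinuousLinearMap.id ℝ V‖ ≤ K} :=
      isClosed_le ((hf.continuous_fderiv one_ne_zero).sub continuous_const).norm continuous_const
    have hsub : B ⊆ {x | ‖fderiv ℝ f x - ContinuousLinearMap.id ℝ V‖ ≤ K} := by
      rw [hB, ← closure_ball (0 : V) hρ.ne']
      exact hcl.closure_subset_iff.2 hb
    intro x hx v
    exact (ContinuousLinearMap.le_opNorm _ v).trans
      (mul_le_mul_of_nonneg_right (hsub hx) (norm_nonneg v))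
  have hpos : ∀ x ∈ B, 0 < (F' x).det := by
    intro x hx
    obtain ⟨q, -, hq⟩ := exists_polynomial_det_one_add_smul
      (fderiv ℝ f x - ContinuousLinearMap.id ℝ V)
    have hne : ∀ s ∈ Set.Icc 0 t, q.eval s ≠ 0 := by
      intro s hs h0
      rw [hq] at h0
      have : ¬ Function.Injective (ContinuousLinearMap.id ℝ V +
          s • (fderiv ℝ f x - ContinuousLinearMap.id ℝ V)) := by
        intro hinj
        have hu := (LinearMap.isUnit_iff_ker_eq_bot
          ((ContinuousLinearMap.id ℝ V +
          s • (fderiv ℝ f x - ContinuousLinearMap.id ℝ V) : V →L[ℝ] V) : V →ₗ[ℝ] V)).2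
            (LinearMap.ker_eq_bot.2 hinj)
        exact (LinearMap.isUnit_iff_isUnit_det _).1 hu |>.ne_zero h0
      apply this
      rw [injective_iff_map_eq_zero]
      intro v hv
      by_contra hv0
      have hv' : v = -(s • (fderiv ℝ f x - ContinuousLinearMap.id ℝ V) v) := by
        rw [eq_neg_iff_add_eq_zero]; simpa using hv
      have h1 : ‖v‖ ≤ s * (K * ‖v‖) := by
        conv_lhs => rw [hv']
        rw [norm_neg, norm_smul, Real.norm_of_nonneg hs.1]
        exact mul_le_mul_of_nonneg_left (hgn x hx v) hs.1
      have h2 : s * K < 1 := lt_of_le_of_lt (mul_le_mul_of_nonneg_right hs.2 K.2) htK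
      have h3 : 0 < ‖v‖ := norm_pos_iff.2 hv0
      nlinarith
    have h0 : q.eval 0 = 1 := by
      rw [hq]; simp [ContinuousLinearMap.det]
    have : 0 < q.eval t := by
      by_contra hle
      push Not at hle
      have := intermediate_value_Icc' ht0.le (q.continuous.continuousOn (s := Set.Icc 0 t))
      obtain ⟨s, hs, h⟩ := this (show (0 : ℝ) ∈ Set.Icc (q.eval t) (q.eval 0) from
        ⟨hle, by rw [h0]; norm_num⟩)
      exact hne s hs h
    rw [hq] at this
    exact this
  have hcv := integral_image_eq_integral_abs_det_fderiv_smul (volume : Measure V)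
    (measurableSet_closedBall (x := (0 : V)) (ε := ρ)) hder hFbij.1.injOn (fun _ => (1 : ℝ))
  have himg' : F '' closedBall 0 ρ = B := himg
  rw [himg'] at hcv
  have h1 : ∫ x in B, (1 : ℝ) = (volume : Measure V).real B := by simp
  rw [h1] at hcv
  rw [hcv]
  refine setIntegral_congr_fun measurableSet_closedBall fun x hx => ?_
  simp only [smul_eq_mul, mul_one]
  exact (abs_of_pos (hpos x hx)).symm

/-- There is no `C¹` retraction of a ball onto its boundary sphere. The integral over the ball
of the Jacobian of `x + t (f x - x)` is a polynomial in `t`; it is the volume of the ball for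
small `t`, hence for `t = 1`, where the Jacobian vanishes. -/
theorem no_contDiff_retraction [Nontrivial V] {f : V → V} (hf : ContDiff ℝ 1 f) {ρ : ℝ}
    (hρ : 0 < ρ) (hfix : ∀ x, ‖x‖ = ρ → f x = x) (hnorm : ∀ x, ‖f x‖ = ρ) : False := by
  obtain ⟨δ, hδ, hint⟩ := eventually_setIntegral_det_eq hf hρ hfix fun x _ => (hnorm x).le
  set B := closedBall (0 : V) ρ with hB
  set A : V → V →L[ℝ] V := fun x => fderiv ℝ f x - ContinuousLinearMap.id ℝ V with hA
  have hAc : Continuous A := (hf.continuous_fderiv one_ne_zero).sub continuous_const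
  set D : ℝ → V → ℝ := fun t x => (ContinuousLinearMap.id ℝ V + t • A x).det with hD
  have hDc : ∀ t, Continuous (D t) := fun t =>
    ContinuousLinearMap.continuous_det.comp (continuous_const.add (hAc.const_smul t))
  have hDi : ∀ t, IntegrableOn (D t) B := fun t =>
    (hDc t).continuousOn.integrableOn_compact (isCompact_closedBall _ _)
  set N := Module.finrank ℝ V + 1 with hN
  set s := Finset.range N with hs
  set v : ℕ → ℝ := fun i => δ / (i + 2) with hv
  have hvinj : Set.InjOn v s := by
    intro i _ j _ h
    simp only [hv] at h
    have h1 : (i + 2 : ℝ) = j + 2 := by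
      rw [div_eq_div_iff (by positivity) (by positivity)] at h
      exact (mul_left_cancel₀ hδ.ne' h).symm
    exact_mod_cast (add_right_cancel h1)
  have hvpos : ∀ i, 0 < v i := fun i => by simp only [hv]; positivity
  have hvlt : ∀ i, v i < δ := fun i => by
    simp only [hv]
    rw [div_lt_iff₀ (by positivity)]
    nlinarith [(Nat.cast_nonneg i : (0 : ℝ) ≤ i)]
  have hlag : ∀ x, D 1 x = ∑ i ∈ s, (Lagrange.basis s v i).eval 1 * D (v i) x := by
    intro x
    obtain ⟨q, hqd, hq⟩ := exists_polynomial_det_one_add_smul (A x)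
    have h := Lagrange.eq_interpolate hvinj (f := q) (by simpa [hs, hN] using hqd)
    have h2 := congrArg (Polynomial.eval 1) h
    rw [Lagrange.interpolate_apply, eval_finsetSum] at h2
    simp only [eval_mul, eval_C, hq] at h2
    rw [hD]
    simp only
    rw [h2]
    exact Finset.sum_congr rfl fun i _ => mul_comm _ _
  have hsum1 : ∑ i ∈ s, (Lagrange.basis s v i).eval 1 = 1 := by
    have := Lagrange.sum_basis hvinj (s := s) ⟨0, by simp [hs, hN]⟩
    rw [← eval_finsetSum, this, eval_one]
  have hI : ∫ x in B, D 1 x = (volume : Measure V).real B := by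
    simp_rw [hlag]
    rw [integral_finsetSum _ fun i _ => (hDi (v i)).const_mul _]
    simp_rw [integral_const_mul]
    rw [Finset.sum_congr rfl fun i _ => by rw [hint (v i) (hvpos i) (hvlt i)],
      ← Finset.sum_mul, hsum1, one_mul]
  have hzero : ∀ x, D 1 x = 0 := by
    intro x
    have e : ContinuousLinearMap.id ℝ V + (1 : ℝ) • A x = fderiv ℝ f x := by simp [hA]
    simp only [hD, e]
    by_contra hne
    have hu := (LinearMap.isUnit_iff_isUnit_det _).2 (isUnit_iff_ne_zero.2 hne)
    have hsurj := LinearMap.range_eq_top.1 ((LinearMap.isUnit_iff_range_eq_top _).1 hu)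
    obtain ⟨w, hw⟩ := hsurj (f x)
    have hd : HasFDerivAt f (fderiv ℝ f x) x := (hf.differentiable one_ne_zero x).hasFDerivAt
    have h1 := hd.norm_sq
    have h2 : HasFDerivAt (fun y => ‖f y‖ ^ 2) (0 : V →L[ℝ] ℝ) x := by
      have : (fun y => ‖f y‖ ^ 2) = fun _ => ρ ^ 2 := by ext y; rw [hnorm]
      rw [this]; exact hasFDerivAt_const _ _
    have h3 := congrArg (fun T : V →L[ℝ] ℝ => T w) (h1.unique h2)
    have hw' : fderiv ℝ f x w = f x := hw
    simp [hw', hnorm] at h3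
    exact hρ.ne' h3
  simp_rw [hzero] at hI
  simp only [integral_zero] at hI
  have : 0 < (volume : Measure V).real B := by
    rw [measureReal_def]
    exact ENNReal.toReal_pos (measure_closedBall_pos _ _ hρ).ne' measure_closedBall_lt_top.ne
  linarith

/-- A continuous self-map of `V` which is the identity far away has a zero: otherwise it could be
smoothed and normalized to a retraction of a ball onto its boundary sphere. -/
theorem exists_eq_zero_of_eq_id {u : V → V} (hu : Continuous u) {R : ℝ}
    (hid : ∀ x, R < ‖x‖ → u x = x) : ∃ x, u x = 0 := by
  rcases subsingleton_or_nontrivial V with h | h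
  · exact ⟨0, Subsingleton.elim _ _⟩
  by_contra! hne
  set ρ := max R 0 + 1 with hρ
  have hρ0 : 0 < ρ := by positivity
  have hRρ : R < ρ := lt_of_le_of_lt (le_max_left R 0) (by linarith)
  have hS : IsClosed {x : V | ρ ≤ ‖x‖} := isClosed_le continuous_const continuous_norm
  have hU : {x : V | R < ‖x‖} ∈ nhdsSet {x : V | ρ ≤ ‖x‖} :=
    (isOpen_lt continuous_const continuous_norm).mem_nhdsSet.2 fun x hx =>
      hRρ.trans_le hx
  obtain ⟨g, hgC, hgd, hgS, -⟩ := hu.exists_contDiff_approx_and_eqOn 1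
    (ε := fun x => ‖u x‖) hu.norm (fun x => norm_pos_iff.2 (hne x)) hS hU
    (contDiffOn_id.congr hid)
  have hg0 : ∀ x, g x ≠ 0 := by
    intro x hx
    have := hgd x
    rw [hx, dist_zero_left] at this
    exact lt_irrefl _ this
  refine no_contDiff_retraction (f := fun x => (ρ * ‖g x‖⁻¹) • g x) ?_ hρ0 ?_ ?_
  · have hgC' : ContDiff ℝ 1 g := hgC
    exact (contDiff_const.mul ((hgC'.norm ℝ hg0).inv fun x => norm_ne_zero_iff.2 (hg0 x))).smul hgC'
  · intro x hx
    have : g x = x := by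
      rw [hgS (show ρ ≤ ‖x‖ from hx.ge), hid x (by rw [hx]; exact hRρ)]
    rw [this, hx, mul_inv_cancel₀ hρ0.ne', one_smul]
  · intro x
    rw [norm_smul, norm_mul, norm_inv, norm_norm, mul_assoc,
      inv_mul_cancel₀ (norm_ne_zero_iff.2 (hg0 x)), mul_one, Real.norm_of_nonneg hρ0.le]

/-- A continuous map on the closed unit ball at distance at most one from the identity has a
zero. -/
theorem exists_mem_closedBall_eq_zero {k : V → V} (hk : ContinuousOn k (closedBall 0 1))
    (hd : ∀ x ∈ closedBall (0 : V) 1, ‖k x - x‖ ≤ 1) : ∃ x ∈ closedBall (0 : V) 1, k x = 0 := by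
  -- radial projection to the ball, and a cutoff equal to `0` outside of the ball of radius `2`
  set pr : V → V := fun x => (max 1 ‖x‖)⁻¹ • x with hpr
  set χ : V → ℝ := fun x => max 0 (min 1 (2 - ‖x‖)) with hχ
  have hprB : ∀ x, pr x ∈ closedBall (0 : V) 1 := by
    intro x
    rw [mem_closedBall_zero_iff, hpr, norm_smul, norm_inv,
      Real.norm_of_nonneg (le_trans zero_le_one (le_max_left _ _))]
    rw [inv_mul_le_iff₀ (lt_of_lt_of_le one_pos (le_max_left _ _)), mul_one]
    exact le_max_right _ _
  have hprc : Continuous pr := by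
    refine Continuous.smul (Continuous.inv₀ (by fun_prop) fun x => ?_) continuous_id
    exact (lt_of_lt_of_le one_pos (le_max_left _ _)).ne'
  have hχc : Continuous χ := by fun_prop
  have hkc : Continuous fun x => k (pr x) := hk.comp_continuous hprc hprB
  obtain ⟨x, hx⟩ := exists_eq_zero_of_eq_id (u := fun x => x + χ x • (k (pr x) - pr x))
    (continuous_id.add (hχc.smul (hkc.sub hprc))) (R := 2) (by
      intro x hx
      have : χ x = 0 := by
        simp only [hχ]
        exact max_eq_left ((min_le_right _ _).trans (by linarith))
      simp [this])
  by_cases h1 : ‖x‖ ≤ 1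
  · have h2 : pr x = x := by simp [hpr, max_eq_left h1]
    have h3 : χ x = 1 := by
      simp only [hχ]
      rw [min_eq_left (by linarith), max_eq_right zero_le_one]
    refine ⟨x, by simpa using h1, ?_⟩
    rw [h2, h3] at hx
    simpa using hx
  · exfalso
    push Not at h1
    have h2 : ‖x‖ ≤ χ x * 1 := by
      have : x = -(χ x • (k (pr x) - pr x)) := by rw [eq_neg_iff_add_eq_zero]; exact hx
      have hχ0 : 0 ≤ χ x := le_max_left _ _
      calc ‖x‖ = ‖-(χ x • (k (pr x) - pr x))‖ := congrArg _ this
        _ = χ x * ‖k (pr x) - pr x‖ := by rw [norm_neg, norm_smul, Real.norm_of_nonneg hχ0]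
        _ ≤ χ x * 1 := by gcongr; exact hd _ (hprB x)
    have h3 : χ x ≤ 1 := max_le zero_le_one (min_le_left _ _)
    linarith

/-- The image of the closed unit ball under a continuous injection is a neighborhood of the image
of the centre. Otherwise the inverse map could be perturbed to have no zero on the image: push
the image off a nearby point `c` of the complement onto a small sphere around `c`, and approximate
the inverse by a smooth map, whose values on that sphere form a null set. -/
theorem image_closedBall_mem_nhds {f : V → V} (hf : ContinuousOn f (closedBall 0 1))
    (hinj : Set.InjOn f (closedBall 0 1)) : f '' closedBall 0 1 ∈ nhds (f 0) := by
  set B := closedBall (0 : V) 1 with hB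
  have h0B : (0 : V) ∈ B := by simp [hB]
  have : CompactSpace B := isCompact_iff_compactSpace.1 (isCompact_closedBall _ _)
  have hemb : Topology.IsClosedEmbedding (B.domRestrict f) :=
    (continuousOn_iff_continuous_domRestrict.1 hf).isClosedEmbedding
      (Set.injOn_iff_injective.1 hinj)
  obtain ⟨G, hG⟩ := ContinuousMap.exists_extension hemb
    (⟨Subtype.val, continuous_subtype_val⟩ : C(B, V))
  have hGf : ∀ x ∈ B, G (f x) = x := fun x hx => by
    have := congrArg (fun T : C(B, V) => T ⟨x, hx⟩) hG
    exact this
  set S := f '' B with hS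
  have hSc : IsCompact S := (isCompact_closedBall _ _).image_of_continuousOn hf
  by_contra hnot
  set a := f 0 with ha
  have hGa : G a = 0 := hGf 0 h0B
  obtain ⟨ε, hε, hGε⟩ : ∃ ε : ℝ, 0 < ε ∧ ∀ y, dist y a ≤ 2 * ε → ‖G y‖ ≤ 1 / 10 := by
    have hc := Metric.continuousAt_iff.1 (G.continuous.continuousAt (x := a)) (1 / 10) (by norm_num)
    obtain ⟨e, he, h⟩ := hc
    refine ⟨e / 3, by positivity, fun y hy => ?_⟩
    have := h (show dist y a < e by linarith)
    rw [hGa, dist_zero_right] at this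
    exact this.le
  obtain ⟨c, hca, hcS⟩ : ∃ c, dist c a < ε ∧ c ∉ S := by
    by_contra! h
    exact hnot (Filter.mem_of_superset (ball_mem_nhds a hε) fun y hy => h y hy)
  set S₁ := S ∩ {y | ε ≤ dist y c} with hS₁
  have hS₁c : IsCompact S₁ := hSc.inter_right (isClosed_le continuous_const (by fun_prop))
  have hG0 : ∀ y ∈ S₁, G y ≠ 0 := by
    rintro _ ⟨⟨x, hx, rfl⟩, hy⟩ h
    rw [hGf x hx] at h
    subst h
    have : ε ≤ dist a c := hy
    rw [dist_comm] at this
    linarith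
  obtain ⟨δ, hδ, hδ1, hδG⟩ : ∃ δ : ℝ, 0 < δ ∧ δ ≤ 1 / 10 ∧ ∀ y ∈ S₁, 2 * δ ≤ ‖G y‖ := by
    rcases S₁.eq_empty_or_nonempty with h | h
    · exact ⟨1 / 10, by norm_num, le_rfl, by simp [h]⟩
    · obtain ⟨y₀, hy₀, hmin⟩ := hS₁c.exists_isMinOn h G.continuous.norm.continuousOn
      have hp : 0 < ‖G y₀‖ := norm_pos_iff.2 (hG0 y₀ hy₀)
      refine ⟨min (1 / 10) (‖G y₀‖ / 2), by positivity, min_le_left _ _, fun y hy => ?_⟩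
      have h1 : ‖G y₀‖ ≤ ‖G y‖ := hmin hy
      linarith [min_le_right (1 / 10) (‖G y₀‖ / 2)]
  obtain ⟨P, hPC, hPd, -⟩ := G.continuous.exists_contDiff_approx 1 (ε := fun _ => δ)
    continuous_const (fun _ => hδ)
  have hnull : (volume : Measure V) (P '' sphere c ε) = 0 :=
    addHaar_image_eq_zero_of_differentiableOn_of_addHaar_eq_zero _
      (hPC.differentiable one_ne_zero).differentiableOn
      (Measure.addHaar_sphere_of_ne_zero _ _ hε.ne')
  obtain ⟨w, hwδ, hwP⟩ : ∃ w ∈ ball (0 : V) δ, w ∉ P '' sphere c ε := by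
    by_contra! h
    have := measure_mono_null (show ball (0 : V) δ ⊆ P '' sphere c ε from h) hnull
    exact (measure_ball_pos (volume : Measure V) 0 hδ).ne' this
  have hwδ' : ‖w‖ < δ := by simpa using hwδ
  have hPG : ∀ y, ‖(P y - w) - G y‖ < 2 * δ := by
    intro y
    have h1 : ‖P y - G y‖ < δ := by simpa [dist_eq_norm] using hPd y
    calc ‖(P y - w) - G y‖ = ‖(P y - G y) - w‖ := by congr 1; abel
      _ ≤ ‖P y - G y‖ + ‖w‖ := norm_sub_le _ _
      _ < 2 * δ := by linarith
  set Φ : V → V := fun y => c + (max (ε / dist y c) 1) • (y - c) with hΦ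
  have hΦ1 : ∀ y, ε ≤ dist y c → Φ y = y := by
    intro y hy
    have : ε / dist y c ≤ 1 := (div_le_one (hε.trans_le hy)).2 hy
    simp [hΦ, max_eq_right this]
  have hΦ2 : ∀ y ∈ S, dist y c < ε → Φ y ∈ sphere c ε := by
    intro y hyS hy
    have hyc : 0 < dist y c := dist_pos.2 (by rintro rfl; exact hcS hyS)
    have : 1 ≤ ε / dist y c := (one_le_div hyc).2 hy.le
    rw [mem_sphere, dist_eq_norm]
    simp only [hΦ, max_eq_left this, add_sub_cancel_left]
    rw [norm_smul, ← dist_eq_norm, Real.norm_of_nonneg (by positivity),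
      div_mul_cancel₀ _ hyc.ne']
  have hΦc : ContinuousOn Φ S := by
    refine continuousOn_const.add (ContinuousOn.smul (ContinuousOn.sup ?_ continuousOn_const)
      (by fun_prop))
    refine ContinuousOn.div continuousOn_const (by fun_prop) fun y hy => ?_
    exact (dist_pos.2 (by rintro rfl; exact hcS hy)).ne'
  obtain ⟨x, hx, hx0⟩ := exists_mem_closedBall_eq_zero (k := fun x => P (Φ (f x)) - w)
    ((hPC.continuous.comp_continuousOn (hΦc.comp hf (Set.mapsTo_image f B))).sub
      continuousOn_const) (by
      intro x hx
      have hyS : f x ∈ S := ⟨x, hx, rfl⟩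
      rcases le_or_gt ε (dist (f x) c) with h | h
      · rw [hΦ1 _ h]
        have := hPG (f x)
        rw [hGf x hx] at this
        linarith
      · have h1 := hΦ2 _ hyS h
        rw [mem_sphere] at h1
        have h2 : ‖G (Φ (f x))‖ ≤ 1 / 10 := hGε _ (by
          linarith [dist_triangle (Φ (f x)) c a])
        have h3 : ‖G (f x)‖ ≤ 1 / 10 := hGε _ (by linarith [dist_triangle (f x) c a])
        rw [hGf x hx] at h3
        have h4 := hPG (Φ (f x))
        calc ‖P (Φ (f x)) - w - x‖
            = ‖(P (Φ (f x)) - w - G (Φ (f x))) + G (Φ (f x)) - x‖ := by congr 1; abel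
          _ ≤ ‖P (Φ (f x)) - w - G (Φ (f x))‖ + ‖G (Φ (f x))‖ + ‖x‖ :=
            (norm_sub_le _ _).trans (by gcongr; exact norm_add_le _ _)
          _ ≤ 1 := by linarith)
  have hyS : f x ∈ S := ⟨x, hx, rfl⟩
  rcases le_or_gt ε (dist (f x) c) with h | h
  · rw [hΦ1 _ h] at hx0
    have h1 := hPG (f x)
    rw [hx0, zero_sub, norm_neg] at h1
    linarith [hδG (f x) ⟨hyS, h⟩]
  · exact hwP ⟨Φ (f x), hΦ2 _ hyS h, sub_eq_zero.1 hx0⟩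

end InvarianceOfDomain

/-- **Invariance of domain**, local form: a continuous injection of an open subset of a Euclidean
space into the space maps neighborhoods to neighborhoods. -/
theorem image_mem_nhds_of_injOn {V : Type*} [NormedAddCommGroup V] [InnerProductSpace ℝ V]
    [FiniteDimensional ℝ V] {f : V → V} {U : Set V} {x : V} (hU : U ∈ nhds x)
    (hf : ContinuousOn f U) (hinj : Set.InjOn f U) : f '' U ∈ nhds (f x) := by
  borelize V
  obtain ⟨r, hr, hrU⟩ := Metric.nhds_basis_closedBall.mem_iff.1 hU
  have hmaps : Set.MapsTo (fun z : V => x + r • z) (Metric.closedBall 0 1) U := by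
    intro z hz
    apply hrU
    rw [mem_closedBall_zero_iff] at hz
    rw [Metric.mem_closedBall, dist_eq_norm, add_sub_cancel_left, norm_smul, Real.norm_of_nonneg hr.le]
    nlinarith
  have h := image_closedBall_mem_nhds (f := fun z => f (x + r • z))
    (hf.comp (by fun_prop) hmaps) (by
      intro z hz z' hz' h
      have := hinj (hmaps hz) (hmaps hz') h
      exact smul_right_injective V hr.ne' (add_left_cancel this))
  simp only [smul_zero, add_zero] at h
  refine Filter.mem_of_superset h ?_
  rintro _ ⟨z, hz, rfl⟩
  exact ⟨_, hmaps hz, rfl⟩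

/-! ### Proper embeddings between manifolds are open -/

section Manifold

open Set Filter Topology

/-- A local homeomorphism detects manifold interior points. -/
lemma mem_manifoldInterior_iff {X Y : Type*} [TopologicalSpace X] [TopologicalSpace Y] {n : ℕ}
    (j : OpenPartialHomeomorph X Y) {x : X} (hx : x ∈ j.source) :
    j x ∈ manifoldInterior n Y ↔ x ∈ manifoldInterior n X := by
  constructor
  · rintro ⟨e, he⟩
    exact ⟨j.trans e, by simp [hx, he]⟩
  · rintro ⟨e, he⟩
    exact ⟨j.symm.trans e, by simp [j.map_source hx, j.left_inv hx, he]⟩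

lemma mem_manifoldBoundary_iff {X Y : Type*} [TopologicalSpace X] [TopologicalSpace Y] {n : ℕ}
    (j : OpenPartialHomeomorph X Y) {x : X} (hx : x ∈ j.source) :
    j x ∈ manifoldBoundary n Y ↔ x ∈ manifoldBoundary n X :=
  not_congr (mem_manifoldInterior_iff j hx)

lemma mem_manifoldBoundary_homeomorph {X Y : Type*} [TopologicalSpace X] [TopologicalSpace Y]
    {n : ℕ} (j : X ≃ₜ Y) (x : X) : j x ∈ manifoldBoundary n Y ↔ x ∈ manifoldBoundary n X :=
  mem_manifoldBoundary_iff j.toOpenPartialHomeomorph (mem_univ x)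

/-- At interior points of a subset, the boundaries of the subset and of the ambient space agree. -/
lemma mem_manifoldBoundary_subtype {X : Type*} [TopologicalSpace X] {n : ℕ} {A : Set X} (x : A)
    (hx : (x : X) ∈ interior A) :
    (x : X) ∈ manifoldBoundary n X ↔ x ∈ manifoldBoundary n A := by
  have : Nonempty (interior A) := ⟨⟨x, hx⟩⟩
  have h1 : IsOpenEmbedding (Subtype.val : interior A → X) := isOpen_interior.isOpenEmbedding_subtypeVal
  have h2 : IsOpenEmbedding (Set.inclusion (interior_subset (s := A))) := by
    refine ⟨.inclusion _, ?_⟩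
    rw [Set.range_inclusion]
    exact isOpen_interior.preimage continuous_subtype_val
  have e1 := mem_manifoldBoundary_iff (n := n) (h1.toOpenPartialHomeomorph _)
    (x := ⟨x, hx⟩) (by simp)
  have e2 := mem_manifoldBoundary_iff (n := n) (h2.toOpenPartialHomeomorph _)
    (x := ⟨x, hx⟩) (by simp)
  exact e1.trans e2.symm

lemma mem_halfSpace_succ {k : ℕ} {x : EuclideanSpace ℝ (Fin (k + 1))} :
    x ∈ halfSpace (k + 1) ↔ 0 ≤ x (Fin.last k) := by
  constructor
  · intro h; exact h (Fin.last k) (by simp)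
  · intro h i hi
    have : i = Fin.last k := by ext; simp; omega
    rwa [this]

/-- The reflection of Euclidean space in the boundary hyperplane of the half space. -/
noncomputable def reflectLast {k : ℕ} (y : EuclideanSpace ℝ (Fin (k + 1))) :
    EuclideanSpace ℝ (Fin (k + 1)) :=
  y - (2 * y (Fin.last k)) • EuclideanSpace.single (Fin.last k) 1

lemma reflectLast_last {k : ℕ} (y : EuclideanSpace ℝ (Fin (k + 1))) :
    reflectLast y (Fin.last k) = -y (Fin.last k) := by
  simp [reflectLast]; ring

lemma reflectLast_reflectLast {k : ℕ} (y : EuclideanSpace ℝ (Fin (k + 1))) :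
    reflectLast (reflectLast y) = y := by
  conv_lhs => rw [reflectLast, reflectLast_last]
  rw [reflectLast, sub_sub, ← add_smul]
  ring_nf
  simp

lemma reflectLast_of_eq_zero {k : ℕ} {y : EuclideanSpace ℝ (Fin (k + 1))}
    (hy : y (Fin.last k) = 0) : reflectLast y = y := by
  simp [reflectLast, hy]

lemma continuous_reflectLast {k : ℕ} : Continuous (reflectLast (k := k)) := by
  unfold reflectLast
  fun_prop

lemma continuous_last {k : ℕ} :
    Continuous fun y : EuclideanSpace ℝ (Fin (k + 1)) => y (Fin.last k) := by
  fun_prop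

/-- Invariance of domain at a boundary point of the half space, for maps which preserve the
boundary: doubling the map along the boundary reduces this to the full Euclidean space. -/
lemma image_mem_nhdsWithin_halfSpace {k : ℕ}
    {g : EuclideanSpace ℝ (Fin (k + 1)) → EuclideanSpace ℝ (Fin (k + 1))}
    {W : Set (EuclideanSpace ℝ (Fin (k + 1)))} {p : EuclideanSpace ℝ (Fin (k + 1))}
    (hW : W ∈ 𝓝[halfSpace (k + 1)] p) (hp : p (Fin.last k) = 0)
    (hg : ContinuousOn g W) (hinj : InjOn g W) (hmaps : MapsTo g W (halfSpace (k + 1)))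
    (hbd : ∀ y ∈ W, g y (Fin.last k) = 0 ↔ y (Fin.last k) = 0) :
    g '' W ∈ 𝓝[halfSpace (k + 1)] (g p) := by
  obtain ⟨O, hO, hpO, hOW⟩ := mem_nhdsWithin.1 hW
  set O' := O ∩ reflectLast ⁻¹' O with hO'
  have hpO' : p ∈ O' := ⟨hpO, by rw [mem_preimage, reflectLast_of_eq_zero hp]; exact hpO⟩
  have hO'o : IsOpen O' := hO.inter (hO.preimage continuous_reflectLast)
  have hup : ∀ y ∈ O', 0 ≤ y (Fin.last k) → y ∈ W := fun y hy h =>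
    hOW ⟨hy.1, mem_halfSpace_succ.2 h⟩
  have hdn : ∀ y ∈ O', y (Fin.last k) ≤ 0 → reflectLast y ∈ W := fun y hy h =>
    hOW ⟨hy.2, mem_halfSpace_succ.2 (by rw [reflectLast_last]; linarith)⟩
  have hpos : ∀ y ∈ W, 0 < y (Fin.last k) → 0 < g y (Fin.last k) := fun y hy h =>
    lt_of_le_of_ne (mem_halfSpace_succ.1 (hmaps hy)) fun h0 => h.ne' ((hbd y hy).1 h0.symm)
  set G : EuclideanSpace ℝ (Fin (k + 1)) → EuclideanSpace ℝ (Fin (k + 1)) := fun y =>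
    if 0 ≤ y (Fin.last k) then g y else reflectLast (g (reflectLast y)) with hG
  have hGup : ∀ y, 0 ≤ y (Fin.last k) → G y = g y := fun y h => if_pos h
  have hGdn : ∀ y, y (Fin.last k) < 0 → G y = reflectLast (g (reflectLast y)) := fun y h =>
    if_neg (not_le.2 h)
  have hGneg : ∀ y ∈ O', y (Fin.last k) < 0 → G y (Fin.last k) < 0 := by
    intro y hy h
    rw [hGdn y h, reflectLast_last, neg_lt_zero]
    exact hpos _ (hdn y hy h.le) (by rw [reflectLast_last]; linarith)
  have hGnonneg : ∀ y ∈ O', 0 ≤ y (Fin.last k) → 0 ≤ G y (Fin.last k) := by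
    intro y hy h
    rw [hGup y h]
    exact mem_halfSpace_succ.1 (hmaps (hup y hy h))
  have hGc : ContinuousOn G O' := by
    refine ContinuousOn.if ?_ ?_ ?_
    · rintro y ⟨hy, hfr⟩
      have h0 : y (Fin.last k) = 0 :=
        (frontier_le_subset_eq continuous_const continuous_last hfr).symm
      have hyW := hup y hy h0.ge
      rw [reflectLast_of_eq_zero h0, reflectLast_of_eq_zero ((hbd y hyW).2 h0)]
    · refine hg.mono ?_
      rintro y ⟨hy, hcl⟩
      rw [(isClosed_le continuous_const continuous_last).closure_eq] at hcl
      exact hup y hy hcl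
    · refine continuous_reflectLast.comp_continuousOn
        (hg.comp continuous_reflectLast.continuousOn ?_)
      rintro y ⟨hy, hcl⟩
      refine hdn y hy ?_
      have : closure {a : EuclideanSpace ℝ (Fin (k + 1)) | ¬ 0 ≤ a (Fin.last k)} ⊆
          {a | a (Fin.last k) ≤ 0} :=
        closure_minimal (fun a (ha : ¬ _) => (not_le.1 ha).le)
          (isClosed_le continuous_last continuous_const)
      exact this hcl
  have hGinj : InjOn G O' := by
    intro y hy z hz h
    rcases le_or_gt 0 (y (Fin.last k)) with h1 | h1 <;>
      rcases le_or_gt 0 (z (Fin.last k)) with h2 | h2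
    · rw [hGup y h1, hGup z h2] at h
      exact hinj (hup y hy h1) (hup z hz h2) h
    · exact absurd (hGnonneg y hy h1) (not_le.2 (h ▸ hGneg z hz h2))
    · exact absurd (hGnonneg z hz h2) (not_le.2 (h ▸ hGneg y hy h1))
    · rw [hGdn y h1, hGdn z h2] at h
      have h3 := congrArg reflectLast h
      rw [reflectLast_reflectLast, reflectLast_reflectLast] at h3
      have h4 := congrArg reflectLast (hinj (hdn y hy h1.le) (hdn z hz h2.le) h3)
      rwa [reflectLast_reflectLast, reflectLast_reflectLast] at h4
  have hnh := image_mem_nhds_of_injOn (hO'o.mem_nhds hpO') hGc hGinj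
  rw [hGup p hp.ge] at hnh
  refine mem_of_superset (inter_mem (mem_nhdsWithin_of_mem_nhds hnh) self_mem_nhdsWithin) ?_
  rintro _ ⟨⟨y, hy, rfl⟩, hH⟩
  rcases le_or_gt 0 (y (Fin.last k)) with h1 | h1
  · exact ⟨y, hup y hy h1, (hGup y h1).symm⟩
  · exact absurd (mem_halfSpace_succ.1 hH) (not_le.2 (hGneg y hy h1))

/-- The manifold boundary of the half space is its boundary hyperplane. -/
lemma mem_manifoldInterior_halfSpace {k : ℕ} (p : halfSpace (k + 1)) :
    p ∈ manifoldInterior (k + 1) (halfSpace (k + 1)) ↔ 0 < (p : EuclideanSpace ℝ _) (Fin.last k) := by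
  constructor
  · rintro ⟨e, he⟩
    by_contra hle
    have h0 : (p : EuclideanSpace ℝ (Fin (k + 1))) (Fin.last k) ≤ 0 := not_lt.1 hle
    have h := image_mem_nhds_of_injOn (f := fun z => (e.symm z : EuclideanSpace ℝ (Fin (k + 1))))
      (e.open_target.mem_nhds (e.map_source he))
      (continuous_subtype_val.comp_continuousOn e.continuousOn_symm)
      (Subtype.val_injective.comp_injOn e.symm.injOn)
    simp only [e.left_inv he] at h
    -- moving down from `p` leaves the half space
    have ht : Tendsto (fun t : ℝ => (p : EuclideanSpace ℝ (Fin (k + 1)))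
        - t • EuclideanSpace.single (Fin.last k) (1 : ℝ)) (𝓝[>] 0) (𝓝 p) := by
      have : Continuous (fun t : ℝ => (p : EuclideanSpace ℝ (Fin (k + 1)))
        - t • EuclideanSpace.single (Fin.last k) (1 : ℝ)) := by fun_prop
      have h := this.tendsto 0
      simp only [zero_smul, sub_zero] at h
      exact h.mono_left nhdsWithin_le_nhds
    obtain ⟨t, ⟨z, hz, hzt⟩, ht0⟩ := ((ht.eventually h).and self_mem_nhdsWithin).exists
    have h1 := mem_halfSpace_succ.1 (e.symm z).2
    simp only at hzt
    rw [hzt] at h1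
    have h2 : (0 : ℝ) < t := ht0
    simp at h1
    linarith
  · intro hp
    have hi : (p : EuclideanSpace ℝ (Fin (k + 1))) ∈ interior (halfSpace (k + 1)) :=
      mem_interior.2 ⟨{y | 0 < y (Fin.last k)}, fun y hy => mem_halfSpace_succ.2 (le_of_lt hy),
        isOpen_lt continuous_const continuous_last, hp⟩
    have := mem_manifoldBoundary_subtype (n := k + 1) p hi
    refine (not_iff_not.1 this).1 ⟨OpenPartialHomeomorph.refl _, mem_univ _⟩

lemma mem_manifoldInterior_iff_chart {X : Type*} [TopologicalSpace X] {k : ℕ}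
    (e : OpenPartialHomeomorph X (halfSpace (k + 1))) {x : X} (hx : x ∈ e.source) :
    x ∈ manifoldInterior (k + 1) X ↔ 0 < (e x : EuclideanSpace ℝ _) (Fin.last k) := by
  rw [← mem_manifoldInterior_halfSpace, mem_manifoldInterior_iff e hx]

/-- **Invariance of domain for manifolds with boundary**: a continuous injection of an open set
which preserves the manifold interior and the manifold boundary is open. -/
theorem image_mem_nhds_of_manifold {X Y : Type*} [TopologicalSpace X] [TopologicalSpace Y] {k : ℕ}
    (hX : IsTopManifold (k + 1) X) (hY : IsTopManifold (k + 1) Y) {f : X → Y} {U : Set X}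
    {x : X} (hU : U ∈ 𝓝 x) (hf : ContinuousOn f U) (hinj : InjOn f U)
    (hbd : ∀ y ∈ U, f y ∈ manifoldBoundary (k + 1) Y ↔ y ∈ manifoldBoundary (k + 1) X) :
    f '' U ∈ 𝓝 (f x) := by
  have hxU : x ∈ U := mem_of_mem_nhds hU
  have hfx : ContinuousAt f x := hf.continuousAt hU
  by_cases hx : x ∈ manifoldInterior (k + 1) X
  · have hfxi : f x ∈ manifoldInterior (k + 1) Y := (not_iff_not.1 (hbd x hxU)).2 hx
    obtain ⟨e, he⟩ := hx
    obtain ⟨e', he'⟩ := hfxi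
    set U' := U ∩ f ⁻¹' e'.source with hU'
    have hU'x : U' ∈ 𝓝 x := inter_mem hU (hfx.preimage_mem_nhds (e'.open_source.mem_nhds he'))
    set W := e.target ∩ e.symm ⁻¹' U' with hW
    have hWx : W ∈ 𝓝 (e x) := by
      refine inter_mem (e.open_target.mem_nhds (e.map_source he))
        ((e.continuousAt_symm (e.map_source he)).preimage_mem_nhds ?_)
      rwa [e.left_inv he]
    have hmaps : MapsTo e.symm W U := fun z hz => hz.2.1
    have h := image_mem_nhds_of_injOn (f := fun z => e' (f (e.symm z))) hWx
      (e'.continuousOn.comp (hf.comp (e.continuousOn_symm.mono fun z hz => hz.1) hmaps)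
        fun z hz => hz.2.2) (by
        intro z hz z' hz' h
        have h1 := hinj (hmaps hz) (hmaps hz') (e'.injOn hz.2.2 hz'.2.2 h)
        exact e.symm.injOn hz.1 hz'.1 h1)
    simp only [e.left_inv he] at h
    refine mem_of_superset (inter_mem (e'.open_source.mem_nhds he')
      ((e'.continuousAt he').preimage_mem_nhds h)) ?_
    rintro y ⟨hy, z, hz, hzy⟩
    exact ⟨e.symm z, hmaps hz, e'.injOn hz.2.2 hy hzy⟩
  · have hfxb : f x ∉ manifoldInterior (k + 1) Y := (hbd x hxU).2 hx
    obtain ⟨e, he⟩ := hX.chart x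
    obtain ⟨e', he'⟩ := hY.chart (f x)
    set U' := U ∩ f ⁻¹' e'.source with hU'
    have hU'x : U' ∈ 𝓝 x := inter_mem hU (hfx.preimage_mem_nhds (e'.open_source.mem_nhds he'))
    set W' := e.target ∩ e.symm ⁻¹' U' with hW'
    have hWx : W' ∈ 𝓝 (e x) := by
      refine inter_mem (e.open_target.mem_nhds (e.map_source he))
        ((e.continuousAt_symm (e.map_source he)).preimage_mem_nhds ?_)
      rwa [e.left_inv he]
    have hlast : ∀ {q : halfSpace (k + 1)}, ¬ 0 < (q : EuclideanSpace ℝ _) (Fin.last k) →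
        (q : EuclideanSpace ℝ _) (Fin.last k) = 0 := fun {q} h =>
      le_antisymm (not_lt.1 h) (mem_halfSpace_succ.1 q.2)
    classical
    -- the coordinate expression of `f`, extended by zero
    set G : halfSpace (k + 1) → EuclideanSpace ℝ (Fin (k + 1)) := fun z => e' (f (e.symm z)) with hG
    set g : EuclideanSpace ℝ (Fin (k + 1)) → EuclideanSpace ℝ (Fin (k + 1)) := fun z =>
      if h : z ∈ halfSpace (k + 1) then G ⟨z, h⟩ else 0 with hg
    have hgG : ∀ z : halfSpace (k + 1), g z = G z := fun z => dif_pos z.2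
    have hmaps : MapsTo e.symm W' U := fun z hz => hz.2.1
    have hGc : ContinuousOn G W' := continuous_subtype_val.comp_continuousOn
      (e'.continuousOn.comp (hf.comp (e.continuousOn_symm.mono fun z hz => hz.1) hmaps)
        fun z hz => hz.2.2)
    have hGinj : InjOn G W' := by
      intro z hz z' hz' h
      have h1 := hinj (hmaps hz) (hmaps hz') (e'.injOn hz.2.2 hz'.2.2 (Subtype.val_injective h))
      exact e.symm.injOn hz.1 hz'.1 h1
    have hgc : ContinuousOn g (Subtype.val '' W') := by
      have h := Topology.IsEmbedding.subtypeVal (p := (· ∈ halfSpace (k + 1)))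
      rw [h.isInducing.continuousOn_image_iff]
      exact hGc.congr fun z _ => hgG z
    have h := image_mem_nhdsWithin_halfSpace (g := g) (W := Subtype.val '' W') (p := e x)
      (by
        rw [nhdsWithin_eq_map_subtype_coe (e x).2]
        exact image_mem_map hWx)
      (hlast fun h => hx ((mem_manifoldInterior_iff_chart e he).2 h))
      hgc
      (by
        rintro _ ⟨z, hz, rfl⟩ _ ⟨z', hz', rfl⟩ h
        rw [hgG, hgG] at h
        rw [hGinj hz hz' h])
      (by rintro _ ⟨z, hz, rfl⟩; rw [hgG]; exact (e' (f (e.symm z))).2)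
      (by
        rintro _ ⟨z, hz, rfl⟩
        rw [hgG]
        have h1 := not_iff_not.1 (hbd _ (hmaps hz))
        rw [mem_manifoldInterior_iff_chart e' hz.2.2,
          mem_manifoldInterior_iff_chart e (e.map_target hz.1), e.right_inv hz.1] at h1
        constructor
        · intro h0; exact hlast fun h2 => (h1.2 h2).ne' h0
        · intro h0; exact hlast fun h2 => (h1.1 h2).ne' h0)
    rw [hgG, hG] at h
    simp only [e.left_inv he] at h
    rw [nhdsWithin_eq_map_subtype_coe (e' (f x)).2, mem_map] at h
    refine mem_of_superset (inter_mem (e'.open_source.mem_nhds he')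
      ((e'.continuousAt he').preimage_mem_nhds h)) ?_
    rintro y ⟨hy, _, ⟨z, hz, rfl⟩, hzy⟩
    rw [hgG] at hzy
    exact ⟨e.symm z, hmaps hz, e'.injOn hz.2.2 hy (Subtype.val_injective hzy)⟩

end Manifold

/-! ### The radial structure of a product end -/

section Radial

open Set Filter Topology

universe u

variable {n : ℕ} {M : Type u} [MetricSpace M] (E : ProperProductEndIn n M)

namespace ProperProductEndIn

/-- The radial coordinate `L ≈ S × [1, ∞) → ℝ`. -/
def rad (x : E.L) : ℝ := (E.str.θ.symm x).2

lemma one_le_rad (x : E.L) : 1 ≤ E.rad x := (E.str.θ.symm x).2.2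

lemma continuous_rad : Continuous E.rad := by
  unfold rad; fun_prop

lemma mem_tail_iff {r : ℝ} {x : M} : x ∈ E.tail r ↔ ∃ hx : x ∈ E.L, r ≤ E.rad ⟨x, hx⟩ := by
  constructor
  · rintro ⟨p, hp, rfl⟩
    refine ⟨(E.str.θ p).2, ?_⟩
    simpa [rad] using hp
  · rintro ⟨hx, h⟩
    exact ⟨E.str.θ.symm ⟨x, hx⟩, h, by simp⟩

lemma coe_mem_tail {r : ℝ} {x : E.L} : (x : M) ∈ E.tail r ↔ r ≤ E.rad x := by
  rw [mem_tail_iff]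
  exact ⟨fun h => h.2, fun h => ⟨x.2, h⟩⟩

lemma tail_subset (r : ℝ) : E.tail r ⊆ E.L := fun _ hx => (E.mem_tail_iff.1 hx).1

lemma tail_anti {r s : ℝ} (h : r ≤ s) : E.tail s ⊆ E.tail r := fun _ hx => by
  obtain ⟨hx, h'⟩ := E.mem_tail_iff.1 hx
  exact E.mem_tail_iff.2 ⟨hx, h.trans h'⟩

lemma tail_eq_image (r : ℝ) : E.tail r = Subtype.val '' {x : E.L | r ≤ E.rad x} := by
  ext x
  rw [mem_tail_iff]
  constructor
  · rintro ⟨hx, h⟩; exact ⟨⟨x, hx⟩, h, rfl⟩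
  · rintro ⟨y, h, rfl⟩; exact ⟨y.2, h⟩

lemma isClosed_tail (r : ℝ) : IsClosed (E.tail r) := by
  rw [tail_eq_image]
  exact E.isClosed.isClosedMap_subtype_val _ (isClosed_le continuous_const E.continuous_rad)

lemma isCompact_rad_le (R : ℝ) : IsCompact {x : E.L | E.rad x ≤ R} := by
  have := E.str.compactS
  have h : IsCompact (E.str.θ '' (univ ×ˢ {r : Ici (1 : ℝ) | (r : ℝ) ≤ R})) := by
    refine (isCompact_univ.prod ?_).image E.str.θ.continuous
    rw [Subtype.isCompact_iff]
    have : Subtype.val '' {r : Ici (1 : ℝ) | (r : ℝ) ≤ R} = Icc 1 R := by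
      ext r; simp [and_comm]
    rw [this]
    exact isCompact_Icc
  refine h.of_isClosed_subset (isClosed_le E.continuous_rad continuous_const) fun x hx => ?_
  exact ⟨E.str.θ.symm x, ⟨mem_univ _, hx⟩, by simp⟩

/-- The compact part `θ(S × [1, R])` of the end, as a subset of `M`. -/
def shell (R : ℝ) : Set M := Subtype.val '' {x : E.L | E.rad x ≤ R}

lemma isCompact_shell (R : ℝ) : IsCompact (E.shell R) :=
  (E.isCompact_rad_le R).image continuous_subtype_val

lemma mem_shell {R : ℝ} {x : E.L} : (x : M) ∈ E.shell R ↔ E.rad x ≤ R := by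
  simp [shell]

variable {E} in
/-- The end minus a shell is open in the ambient space. -/
lemma isOpen_rad_gt (hint : E.tail 2 ⊆ interior E.L) {r : ℝ} (hr : 2 ≤ r) :
    IsOpen (Subtype.val '' {x : E.L | r < E.rad x} : Set M) := by
  have h1 : IsOpen {x : E.L | r < E.rad x} := isOpen_lt continuous_const E.continuous_rad
  obtain ⟨O, hO, hOe⟩ := isOpen_induced_iff.1 h1
  have : (Subtype.val '' {x : E.L | r < E.rad x} : Set M) = O ∩ interior E.L := by
    ext x
    constructor
    · rintro ⟨y, hy, rfl⟩
      refine ⟨?_, hint (E.coe_mem_tail.2 (hr.trans (le_of_lt hy)))⟩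
      have : y ∈ Subtype.val ⁻¹' O := by rw [hOe]; exact hy
      exact this
    · rintro ⟨hxO, hxi⟩
      have hxL := interior_subset hxi
      have : (⟨x, hxL⟩ : E.L) ∈ Subtype.val ⁻¹' O := hxO
      rw [hOe] at this
      exact ⟨_, this, rfl⟩
  rw [this]
  exact hO.inter isOpen_interior

variable {E} in
lemma mem_interior_tail (hint : E.tail 2 ⊆ interior E.L) {r : ℝ} (hr : 2 ≤ r) {x : E.L}
    (hx : r < E.rad x) : (x : M) ∈ interior (E.tail r) :=
  mem_interior.2 ⟨_, by
    rintro _ ⟨y, hy, rfl⟩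
    exact E.coe_mem_tail.2 (le_of_lt hy), isOpen_rad_gt hint hr, x, hx, rfl⟩

variable {E} in
/-- A point of `L_r` outside of its interior lies on level `r`. -/
lemma rad_eq_of_not_mem_interior (hint : E.tail 2 ⊆ interior E.L) {r : ℝ} (hr : 2 ≤ r) {x : E.L}
    (hx : (x : M) ∈ E.tail r) (hx' : (x : M) ∉ interior (E.tail r)) : E.rad x = r :=
  le_antisymm (not_lt.1 fun h => hx' (mem_interior_tail hint hr h)) (E.coe_mem_tail.1 hx)

lemma exists_tail_subset_of_cofinal {F : Set E.L} (hF : F ∈ cofinalClosed E.L) :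
    ∃ R : ℝ, ∀ x : E.L, R ≤ E.rad x → x ∈ F := by
  obtain ⟨B, hB⟩ := (hF.2.image E.continuous_rad).bddAbove
  refine ⟨B + 1, fun x hx => ?_⟩
  by_contra h
  have := hB ⟨x, subset_closure h, rfl⟩
  linarith

/-- The set `L_c` as a subset of `L`. -/
def level (c : ℝ) : Set E.L := {x | c ≤ E.rad x}

lemma level_mem_cofinalClosed (r : ℝ) : E.level r ∈ cofinalClosed E.L := by
  refine ⟨isClosed_le continuous_const E.continuous_rad,
    (E.isCompact_rad_le r).of_isClosed_subset isClosed_closure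
      (closure_minimal ?_ (isClosed_le E.continuous_rad continuous_const))⟩
  intro x hx
  exact (not_le.1 (show ¬ r ≤ E.rad x from hx)).le

variable {E}

lemma IsIsolated.exists_dist_ge (hiso : E.IsIsolated) {c : ℝ} (hc : 0 < c) :
    ∃ R : ℝ, ∀ x ∈ E.tail R, ∀ y ∉ E.L, c ≤ dist x y := by
  obtain ⟨F, hF, h⟩ := hiso c hc
  obtain ⟨R, hR⟩ := E.exists_tail_subset_of_cofinal hF
  refine ⟨R, fun x hx y hy => ?_⟩
  obtain ⟨hxL, hxR⟩ := E.mem_tail_iff.1 hx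
  have h1 : ENNReal.ofReal c < edist y x := h.trans_le
    ((iInf₂_le y hy).trans (iInf₂_le (⟨x, hxL⟩ : E.L) (hR _ hxR)))
  rw [edist_dist, dist_comm] at h1
  exact (ENNReal.ofReal_lt_ofReal_iff_of_nonneg hc.le |>.1 h1).le

lemma IsIsolated.exists_pos_dist_ge (hiso : E.IsIsolated) (hint : E.tail 2 ⊆ interior E.L) :
    ∃ c : ℝ, 0 < c ∧ ∀ x ∈ E.tail 2, ∀ y ∉ E.L, c ≤ dist x y := by
  obtain ⟨R, hR⟩ := hiso.exists_dist_ge one_pos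
  have hK : IsCompact (E.tail 2 ∩ E.shell R) := (E.isCompact_shell R).inter_left (E.isClosed_tail 2)
  obtain ⟨δ, hδ, hδK⟩ := hK.exists_thickening_subset_open isOpen_interior
    (inter_subset_left.trans hint)
  refine ⟨min δ 1, by positivity, fun x hx y hy => ?_⟩
  obtain ⟨hxL, -⟩ := E.mem_tail_iff.1 hx
  rcases le_total R (E.rad ⟨x, hxL⟩) with h | h
  · exact (min_le_right _ _).trans (hR x (E.mem_tail_iff.2 ⟨hxL, h⟩) y hy)
  · refine (min_le_left _ _).trans ?_
    by_contra hlt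
    refine hy (interior_subset (hδK (Metric.mem_thickening_iff.2 ⟨x, ⟨hx, ?_⟩, ?_⟩)))
    · exact (E.mem_shell (x := ⟨x, hxL⟩)).2 h
    · rw [dist_comm]; exact not_le.1 hlt

variable (E)

/-- The number `max 1 r` as a point of `[1, ∞)`. -/
def toIci (r : ℝ) : Ici (1 : ℝ) := ⟨max 1 r, mem_Ici.2 (le_max_left _ _)⟩

@[simp] lemma coe_toIci (r : ℝ) : (toIci r : ℝ) = max 1 r := rfl

lemma continuous_toIci : Continuous toIci :=
  (continuous_const.max continuous_id).subtype_mk _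

open Classical in
/-- The self-map of `M` which acts on the end by `θ(p, r) ↦ θ(p, γ r)` and is the identity
elsewhere. Values of `γ` below `1` are replaced by `1`. -/
noncomputable def radialMap (γ : ℝ → ℝ) (x : M) : M :=
  if hx : x ∈ E.L then
    E.str.θ ((E.str.θ.symm ⟨x, hx⟩).1, toIci (γ (E.rad ⟨x, hx⟩)))
  else x

lemma radialMap_of_not_mem {γ : ℝ → ℝ} {x : M} (hx : x ∉ E.L) : E.radialMap γ x = x :=
  dif_neg hx

lemma radialMap_coe (γ : ℝ → ℝ) (x : E.L) : E.radialMap γ x =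
    E.str.θ ((E.str.θ.symm x).1, toIci (γ (E.rad x))) :=
  dif_pos x.2

lemma radialMap_mem {γ : ℝ → ℝ} {x : M} (hx : x ∈ E.L) : E.radialMap γ x ∈ E.L := by
  rw [E.radialMap_coe γ ⟨x, hx⟩]; exact Subtype.property _

lemma rad_radialMap {γ : ℝ → ℝ} (x : E.L) :
    E.rad ⟨E.radialMap γ x, E.radialMap_mem x.2⟩ = max 1 (γ (E.rad x)) := by
  have : (⟨E.radialMap γ x, E.radialMap_mem x.2⟩ : E.L) =
    E.str.θ ((E.str.θ.symm x).1, toIci (γ (E.rad x))) :=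
    Subtype.ext (E.radialMap_coe γ x)
  rw [this, rad, Homeomorph.symm_apply_apply, coe_toIci]

lemma radialMap_eq_self {γ : ℝ → ℝ} (x : E.L) (h : γ (E.rad x) = E.rad x) :
    E.radialMap γ x = x := by
  rw [E.radialMap_coe]
  have : (E.str.θ.symm x).2 = toIci (γ (E.rad x)) := by
    ext
    rw [coe_toIci, h]
    exact (max_eq_right (E.one_le_rad x)).symm
  rw [← this]
  simp

lemma radialMap_radialMap {γ γ' : ℝ → ℝ} (h : ∀ r, 1 ≤ r → γ (γ' r) = r)
    (h' : ∀ r, 1 ≤ r → 1 ≤ γ' r) (x : M) : E.radialMap γ (E.radialMap γ' x) = x := by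
  by_cases hx : x ∈ E.L
  · have e := E.rad_radialMap (γ := γ') ⟨x, hx⟩
    rw [max_eq_right (h' _ (E.one_le_rad _))] at e
    rw [E.radialMap_coe γ ⟨_, E.radialMap_mem hx⟩]
    simp only [e, h _ (E.one_le_rad _)]
    have e2 : (⟨E.radialMap γ' x, E.radialMap_mem hx⟩ : E.L) =
      E.str.θ ((E.str.θ.symm ⟨x, hx⟩).1, toIci (γ' (E.rad ⟨x, hx⟩))) :=
      Subtype.ext (E.radialMap_coe γ' ⟨x, hx⟩)
    rw [e2, Homeomorph.symm_apply_apply]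
    have e3 : (E.str.θ.symm ⟨x, hx⟩).2 = toIci (E.rad ⟨x, hx⟩) := by
      ext
      exact (max_eq_right (E.one_le_rad _)).symm
    rw [← e3]
    simp
  · rw [E.radialMap_of_not_mem hx, E.radialMap_of_not_mem hx]

variable {E}

lemma radialMap_mem_tail {γ : ℝ → ℝ} {r s : ℝ} (hγ : ∀ ρ, r ≤ ρ → s ≤ γ ρ)
    {x : M} (hx : x ∈ E.tail r) : E.radialMap γ x ∈ E.tail s := by
  obtain ⟨hxL, h⟩ := E.mem_tail_iff.1 hx
  refine E.mem_tail_iff.2 ⟨E.radialMap_mem hxL, ?_⟩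
  have := E.rad_radialMap (γ := γ) ⟨x, hxL⟩
  rw [this]
  exact (hγ _ h).trans (le_max_right _ _)

/-- A continuous family of radial functions, each the identity on `[1, 2]`, defines a continuous
family of self-maps of `M`. -/
lemma continuous_radialMap {T : Type*} [TopologicalSpace T] (hint : E.tail 2 ⊆ interior E.L)
    {γ : T → ℝ → ℝ} (hγ : Continuous fun p : T × ℝ => γ p.1 p.2) (hid : ∀ t r, r ≤ 2 → γ t r = r) :
    Continuous fun p : T × M => E.radialMap (γ p.1) p.2 := by
  rw [continuous_iff_continuousAt]
  rintro ⟨t, x⟩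
  by_cases hx : x ∈ E.tail 2
  · -- on the interior of `L` the map is given by a continuous formula
    have hO : IsOpen (univ ×ˢ interior E.L : Set (T × M)) := isOpen_univ.prod isOpen_interior
    refine ContinuousOn.continuousAt (s := univ ×ˢ interior E.L) ?_
      (hO.mem_nhds ⟨mem_univ _, hint hx⟩)
    rw [continuousOn_iff_continuous_domRestrict]
    let toL : (univ ×ˢ interior E.L : Set (T × M)) → E.L := fun p =>
      ⟨p.1.2, interior_subset p.2.2⟩
    have htoL : Continuous toL := by
      refine Continuous.subtype_mk ?_ _
      exact continuous_snd.comp continuous_subtype_val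
    have hradc : Continuous fun p => E.rad (toL p) := E.continuous_rad.comp htoL
    have : ((univ ×ˢ interior E.L : Set (T × M)).domRestrict
        fun p : T × M => E.radialMap (γ p.1) p.2) = fun p => ((E.str.θ ((E.str.θ.symm (toL p)).1,
          toIci (γ p.1.1 (E.rad (toL p)))) : E.L) : M) := by
      ext p
      exact E.radialMap_coe (γ p.1.1) (toL p)
    rw [this]
    refine continuous_subtype_val.comp (E.str.θ.continuous.comp (Continuous.prodMk ?_ ?_))
    · exact continuous_fst.comp (E.str.θ.symm.continuous.comp htoL)
    · exact continuous_toIci.comp <| hγ.comp ((continuous_fst.comp continuous_subtype_val).prodMk hradc)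
  · have hO : (univ ×ˢ (E.tail 2)ᶜ : Set (T × M)) ∈ 𝓝 (t, x) :=
      (isOpen_univ.prod (E.isClosed_tail 2).isOpen_compl).mem_nhds ⟨mem_univ _, hx⟩
    refine (continuousAt_snd (p := (t, x))).congr ?_
    filter_upwards [hO]
    rintro ⟨t', x'⟩ ⟨-, hx'⟩
    by_cases hL : x' ∈ E.L
    · have : E.rad ⟨x', hL⟩ ≤ 2 := by
        by_contra h
        exact hx' (E.mem_tail_iff.2 ⟨hL, (not_le.1 h).le⟩)
      exact (E.radialMap_eq_self ⟨x', hL⟩ (hid _ _ this)).symm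
    · exact (E.radialMap_of_not_mem hL).symm

lemma radialMap_eq_self_of_not_mem_shell {γ : ℝ → ℝ} {R : ℝ} (hid : ∀ r, R ≤ r → γ r = r) {x : M}
    (hx : x ∉ E.shell R) : E.radialMap γ x = x := by
  by_cases hL : x ∈ E.L
  · refine E.radialMap_eq_self ⟨x, hL⟩ (hid _ ?_)
    by_contra h
    exact hx ((E.mem_shell (x := ⟨x, hL⟩)).2 (not_le.1 h).le)
  · exact E.radialMap_of_not_mem hL

end ProperProductEndIn

/-- A continuous map which is the identity off a compact set is uniformly continuous. -/
lemma uniformContinuous_of_eq_id_off_compact {X : Type*} [UniformSpace X] {f : X → X}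
    (hf : Continuous f) {K : Set X} (hK : IsCompact K) (hid : ∀ x ∉ K, f x = x) :
    UniformContinuous f := by
  intro r hr
  have h1 := hK.uniformContinuousAt_of_continuousAt f (fun a _ => hf.continuousAt)
    (symm_le_uniformity hr)
  have h1' := hK.uniformContinuousAt_of_continuousAt f (fun a _ => hf.continuousAt) hr
  have h2 := symm_le_uniformity h1
  rw [mem_map]
  filter_upwards [h1', h2, hr] with p hp1 hp2 hp3
  by_cases hx : p.1 ∈ K
  · exact hp1 hx
  by_cases hy : p.2 ∈ K
  · exact hp2 hy
  · change (f p.1, f p.2) ∈ r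
    rw [hid _ hx, hid _ hy]
    exact hp3

/-- A jointly continuous family of self-maps which are the identity off a common compact set is
continuous for the topology of uniform convergence. -/
lemma continuousAt_ofFun_of_eq_id_off_compact {T X : Type*} [TopologicalSpace T] [UniformSpace X]
    {Γ : T → X → X} (hΓ : Continuous fun p : T × X => Γ p.1 p.2) {K : Set X} (hK : IsCompact K)
    {t₀ : T} (hid : ∀ᶠ t in 𝓝 t₀, ∀ x ∉ K, Γ t x = x) :
    ContinuousAt (fun t => UniformFun.ofFun (Γ t)) t₀ := by
  rw [ContinuousAt, UniformFun.tendsto_iff_tendstoUniformly]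
  intro r hr
  have h : ∀ᶠ t in 𝓝 t₀, ∀ x ∈ K, (Γ t₀ x, Γ t x) ∈ r := by
    refine hK.eventually_forall_of_forall_eventually fun x _ => ?_
    have h1 : ContinuousAt (fun p : T × X => (Γ t₀ p.2, Γ p.1 p.2)) (t₀, x) :=
      ((hΓ.comp (continuous_const.prodMk continuous_snd)).prodMk hΓ).continuousAt
    exact h1.preimage_mem_nhds (nhds_le_uniformity _ hr)
  filter_upwards [h, hid] with t ht ht' x
  by_cases hx : x ∈ K
  · exact ht x hx
  · change (Γ t₀ x, Γ t x) ∈ r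
    rw [ht' x hx, hid.self_of_nhds x hx]
    exact refl_mem_uniformity hr

/-- Composition is continuous for the topology of uniform convergence at pairs whose outer map is
uniformly continuous. -/
lemma tendsto_ofFun_comp {ι X : Type*} [UniformSpace X] {l : Filter ι} {F G : ι → X →ᵤ X}
    {f g : X →ᵤ X} (hF : Tendsto F l (𝓝 f)) (hG : Tendsto G l (𝓝 g))
    (hf : UniformContinuous (UniformFun.toFun f)) :
    Tendsto (fun i => UniformFun.ofFun (UniformFun.toFun (F i) ∘ UniformFun.toFun (G i))) l
      (𝓝 (UniformFun.ofFun (UniformFun.toFun f ∘ UniformFun.toFun g))) := by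
  rw [UniformFun.tendsto_iff_tendstoUniformly] at *
  intro r hr
  obtain ⟨s, hs, hsr⟩ := comp_mem_uniformity_sets hr
  filter_upwards [hF s hs, (hf.comp_tendstoUniformly hG) s hs] with i h1 h2 x
  exact hsr ⟨_, h2 x, h1 _⟩

/-! ### Stretching homeomorphisms of the ray -/

/-- The maximum of the identity and the minimum of two increasing bijections is inverted by the
minimum of the identity and the maximum of their inverses. -/
lemma min_max_max_min_eq {α : Type*} [LinearOrder α] {f f' g g' : α → α}
    (hf : ∀ x y, f x ≤ y ↔ x ≤ f' y) (hg : ∀ x y, g x ≤ y ↔ x ≤ g' y)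
    (hf' : ∀ x, f' (f x) = x) (hg' : ∀ x, g' (g x) = x) (x : α) :
    min (max x (min (f x) (g x))) (max (f' (max x (min (f x) (g x))))
      (g' (max x (min (f x) (g x))))) = x := by
  set r := max x (min (f x) (g x)) with hr
  have hxr : x ≤ r := le_max_left _ _
  rcases le_total (min (f x) (g x)) x with h | h
  · have hrx : r = x := max_eq_left h
    rw [hrx]
    refine min_eq_left ?_
    rcases min_le_iff.1 h with h | h
    · exact le_max_of_le_left ((hf _ _).1 h)
    · exact le_max_of_le_right ((hg _ _).1 h)
  · have hrx : r = min (f x) (g x) := max_eq_right h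
    have h1 : f' r ≤ x := by
      rw [← hf' x, ← hf]
      exact ((hf _ _).2 le_rfl).trans (hrx.le.trans (min_le_left _ _))
    have h2 : g' r ≤ x := by
      rw [← hg' x, ← hg]
      exact ((hg _ _).2 le_rfl).trans (hrx.le.trans (min_le_right _ _))
    have h3 : max (f' r) (g' r) = x := by
      refine le_antisymm (max_le h1 h2) ?_
      rcases min_choice (f x) (g x) with h | h
      · exact le_max_of_le_left (by rw [hrx, h, hf'])
      · exact le_max_of_le_right (by rw [hrx, h, hg'])
    rw [h3]
    exact min_eq_right hxr

/-- The piecewise linear homeomorphism of the line which is the identity outside of `[a, s + 1]`,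
maps `[a, b]` onto `[a, s]` and `[b, s + 1]` onto `[s, s + 1]`, for `a < b ≤ s`. -/
noncomputable def stretch (a b s r : ℝ) : ℝ :=
  max r (min (a + (r - a) * ((s - a) / (b - a))) (s + (r - b) / (s + 1 - b)))

/-- The inverse of `stretch a b s`. -/
noncomputable def unstretch (a b s r : ℝ) : ℝ :=
  min r (max (a + (r - a) / ((s - a) / (b - a))) (b + (r - s) * (s + 1 - b)))

section stretch

variable {a b s : ℝ}

lemma stretch_aux1 (hab : a < b) (hbs : b ≤ s) (x y : ℝ) :
    a + (x - a) * ((s - a) / (b - a)) ≤ y ↔ x ≤ a + (y - a) / ((s - a) / (b - a)) := by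
  have h : 0 < (s - a) / (b - a) := div_pos (by linarith) (by linarith)
  rw [← sub_le_iff_le_add', le_div_iff₀ h, ← le_sub_iff_add_le']

lemma stretch_aux2 (hbs : b ≤ s) (x y : ℝ) :
    s + (x - b) / (s + 1 - b) ≤ y ↔ x ≤ b + (y - s) * (s + 1 - b) := by
  have h : 0 < s + 1 - b := by linarith
  rw [← sub_le_iff_le_add', ← le_sub_iff_add_le', div_le_iff₀ h]

lemma stretch_aux3 (hab : a < b) (hbs : b ≤ s) (x : ℝ) :
    a + (a + (x - a) * ((s - a) / (b - a)) - a) / ((s - a) / (b - a)) = x := by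
  have h : (s - a) / (b - a) ≠ 0 := (div_pos (by linarith) (by linarith)).ne'
  rw [add_sub_cancel_left, mul_div_cancel_right₀ _ h]; ring

lemma stretch_aux3' (hab : a < b) (hbs : b ≤ s) (x : ℝ) :
    a + (a + (x - a) / ((s - a) / (b - a)) - a) * ((s - a) / (b - a)) = x := by
  have h : (s - a) / (b - a) ≠ 0 := (div_pos (by linarith) (by linarith)).ne'
  rw [add_sub_cancel_left, div_mul_cancel₀ _ h]; ring

lemma stretch_aux4 (hbs : b ≤ s) (x : ℝ) :
    b + (s + (x - b) / (s + 1 - b) - s) * (s + 1 - b) = x := by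
  have h : s + 1 - b ≠ 0 := by linarith
  rw [add_sub_cancel_left, div_mul_cancel₀ _ h]; ring

lemma stretch_aux4' (hbs : b ≤ s) (x : ℝ) :
    s + (b + (x - s) * (s + 1 - b) - b) / (s + 1 - b) = x := by
  have h : s + 1 - b ≠ 0 := by linarith
  rw [add_sub_cancel_left, mul_div_cancel_right₀ _ h]; ring

lemma unstretch_stretch (hab : a < b) (hbs : b ≤ s) (r : ℝ) :
    unstretch a b s (stretch a b s r) = r :=
  min_max_max_min_eq (stretch_aux1 hab hbs) (stretch_aux2 hbs) (stretch_aux3 hab hbs)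
    (stretch_aux4 hbs) r

lemma stretch_unstretch (hab : a < b) (hbs : b ≤ s) (r : ℝ) :
    stretch a b s (unstretch a b s r) = r :=
  min_max_max_min_eq (α := ℝᵒᵈ) (fun x y => (stretch_aux1 hab hbs y x).symm)
    (fun x y => (stretch_aux2 hbs y x).symm) (stretch_aux3' hab hbs) (stretch_aux4' hbs) r

lemma le_stretch (r : ℝ) : r ≤ stretch a b s r := le_max_left _ _

lemma stretch_of_le (hab : a < b) (hbs : b ≤ s) {r : ℝ} (hr : r ≤ a) : stretch a b s r = r := by
  refine max_eq_left (min_le_of_left_le ?_)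
  have h : 1 ≤ (s - a) / (b - a) := (one_le_div (by linarith)).2 (by linarith)
  nlinarith

lemma stretch_of_ge (hbs : b ≤ s) {r : ℝ} (hr : s + 1 ≤ r) : stretch a b s r = r := by
  refine max_eq_left (min_le_of_right_le ?_)
  rw [stretch_aux2 hbs]
  nlinarith

lemma unstretch_of_le (hab : a < b) (hbs : b ≤ s) {r : ℝ} (hr : r ≤ a) :
    unstretch a b s r = r := by
  conv_lhs => rw [← stretch_of_le hab hbs hr]
  exact unstretch_stretch hab hbs r

lemma unstretch_of_ge (hab : a < b) (hbs : b ≤ s) {r : ℝ} (hr : s + 1 ≤ r) :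
    unstretch a b s r = r := by
  conv_lhs => rw [← stretch_of_ge (a := a) hbs hr]
  exact unstretch_stretch hab hbs r

lemma le_stretch_of_ge (hab : a < b) (hbs : b ≤ s) {r : ℝ} (hr : b ≤ r) : s ≤ stretch a b s r := by
  refine le_max_of_le_right (le_min ?_ ?_)
  · have h : 0 < (s - a) / (b - a) := div_pos (by linarith) (by linarith)
    have h2 : (b - a) * ((s - a) / (b - a)) = s - a := mul_div_cancel₀ _ (by linarith)
    nlinarith
  · have : 0 ≤ (r - b) / (s + 1 - b) := div_nonneg (by linarith) (by linarith)
    linarith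

lemma le_unstretch_of_ge (hab : a < b) (hbs : b ≤ s) {r : ℝ} (hr : a ≤ r) :
    a ≤ unstretch a b s r := by
  refine le_min hr (le_max_of_le_left ?_)
  have h : 0 < (s - a) / (b - a) := div_pos (by linarith) (by linarith)
  have : 0 ≤ (r - a) / ((s - a) / (b - a)) := div_nonneg (by linarith) h.le
  linarith

lemma one_le_unstretch (hab : a < b) (hbs : b ≤ s) (ha : 1 ≤ a) {r : ℝ} (hr : 1 ≤ r) :
    1 ≤ unstretch a b s r := by
  rcases le_total r a with h | h
  · rwa [unstretch_of_le hab hbs h]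
  · exact ha.trans (le_unstretch_of_ge hab hbs h)

lemma stretch_self (hab : a < b) (r : ℝ) : stretch a b b r = r := by
  refine max_eq_left (min_le_of_left_le ?_)
  rw [div_self (by linarith)]; linarith

lemma continuous_stretch (hab : a < b) : Continuous fun p : Ici b × ℝ => stretch a b p.1 p.2 := by
  unfold stretch
  have h : ∀ p : Ici b × ℝ, (p.1 : ℝ) + 1 - b ≠ 0 := fun p => by
    have : b ≤ p.1 := p.1.2
    linarith
  have h' : b - a ≠ 0 := by linarith
  fun_prop (disch := first | exact h _ | exact h')

lemma continuous_unstretch (hab : a < b) :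
    Continuous fun p : Ici b × ℝ => unstretch a b p.1 p.2 := by
  unfold unstretch
  have h' : b - a ≠ 0 := by linarith
  have h : ∀ p : Ici b × ℝ, ((p.1 : ℝ) - a) / (b - a) ≠ 0 := fun p => by
    have : b ≤ p.1 := p.1.2
    exact (div_pos (by linarith) (by linarith)).ne'
  fun_prop (disch := first | exact h _ | exact h')

end stretch

end Radial

/-! ### Gluing uniform homeomorphisms -/

section Glue

open Set Filter Topology

open Classical in
/-- The extension by the identity of a map defined on a subset. -/
noncomputable def extendId {X : Type*} (C : Set X) (k : C → X) (x : X) : X :=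
  if hx : x ∈ C then k ⟨x, hx⟩ else x

lemma extendId_coe {X : Type*} {C : Set X} (k : C → X) (x : C) : extendId C k x = k x := dif_pos x.2

lemma extendId_of_not_mem {X : Type*} {C : Set X} (k : C → X) {x : X} (hx : x ∉ C) :
    extendId C k x = x := dif_neg hx

variable {X : Type*} [MetricSpace X] {C K : Set X} {δ : ℝ}

/-- A uniformly continuous map on a closed set, which fixes the frontier, extends by the identity
to a uniformly continuous map, provided that points outside of the set which are close to the set
lie in a compact set. -/
lemma uniformContinuous_extendId (hC : IsClosed C) (hK : IsCompact K) (hδ : 0 < δ)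
    (hsep : ∀ x ∈ C, ∀ y ∉ C, dist x y < δ → y ∈ K) {k : C → X} (hk : UniformContinuous k)
    (hfr : ∀ x : C, (x : X) ∈ frontier C → k x = x) : UniformContinuous (extendId C k) := by
  classical
  have hcont : Continuous (extendId C k) := by
    have h1 : extendId C k = C.piecewise (extendId C k) id := by
      ext x
      by_cases hx : x ∈ C
      · simp [hx]
      · simp [hx, extendId_of_not_mem]
    rw [h1]
    refine continuous_piecewise (fun a ha => ?_) ?_ continuousOn_id
    · exact (extendId_coe k ⟨a, hC.frontier_subset ha⟩).trans (hfr _ ha)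
    · rw [hC.closure_eq, continuousOn_iff_continuous_domRestrict]
      exact hk.continuous.congr fun x => (extendId_coe k x).symm
  rw [Metric.uniformContinuous_iff] at hk ⊢
  intro ε hε
  obtain ⟨δ₁, hδ₁, h1⟩ := hk ε hε
  obtain ⟨δ₂, hδ₂, h2⟩ := Metric.mem_uniformity_dist.1
    (hK.uniformContinuousAt_of_continuousAt (extendId C k) (fun a _ => hcont.continuousAt)
      (Metric.dist_mem_uniformity hε))
  have hkey : ∀ x ∈ C, ∀ y ∉ C, dist x y < min δ δ₂ →
      dist (extendId C k x) (extendId C k y) < ε := by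
    intro x hx y hy h
    have hyK := hsep x hx y hy (h.trans_le (min_le_left _ _))
    rw [dist_comm] at h ⊢
    exact h2 (h.trans_le (min_le_right _ _)) hyK
  refine ⟨min (min δ δ₂) (min δ₁ ε), by positivity, fun {x y} h => ?_⟩
  by_cases hx : x ∈ C <;> by_cases hy : y ∈ C
  · rw [extendId_coe k ⟨x, hx⟩, extendId_coe k ⟨y, hy⟩]
    exact h1 (h.trans_le ((min_le_right _ _).trans (min_le_left _ _)))
  · exact hkey x hx y hy (h.trans_le (min_le_left _ _))
  · rw [dist_comm] at h ⊢
    exact hkey y hy x hx (h.trans_le (min_le_left _ _))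
  · rw [extendId_of_not_mem k hx, extendId_of_not_mem k hy]
    exact h.trans_le ((min_le_right _ _).trans (min_le_right _ _))

/-- Extension by the identity of a uniform homeomorphism of a closed set which fixes the
frontier. -/
lemma exists_uniformEquiv_extendId (hC : IsClosed C) (hK : IsCompact K) (hδ : 0 < δ)
    (hsep : ∀ x ∈ C, ∀ y ∉ C, dist x y < δ → y ∈ K) {k : C → X} (hk : IsUniformEmbedding k)
    (hr : range k = C) (hfr : ∀ x : C, (x : X) ∈ frontier C → k x = x) :
    ∃ e : X ≃ᵤ X, ∀ x, e x = extendId C k x := by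
  have hmem : ∀ x : C, k x ∈ C := fun x => hr ▸ mem_range_self x
  have hex : ∀ y : C, ∃ x : C, k x = y := fun y => by
    have : (y : X) ∈ range k := hr.symm ▸ y.2
    exact this
  choose k' hk' using hex
  have hk'u : UniformContinuous fun y => (k' y : X) := by
    refine uniformContinuous_subtype_val.comp ?_
    rw [hk.isUniformInducing.uniformContinuous_iff]
    have : k ∘ k' = Subtype.val := funext hk'
    rw [this]
    exact uniformContinuous_subtype_val
  have hleft : ∀ x : C, k' ⟨k x, hmem x⟩ = x := fun x => hk.injective (hk' _)
  refine ⟨⟨⟨extendId C k, extendId C fun y => k' y, fun x => ?_, fun x => ?_⟩, ?_, ?_⟩, fun x => rfl⟩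
  · by_cases hx : x ∈ C
    · rw [extendId_coe k ⟨x, hx⟩, extendId_coe _ ⟨k ⟨x, hx⟩, hmem _⟩, hleft]
    · rw [extendId_of_not_mem k hx, extendId_of_not_mem _ hx]
  · by_cases hx : x ∈ C
    · rw [extendId_coe _ ⟨x, hx⟩, extendId_coe, hk']
    · rw [extendId_of_not_mem _ hx, extendId_of_not_mem k hx]
  · exact uniformContinuous_extendId hC hK hδ hsep hk.uniformContinuous hfr
  · refine uniformContinuous_extendId hC hK hδ hsep hk'u fun x hx => ?_
    have := hfr x hx
    have h2 : k' x = x := hk.injective (by rw [hk', this])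
    rw [h2]

end Glue

/-! ### Deformations of embeddings of a neighborhood of the end -/

section Image

open Set Filter Topology

universe u

variable {n : ℕ} {X : Type u} [MetricSpace X]

/-- The interior of the domain of a proper embedding is mapped to an open set. -/
lemma isOpen_image_interior_of_properEmb (hX : IsTopManifold n X) (hn : 0 < n) {F : Set X}
    {f : F →ᵤ X} (hf : f ∈ properEmb n F) :
    IsOpen (UniformFun.toFun f '' {x | (x : X) ∈ interior F}) := by
  classical
  obtain ⟨k, rfl⟩ : ∃ k, n = k + 1 := ⟨n - 1, by omega⟩
  set g : X → X := extendId F (UniformFun.toFun f) with hg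
  have hgF : ∀ x (hx : x ∈ F), g x = UniformFun.toFun f ⟨x, hx⟩ := fun x hx => dif_pos hx
  have himg : UniformFun.toFun f '' {x | (x : X) ∈ interior F} = g '' interior F := by
    ext y
    constructor
    · rintro ⟨x, hx, rfl⟩
      exact ⟨x, hx, hgF x x.2⟩
    · rintro ⟨x, hx, rfl⟩
      exact ⟨⟨x, interior_subset hx⟩, hx, (hgF x (interior_subset hx)).symm⟩
  have hgc : ContinuousOn g F := by
    rw [continuousOn_iff_continuous_domRestrict]
    exact hf.1.uniformContinuous.continuous.congr fun x => (hgF x x.2).symm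
  have hgi : InjOn g F := by
    intro x hx y hy h
    rw [hgF x hx, hgF y hy] at h
    exact congrArg Subtype.val (hf.1.injective h)
  rw [himg, isOpen_iff_mem_nhds]
  rintro _ ⟨x, hx, rfl⟩
  refine image_mem_nhds_of_manifold hX hX (isOpen_interior.mem_nhds hx)
    (hgc.mono interior_subset) (hgi.mono interior_subset) fun y hy => ?_
  rw [hgF y (interior_subset hy)]
  exact hf.2 _

/-- Along a path of proper embeddings which is constant on the frontier of the closed domain, the
image does not change: the images of the interior are open and closed in the complement of the
image of the frontier, where the tracks of interior points stay. -/
lemma range_eq_of_path [ProperSpace X] (hX : IsTopManifold n X) (hn : 0 < n) {F : Set X} (hF : IsClosed F)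
    {f : I → F →ᵤ X} (hfc : Continuous f) (hf : ∀ t, f t ∈ properEmb n F)
    (hfr : ∀ t, ∀ x : F, (x : X) ∈ frontier F →
      UniformFun.toFun (f t) x = UniformFun.toFun (f 0) x) (t : I) :
    range (UniformFun.toFun (f t)) = range (UniformFun.toFun (f 0)) := by
  have : CompleteSpace F := hF.isComplete.completeSpace_coe
  have hcl : ∀ t, IsClosed (range (UniformFun.toFun (f t))) := fun t =>
    (hf t).1.isClosedEmbedding.isClosed_range
  have hfrF : frontier F = F \ interior F := hF.frontier_eq
  have hkey : ∀ u s : I, ∀ x : F, (x : X) ∈ interior F →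
      UniformFun.toFun (f s) x ∈ range (UniformFun.toFun (f u)) := by
    intro u s x hx
    have hγ : Continuous fun s => UniformFun.toFun (f s) x :=
      (UniformFun.uniformContinuous_eval X x).continuous.comp hfc
    have heq : (fun s => UniformFun.toFun (f s) x) ⁻¹' range (UniformFun.toFun (f u)) =
        (fun s => UniformFun.toFun (f s) x) ⁻¹'
          (UniformFun.toFun (f u) '' {x | (x : X) ∈ interior F}) := by
      ext s
      constructor
      · rintro ⟨y, hy⟩
        refine ⟨y, ?_, hy⟩
        by_contra hyi
        have hyf : (y : X) ∈ frontier F := hfrF ▸ ⟨y.2, hyi⟩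
        have h1 : UniformFun.toFun (f s) y = UniformFun.toFun (f s) x := by
          rw [hfr s y hyf, ← hfr u y hyf]; exact hy
        rw [(hf s).1.injective h1] at hyi
        exact hyi hx
      · rintro ⟨y, -, hy⟩
        exact ⟨y, hy⟩
    have hclopen : IsClopen ((fun s => UniformFun.toFun (f s) x) ⁻¹'
        range (UniformFun.toFun (f u))) := by
      refine ⟨(hcl u).preimage hγ, ?_⟩
      rw [heq]
      exact (isOpen_image_interior_of_properEmb hX hn (hf u)).preimage hγ
    have := hclopen.eq_univ ⟨u, ⟨x, rfl⟩⟩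
    exact eq_univ_iff_forall.1 this s
  have hsub : ∀ u s, range (UniformFun.toFun (f s)) ⊆ range (UniformFun.toFun (f u)) := by
    rintro u s _ ⟨x, rfl⟩
    by_cases hx : (x : X) ∈ interior F
    · exact hkey u s x hx
    · have hxf : (x : X) ∈ frontier F := hfrF ▸ ⟨x.2, hx⟩
      exact ⟨x, by rw [hfr u x hxf, hfr s x hxf]⟩
  exact (hsub 0 t).antisymm (hsub t 0)

end Image

/-! ### Displacement on a subset and deformation stages -/

section Stage

open Set Filter Topology

universe u

variable {n : ℕ} {M : Type u} [MetricSpace M]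

/-- The displacement `sup {d(h x, x) | x ∈ C}` of a map on a subset `C`. -/
noncomputable def supDist (C : Set M) (h : M →ᵤ M) : ENNReal :=
  ⨆ x ∈ C, edist (UniformFun.toFun h x) x

lemma supDist_le_iff {C : Set M} {h : M →ᵤ M} {a : ENNReal} :
    supDist C h ≤ a ↔ ∀ x ∈ C, edist (UniformFun.toFun h x) x ≤ a := iSup₂_le_iff

lemma edist_le_supDist {C : Set M} (h : M →ᵤ M) {x : M} (hx : x ∈ C) :
    edist (UniformFun.toFun h x) x ≤ supDist C h := supDist_le_iff.1 le_rfl x hx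

lemma supDist_mono {C D : Set M} (hCD : C ⊆ D) (h : M →ᵤ M) : supDist C h ≤ supDist D h :=
  supDist_le_iff.2 fun _ hx => edist_le_supDist h (hCD hx)

lemma supDist_le_edist (C : Set M) (h : M →ᵤ M) : supDist C h ≤ edist h (idFun M) :=
  supDist_le_iff.2 fun x _ => UniformFun.edist_eval_le (f := h) (g := idFun M) (x := x)

lemma supDist_eq_zero {C : Set M} {h : M →ᵤ M} :
    supDist C h = 0 ↔ ∀ x ∈ C, UniformFun.toFun h x = x := by
  rw [← nonpos_iff_eq_zero, supDist_le_iff]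
  simp

lemma continuous_supDist (C : Set M) : Continuous (supDist C) := by
  refine continuous_of_le_add_edist 1 ENNReal.one_ne_top fun h h' => ?_
  rw [one_mul]
  refine supDist_le_iff.2 fun x hx => ?_
  calc edist (UniformFun.toFun h x) x
      ≤ edist (UniformFun.toFun h x) (UniformFun.toFun h' x) + edist (UniformFun.toFun h' x) x :=
        edist_triangle _ _ _
    _ ≤ edist h h' + supDist C h' := by
        gcongr
        · exact UniformFun.edist_eval_le
        · exact edist_le_supDist h' hx
    _ = _ := add_comm _ _

/-- A deformation supported in `C` which moves every bounded uniform homeomorphism with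
displacement less than `α` on `C` to one which is the identity on `C'`. Outside of that
neighborhood only the values at time `0` and the support are prescribed. -/
structure IsStage (n : ℕ) (C C' : Set M) (α β : ℝ)
    (ψ : bddUnifHomeo M → I → bddUnifHomeo M) : Prop where
  continuousOn : ContinuousOn (fun p : bddUnifHomeo M × I => ψ p.1 p.2)
    {p | supDist C p.1.1 < ENNReal.ofReal α}
  zero : ∀ h, ψ h 0 = h
  one : ∀ h : bddUnifHomeo M, supDist C h.1 < ENNReal.ofReal α →
    ∀ x ∈ C', UniformFun.toFun (ψ h 1).1 x = x
  eq_off : ∀ h t, ∀ x ∉ C, UniformFun.toFun (ψ h t).1 x = UniformFun.toFun h.1 x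
  supDist_le : ∀ (h : bddUnifHomeo M) (t : I), supDist C h.1 < ENNReal.ofReal α →
    supDist C (ψ h t).1 ≤ ENNReal.ofReal β
  eq_self : ∀ h : bddUnifHomeo M, (∀ x ∈ C, UniformFun.toFun h.1 x = x) → ∀ t, ψ h t = h
  boundary : ∀ h : bddUnifHomeo M,
    (∀ x ∈ manifoldBoundary n M, UniformFun.toFun h.1 x = x) →
    ∀ t, ∀ x ∈ manifoldBoundary n M, UniformFun.toFun (ψ h t).1 x = x

/-- A family of deformations of homeomorphisms keeps maps with small displacement on `C` small. -/
def IsSmallAtId (C : Set M) (ψ : bddUnifHomeo M → I → bddUnifHomeo M) : Prop :=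
  ∀ ε : ℝ, 0 < ε → ∃ δ : ℝ, 0 < δ ∧ ∀ (h : bddUnifHomeo M) (t : I),
    supDist C h.1 < ENNReal.ofReal δ → supDist C (ψ h t).1 ≤ ENNReal.ofReal ε

namespace ProperProductEndIn

variable (E : ProperProductEndIn n M)

lemma mem_level {c : ℝ} {x : M} (hx : x ∈ E.tail c) :
    (⟨x, E.tail_subset c hx⟩ : E.L) ∈ E.level c :=
  E.coe_mem_tail.1 hx

lemma tail_of_level {c : ℝ} (x : E.level c) : ((x : E.L) : M) ∈ E.tail c :=
  E.coe_mem_tail.2 x.2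

open Classical in
/-- The restriction of a self-map of `M` to a map `L_c → L`, with junk values at points which
leave `L`. -/
noncomputable def restrictLevel (c : ℝ) (h : M →ᵤ M) : E.level c →ᵤ E.L :=
  UniformFun.ofFun fun x =>
    if hx : UniformFun.toFun h x ∈ E.L then ⟨UniformFun.toFun h x, hx⟩ else x

open Classical in
/-- The self-map of `M` given by `f` on `L_c` and by `h` elsewhere. -/
noncomputable def glue (c : ℝ) (h : M →ᵤ M) (f : E.level c →ᵤ E.L) : M →ᵤ M :=
  UniformFun.ofFun fun x =>
    if hx : x ∈ E.tail c then (UniformFun.toFun f ⟨⟨x, E.tail_subset c hx⟩, E.mem_level hx⟩ : E.L)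
    else UniformFun.toFun h x

variable {E} {c : ℝ}

lemma coe_restrictLevel {h : M →ᵤ M} {x : E.level c} (hx : UniformFun.toFun h x ∈ E.L) :
    ((UniformFun.toFun (E.restrictLevel c h) x : E.L) : M) = UniformFun.toFun h x := by
  have : UniformFun.toFun (E.restrictLevel c h) x = ⟨UniformFun.toFun h x, hx⟩ := dif_pos hx
  rw [this]

lemma glue_of_mem {h : M →ᵤ M} {f : E.level c →ᵤ E.L} (x : E.level c) :
    UniformFun.toFun (E.glue c h f) x = UniformFun.toFun f x :=
  dif_pos (E.tail_of_level x)

lemma glue_of_not_mem {h : M →ᵤ M} {f : E.level c →ᵤ E.L} {x : M} (hx : x ∉ E.tail c) :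
    UniformFun.toFun (E.glue c h f) x = UniformFun.toFun h x :=
  dif_neg hx

lemma edist_glue_le (h h' : M →ᵤ M) (f f' : E.level c →ᵤ E.L) :
    edist (E.glue c h f) (E.glue c h' f') ≤ max (edist h h') (edist f f') := by
  refine UniformFun.edist_le.2 fun x => ?_
  by_cases hx : x ∈ E.tail c
  · rw [glue_of_mem ⟨⟨x, E.tail_subset c hx⟩, E.mem_level hx⟩,
      glue_of_mem ⟨⟨x, E.tail_subset c hx⟩, E.mem_level hx⟩]
    exact le_max_of_le_right (UniformFun.edist_eval_le (f := f) (g := f'))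
  · rw [glue_of_not_mem hx, glue_of_not_mem hx]
    exact le_max_of_le_left UniformFun.edist_eval_le

lemma mem_interior_of_supDist_lt {α : ℝ} (hdist : ∀ x ∈ E.tail c, ∀ y ∉ E.L, α ≤ dist x y)
    {h : M →ᵤ M} (hh : supDist (E.tail c) h < ENNReal.ofReal α) {x : M} (hx : x ∈ E.tail c) :
    UniformFun.toFun h x ∈ interior E.L := by
  have h1 : edist (UniformFun.toFun h x) x < ENNReal.ofReal α := (edist_le_supDist h hx).trans_lt hh
  rw [edist_lt_ofReal] at h1
  refine mem_interior_iff_mem_nhds.2 (mem_of_superset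
    (Metric.ball_mem_nhds _ (sub_pos.2 h1)) fun y hy => ?_)
  by_contra hyL
  have h2 := hdist x hx y hyL
  have h3 := dist_triangle x (UniformFun.toFun h x) y
  rw [Metric.mem_ball, dist_comm] at hy
  rw [dist_comm (UniformFun.toFun h x) x] at hy
  linarith

lemma restrictLevel_mem (hint : E.tail 2 ⊆ interior E.L) (hc : 2 ≤ c) {α : ℝ}
    (hdist : ∀ x ∈ E.tail c, ∀ y ∉ E.L, α ≤ dist x y) {h : M →ᵤ M} (hu : h ∈ unifHomeo M)
    (hh : supDist (E.tail c) h < ENNReal.ofReal α) :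
    E.restrictLevel c h ∈ properEmbBall n (E.level c) α := by
  obtain ⟨e, rfl⟩ := hu
  have hmem : ∀ x : E.level c, UniformFun.toFun (UniformFun.ofFun e) x ∈ interior E.L := fun x =>
    mem_interior_of_supDist_lt hdist hh (E.tail_of_level x)
  have hval : ∀ x : E.level c,
      ((UniformFun.toFun (E.restrictLevel c (UniformFun.ofFun e)) x : E.L) : M) = e x := fun x =>
    coe_restrictLevel (interior_subset (hmem x))
  refine ⟨⟨?_, fun x => ?_⟩, ?_⟩
  · rw [← isUniformEmbedding_subtype_val.of_comp_iff]
    have : (Subtype.val ∘ UniformFun.toFun (E.restrictLevel c (UniformFun.ofFun e))) =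
        e ∘ Subtype.val ∘ Subtype.val := funext hval
    rw [this]
    exact e.isUniformEmbedding.comp
      (isUniformEmbedding_subtype_val.comp isUniformEmbedding_subtype_val)
  · rw [← mem_manifoldBoundary_subtype _ (by rw [hval]; exact hmem x), hval,
      ← mem_manifoldBoundary_subtype _ (hint (E.tail_anti hc (E.tail_of_level x)))]
    exact mem_manifoldBoundary_homeomorph e.toHomeomorph _
  · refine lt_of_le_of_lt (UniformFun.edist_le.2 fun x => ?_) hh
    have := edist_le_supDist (UniformFun.ofFun e) (E.tail_of_level x)
    rw [Subtype.edist_eq, hval]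
    exact this

/-- Replacing a uniform homeomorphism on `L_c` by another uniform embedding with the same image
and the same values on the frontier yields a uniform homeomorphism. -/
lemma glue_mem_unifHomeo (hiso : E.IsIsolated) (hint : E.tail 2 ⊆ interior E.L) (hc : 2 ≤ c)
    (e : M ≃ᵤ M) {f : E.level c →ᵤ E.L} (hf : IsUniformEmbedding (UniformFun.toFun f))
    (hr : range (fun x => ((UniformFun.toFun f x : E.L) : M)) = e '' E.tail c)
    (hfr : ∀ x : E.level c, (x : E.L) ∈ frontier (E.level c) →
      ((UniformFun.toFun f x : E.L) : M) = e x) :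
    E.glue c (UniformFun.ofFun e) f ∈ unifHomeo M := by
  obtain ⟨δ, hδ, hδd⟩ := hiso.exists_pos_dist_ge hint
  -- the inclusion `L_c → L`
  let j : E.tail c → E.level c := fun x => ⟨⟨x, E.tail_subset c x.2⟩, E.mem_level x.2⟩
  have hj : IsUniformEmbedding j := by
    rw [← (isUniformEmbedding_subtype_val.comp
      (isUniformEmbedding_subtype_val (p := (· ∈ E.level c)))).of_comp_iff]
    exact isUniformEmbedding_subtype_val
  have hjs : Function.Surjective j := fun x => ⟨⟨x, E.tail_of_level x⟩, rfl⟩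
  set k : E.tail c → M := fun x => e.symm ((UniformFun.toFun f (j x) : E.L) : M) with hk
  have hku : IsUniformEmbedding k :=
    e.symm.isUniformEmbedding.comp (isUniformEmbedding_subtype_val.comp (hf.comp hj))
  have hkr : range k = E.tail c := by
    have : range k = e.symm '' range (fun x => ((UniformFun.toFun f x : E.L) : M)) := by
      rw [← range_comp, ← hjs.range_comp]; rfl
    rw [this, hr, ← image_comp]
    simp
  have hkfr : ∀ x : E.tail c, (x : M) ∈ frontier (E.tail c) → k x = x := by
    intro x hx
    have h1 : ((j x : E.level c) : E.L) ∈ frontier (E.level c) := by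
      refine ⟨subset_closure (j x).2, fun hi => hx.2 ?_⟩
      obtain ⟨O, hO, hOe⟩ := isOpen_induced_iff.1 (isOpen_interior (s := E.level c))
      refine mem_interior.2 ⟨O ∩ interior E.L, ?_, hO.inter isOpen_interior, ?_,
        hint (E.tail_anti hc x.2)⟩
      · rintro y ⟨hyO, hyi⟩
        have : (⟨y, interior_subset hyi⟩ : E.L) ∈ Subtype.val ⁻¹' O := hyO
        rw [hOe] at this
        have h3 : (⟨y, interior_subset hyi⟩ : E.L) ∈ E.level c := interior_subset this
        exact (E.coe_mem_tail (x := ⟨y, interior_subset hyi⟩)).2 h3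
      · rw [← hOe] at hi
        exact hi
    simp only [hk]
    rw [hfr _ h1]
    exact e.symm_apply_apply _
  obtain ⟨e', he'⟩ := exists_uniformEquiv_extendId (E.isClosed_tail c) (E.isCompact_shell c) hδ
    (by
      intro x hx y hy hxy
      have hyL : y ∈ E.L := by
        by_contra h
        exact absurd (hδd x (E.tail_anti hc hx) y h) (not_le.2 hxy)
      refine (E.mem_shell (x := ⟨y, hyL⟩)).2 ?_
      by_contra h
      exact hy (E.mem_tail_iff.2 ⟨hyL, (not_le.1 h).le⟩)) hku hkr hkfr
  refine ⟨e'.trans e, ?_⟩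
  apply UniformFun.toFun.injective
  funext x
  change _ = e (e' x)
  rw [he']
  by_cases hx : x ∈ E.tail c
  · rw [extendId_coe k ⟨x, hx⟩, glue_of_mem (j ⟨x, hx⟩)]
    exact (e.apply_symm_apply _).symm
  · rw [extendId_of_not_mem k hx, glue_of_not_mem hx]
    rfl

variable (E) in
/-- The end deformation property yields a deformation stage for bounded homeomorphisms, for every
level which is farther than `α` from the complement of the end. -/
theorem exists_isStage_of_hasED (hiso : E.IsIsolated) (hint : E.tail 2 ⊆ interior E.L)
    (hED : HasED n E.L) (hc : 2 ≤ c) {α : ℝ} (hα : 0 < α)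
    (hdist : ∀ x ∈ E.tail c, ∀ y ∉ E.L, α ≤ dist x y) (R : ℝ) :
    ∃ c' : ℝ, R ≤ c' ∧ ∃ β : ℝ, ∃ ψ : bddUnifHomeo M → I → bddUnifHomeo M,
      IsStage n (E.tail c) (E.tail c') α β ψ ∧ IsSmallAtId (E.tail c) ψ := by
  classical
  obtain ⟨β, hβ, H, hH, hHF, φ, hφ, hφβ, hφfr⟩ := hED (E.level c) (E.level_mem_cofinalClosed c) α hα
  obtain ⟨R₁, hR₁⟩ := E.exists_tail_subset_of_cofinal hH
  have hproper := E.str.proper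
  have hn : 0 < n := by have := E.str.dim_eq; omega
  set W : Set (bddUnifHomeo M) := {h | supDist (E.tail c) h.1 < ENNReal.ofReal α} with hW
  -- the restriction map
  let res : W → properEmbBall n (E.level c) α := fun w =>
    ⟨E.restrictLevel c w.1.1, restrictLevel_mem hint hc hdist w.1.2.1 w.2⟩
  have hval : ∀ (w : W) (x : E.level c), ((UniformFun.toFun (res w).1 x : E.L) : M) =
      UniformFun.toFun w.1.1 x := fun w x =>
    coe_restrictLevel (interior_subset (mem_interior_of_supDist_lt hdist w.2 (E.tail_of_level x)))
  have hresc : Continuous res := by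
    refine LipschitzWith.continuous (K := 1) fun w w' => ?_
    rw [ENNReal.coe_one, one_mul]
    refine UniformFun.edist_le.2 fun x => ?_
    rw [Subtype.edist_eq, hval, hval]
    exact UniformFun.edist_eval_le
  have hfr : ∀ (w : W) (t : I) (x : E.level c), (x : E.L) ∈ frontier (E.level c) →
      ((UniformFun.toFun (φ (res w, t)) x : E.L) : M) = UniformFun.toFun w.1.1 x := by
    intro w t x hx
    rw [hφfr (res w) t x hx, hval]
  have hrange : ∀ (w : W) (t : I), range (fun x => ((UniformFun.toFun (φ (res w, t)) x : E.L) : M)) =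
      UniformFun.toFun w.1.1 '' E.tail c := by
    intro w t
    have h1 := range_eq_of_path E.str.manifold hn (E.level_mem_cofinalClosed c).1
      (f := fun t => φ (res w, t)) (hφ.continuous.comp (by fun_prop)) (fun t => hφ.mem _)
      (fun t x hx => by rw [hφfr _ _ _ hx, hφfr _ _ _ hx]) t
    have h2 : range (fun x => ((UniformFun.toFun (φ (res w, t)) x : E.L) : M)) =
        Subtype.val '' range (UniformFun.toFun (φ (res w, t))) := by
      rw [← range_comp]; rfl
    rw [h2, h1, ← range_comp]
    ext y
    constructor
    · rintro ⟨x, rfl⟩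
      refine ⟨x, E.tail_of_level x, ?_⟩
      simp only [Function.comp, hφ.zero]
      exact (hval w x).symm
    · rintro ⟨x, hx, rfl⟩
      refine ⟨⟨⟨x, E.tail_subset c hx⟩, E.mem_level hx⟩, ?_⟩
      simp only [Function.comp, hφ.zero]
      exact hval w _
  have hclose : ∀ (w : W) (t : I) (x : E.level c),
      edist ((UniformFun.toFun (φ (res w, t)) x : E.L) : M) x ≤ ENNReal.ofReal β := by
    intro w t x
    have h1 : edist (UniformFun.toFun (φ (res w, t)) x) (x : E.L) ≤ edist (φ (res w, t)) (incl _) :=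
      UniformFun.edist_eval_le (f := φ (res w, t)) (g := incl (E.level c))
    exact h1.trans (hφβ _).2.le
  have hglue_le : ∀ (w : W) (t : I), supDist (E.tail c) (E.glue c w.1.1 (φ (res w, t))) ≤
      edist (φ (res w, t)) (incl _) := by
    intro w t
    refine supDist_le_iff.2 fun x hx => ?_
    have := glue_of_mem (h := w.1.1) (f := φ (res w, t))
      ⟨⟨x, E.tail_subset c hx⟩, E.mem_level hx⟩
    rw [this]
    exact UniformFun.edist_eval_le (f := φ (res w, t)) (g := incl (E.level c))
      (x := ⟨⟨x, E.tail_subset c hx⟩, E.mem_level hx⟩)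
  have hmem : ∀ (w : W) (t : I), E.glue c w.1.1 (φ (res w, t)) ∈ bddUnifHomeo M := by
    intro w t
    constructor
    · obtain ⟨e, he⟩ := w.1.2.1
      have h1 := hrange w t
      have h2 := hfr w t
      rw [he] at h1 h2
      rw [he]
      exact glue_mem_unifHomeo hiso hint hc e (hφ.mem _).1 h1 h2
    · refine lt_of_le_of_lt (b := max (ENNReal.ofReal β) (edist w.1.1 (idFun M)))
        (UniformFun.edist_le.2 fun x => ?_) (max_lt ENNReal.ofReal_lt_top w.1.2.2)
      by_cases hx : x ∈ E.tail c
      · exact le_max_of_le_left ((edist_le_supDist _ hx).trans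
          ((hglue_le w t).trans (hφβ _).2.le))
      · rw [glue_of_not_mem hx]
        exact le_max_of_le_right (UniformFun.edist_eval_le (f := w.1.1) (g := idFun M))
  let Ψ : W × I → bddUnifHomeo M := fun p => ⟨_, hmem p.1 p.2⟩
  have hΨc : Continuous Ψ := by
    refine Continuous.subtype_mk ?_ _
    rw [continuous_iff_continuousAt]
    intro p
    have h1 : Continuous fun q : W × I => φ (res q.1, q.2) := hφ.continuous.comp (by fun_prop)
    have h2 : Continuous fun q : W × I => q.1.1.1 := by fun_prop
    rw [ContinuousAt, tendsto_iff_edist_tendsto_0]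
    have h3 := tendsto_iff_edist_tendsto_0.1 (h1.tendsto p)
    have h4 := tendsto_iff_edist_tendsto_0.1 (h2.tendsto p)
    have h5 := h4.max h3
    rw [max_self] at h5
    exact tendsto_of_tendsto_of_tendsto_of_le_of_le tendsto_const_nhds h5 (fun _ => zero_le)
      fun q => edist_glue_le _ _ _ _
  let ψ : bddUnifHomeo M → I → bddUnifHomeo M := fun h t =>
    if hh : h ∈ W then Ψ (⟨h, hh⟩, t) else h
  have hψW : ∀ (w : W) (t : I), ψ w.1 t = Ψ (w, t) := fun w t => dif_pos w.2
  have hψn : ∀ {h} (t : I), h ∉ W → ψ h t = h := fun t hh => dif_neg hh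
  refine ⟨max R (max R₁ c), le_max_left _ _, β, ψ, ⟨?_, fun h => ?_, fun h hh x hx => ?_,
    fun h t x hx => ?_, fun h t hh => ?_, fun h hh t => ?_, fun h hh t x hx => ?_⟩, fun ε hε => ?_⟩
  · rw [continuousOn_iff_continuous_domRestrict]
    have : Continuous fun p : {p : bddUnifHomeo M × I |
        supDist (E.tail c) p.1.1 < ENNReal.ofReal α} => Ψ (⟨p.1.1, p.2⟩, p.1.2) :=
      hΨc.comp (by fun_prop)
    exact this.congr fun p => (hψW ⟨p.1.1, p.2⟩ p.1.2).symm
  · by_cases hh : h ∈ W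
    · rw [hψW ⟨h, hh⟩]
      apply Subtype.ext
      apply UniformFun.toFun.injective
      funext x
      by_cases hx : x ∈ E.tail c
      · refine (glue_of_mem ⟨⟨x, E.tail_subset c hx⟩, E.mem_level hx⟩).trans ?_
        rw [hφ.zero, hval]
      · exact glue_of_not_mem hx
    · exact hψn 0 hh
  · rw [hψW ⟨h, hh⟩]
    have hxc : x ∈ E.tail c := E.tail_anti ((le_max_right R₁ c).trans (le_max_right _ _)) hx
    have hx1 : x ∈ E.tail R₁ := E.tail_anti ((le_max_left R₁ c).trans (le_max_right _ _)) hx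
    refine (glue_of_mem ⟨⟨x, E.tail_subset c hxc⟩, E.mem_level hxc⟩).trans ?_
    rw [hφ.one]
    exact hR₁ _ (E.mem_level hx1)
  · by_cases hh : h ∈ W
    · rw [hψW ⟨h, hh⟩]
      exact glue_of_not_mem hx
    · rw [hψn t hh]
  · rw [hψW ⟨h, hh⟩]
    exact (hglue_le _ _).trans (hφβ _).2.le
  · by_cases hh' : h ∈ W
    · rw [hψW ⟨h, hh'⟩]
      have h1 : (res ⟨h, hh'⟩).1 = incl (E.level c) := by
        apply UniformFun.toFun.injective
        funext x
        exact Subtype.ext ((hval ⟨h, hh'⟩ x).trans (hh _ (E.tail_of_level x)))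
      have h2 := hφ.incl (res ⟨h, hh'⟩) h1 t
      apply Subtype.ext
      apply UniformFun.toFun.injective
      funext x
      by_cases hx : x ∈ E.tail c
      · refine (glue_of_mem ⟨⟨x, E.tail_subset c hx⟩, E.mem_level hx⟩).trans ?_
        rw [h2, hval]
      · exact glue_of_not_mem hx
    · exact hψn t hh'
  · by_cases hh' : h ∈ W
    · rw [hψW ⟨h, hh'⟩]
      by_cases hxc : x ∈ E.tail c
      · refine (glue_of_mem ⟨⟨x, E.tail_subset c hxc⟩, E.mem_level hxc⟩).trans ?_
        rw [hφ.boundary (res ⟨h, hh'⟩)]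
        · intro y hy
          apply Subtype.ext
          rw [hval]
          exact hh _ ((mem_manifoldBoundary_subtype _
            (hint (E.tail_anti hc (E.tail_of_level y)))).2 hy)
        · exact (mem_manifoldBoundary_subtype _ (hint (E.tail_anti hc hxc))).1 hx
      · exact (glue_of_not_mem hxc).trans (hh x hx)
    · rw [hψn t hh']; exact hh x hx
  · -- continuity of the deformation at the inclusion, uniformly in time
    have hi : incl (E.level c) ∈ properEmbBall n (E.level c) α :=
      ⟨⟨isUniformEmbedding_subtype_val, fun _ => Iff.rfl⟩, by
        rw [edist_self]; exact ENNReal.ofReal_pos.2 hα⟩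
    have h1 : ∀ᶠ f in 𝓝 (⟨incl (E.level c), hi⟩ : properEmbBall n (E.level c) α), ∀ t ∈ (univ : Set I),
        edist (φ (f, t)) (incl (E.level c)) < ENNReal.ofReal ε := by
      refine isCompact_univ.eventually_forall_of_forall_eventually fun t _ => ?_
      have h2 : Continuous fun p => edist (φ p) (incl (E.level c)) :=
        hφ.continuous.edist continuous_const
      have h3 := h2.tendsto (⟨incl (E.level c), hi⟩, t)
      refine h3.eventually (gt_mem_nhds ?_)
      rw [hφ.incl _ rfl, edist_self]
      exact ENNReal.ofReal_pos.2 hε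
    obtain ⟨δ', hδ', hball⟩ := EMetric.mem_nhds_iff.1 h1
    obtain ⟨δ, hδ, hδδ⟩ : ∃ δ : ℝ, 0 < δ ∧ ENNReal.ofReal δ ≤ δ' := by
      obtain ⟨r, hr0, hr⟩ := ENNReal.lt_iff_exists_nnreal_btwn.1 hδ'
      exact ⟨r, by exact_mod_cast hr0, by rw [ENNReal.ofReal_coe_nnreal]; exact hr.le⟩
    refine ⟨min δ α, by positivity, fun h t hh => ?_⟩
    have hhW : h ∈ W := hh.trans_le (ENNReal.ofReal_le_ofReal (min_le_right _ _))
    rw [hψW ⟨h, hhW⟩]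
    refine (hglue_le _ _).trans (hball ?_ t (mem_univ t)).le
    have h2 : edist (E.restrictLevel c h.1) (incl (E.level c)) ≤ supDist (E.tail c) h.1 := by
      refine UniformFun.edist_le.2 fun x => ?_
      have := hval ⟨h, hhW⟩ x
      rw [Subtype.edist_eq]
      have h3 := edist_le_supDist h.1 (E.tail_of_level x)
      rw [← this] at h3
      exact h3
    exact (h2.trans_lt hh).trans_le
      ((ENNReal.ofReal_le_ofReal (min_le_left _ _)).trans hδδ)

end ProperProductEndIn

end Stage

/-! ### Conjugation by stretching homeomorphisms -/

section Conjugation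

open Set Filter Topology

universe u

variable {n : ℕ} {M : Type u} [MetricSpace M]

/-- A uniform homeomorphism at finite distance from the identity. -/
def IsBddEquiv (e : M ≃ᵤ M) : Prop := ∃ D : ℝ, ∀ x, dist (e x) x ≤ D

lemma IsBddEquiv.symm {e : M ≃ᵤ M} (he : IsBddEquiv e) : IsBddEquiv e.symm := by
  obtain ⟨D, hD⟩ := he
  refine ⟨D, fun x => ?_⟩
  have := hD (e.symm x)
  rwa [e.apply_symm_apply, dist_comm] at this

/-- The conjugate `e⁻¹ ∘ h ∘ e`. -/
def conjFun (e : M ≃ᵤ M) (h : M →ᵤ M) : M →ᵤ M :=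
  UniformFun.ofFun (e.symm ∘ UniformFun.toFun h ∘ e)

lemma toFun_conjFun (e : M ≃ᵤ M) (h : M →ᵤ M) (x : M) :
    UniformFun.toFun (conjFun e h) x = e.symm (UniformFun.toFun h (e x)) := rfl

lemma conjFun_mem_unifHomeo (e : M ≃ᵤ M) {h : M →ᵤ M} (hh : h ∈ unifHomeo M) :
    conjFun e h ∈ unifHomeo M := by
  obtain ⟨k, rfl⟩ := hh
  exact ⟨(e.trans k).trans e.symm, rfl⟩

lemma edist_conjFun_le {e : M ≃ᵤ M} {D : ℝ} (hD : ∀ x, dist (e x) x ≤ D) (h : M →ᵤ M) :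
    edist (conjFun e h) (idFun M) ≤ ENNReal.ofReal (2 * D) + edist h (idFun M) := by
  refine UniformFun.edist_le.2 fun x => ?_
  have hD0 : 0 ≤ D := dist_nonneg.trans (hD x)
  have h1 : edist (e.symm (UniformFun.toFun h (e x))) (UniformFun.toFun h (e x))
      ≤ ENNReal.ofReal D := by
    rw [edist_dist, dist_comm]
    have := hD (e.symm (UniformFun.toFun h (e x)))
    rw [e.apply_symm_apply] at this
    exact ENNReal.ofReal_le_ofReal this
  have h2 : edist (UniformFun.toFun h (e x)) (e x) ≤ edist h (idFun M) :=
    UniformFun.edist_eval_le (f := h) (g := idFun M) (x := e x)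
  have h3 : edist (e x) x ≤ ENNReal.ofReal D := by
    rw [edist_dist]; exact ENNReal.ofReal_le_ofReal (hD x)
  calc edist (e.symm (UniformFun.toFun h (e x))) x
      ≤ edist (e.symm (UniformFun.toFun h (e x))) (UniformFun.toFun h (e x)) +
        edist (UniformFun.toFun h (e x)) (e x) + edist (e x) x := edist_triangle4 _ _ _ _
    _ ≤ ENNReal.ofReal D + edist h (idFun M) + ENNReal.ofReal D := by gcongr
    _ = _ := by rw [two_mul, ENNReal.ofReal_add hD0 hD0]; ring

lemma conjFun_mem {e : M ≃ᵤ M} (he : IsBddEquiv e) {h : M →ᵤ M} (hh : h ∈ bddUnifHomeo M) :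
    conjFun e h ∈ bddUnifHomeo M := by
  obtain ⟨D, hD⟩ := he
  exact ⟨conjFun_mem_unifHomeo e hh.1,
    (edist_conjFun_le hD h).trans_lt (ENNReal.add_lt_top.2 ⟨ENNReal.ofReal_lt_top, hh.2⟩)⟩

/-- Conjugation as a self-map of the group of bounded uniform homeomorphisms. -/
def conj (e : M ≃ᵤ M) (he : IsBddEquiv e) (h : bddUnifHomeo M) : bddUnifHomeo M :=
  ⟨conjFun e h.1, conjFun_mem he h.2⟩

lemma conj_conj_symm {e : M ≃ᵤ M} (he : IsBddEquiv e) (h : bddUnifHomeo M) :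
    conj e he (conj e.symm he.symm h) = h := by
  apply Subtype.ext
  apply UniformFun.toFun.injective
  funext x
  change e.symm (e (UniformFun.toFun h.1 (e.symm (e x)))) = _
  simp

lemma continuous_conj (e : M ≃ᵤ M) (he : IsBddEquiv e) : Continuous (conj e he) := by
  refine Continuous.subtype_mk ?_ _
  rw [continuous_iff_continuousAt]
  intro h
  have h1 : Tendsto (fun k : bddUnifHomeo M =>
      UniformFun.ofFun (UniformFun.toFun k.1 ∘ UniformFun.toFun (UniformFun.ofFun e))) (𝓝 h)
      (𝓝 (UniformFun.ofFun (UniformFun.toFun h.1 ∘ UniformFun.toFun (UniformFun.ofFun e)))) := by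
    refine tendsto_ofFun_comp continuous_subtype_val.continuousAt tendsto_const_nhds ?_
    obtain ⟨k, hk⟩ := h.2.1
    rw [hk]
    exact k.uniformContinuous
  exact tendsto_ofFun_comp (F := fun _ => UniformFun.ofFun e.symm) tendsto_const_nhds h1
    e.symm.uniformContinuous

lemma supDist_conjFun_le {e : M ≃ᵤ M} {C : Set M} (hC : ∀ x, e x ∈ C ↔ x ∈ C) {α ε : ℝ}
    (hmod : ∀ x y, dist x y < α → dist (e.symm x) (e.symm y) ≤ ε) {h : M →ᵤ M}
    (hh : supDist C h < ENNReal.ofReal α) : supDist C (conjFun e h) ≤ ENNReal.ofReal ε := by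
  refine supDist_le_iff.2 fun x hx => ?_
  have h1 := (edist_le_supDist h ((hC x).2 hx)).trans_lt hh
  rw [edist_lt_ofReal] at h1
  have h2 := hmod _ _ h1
  rw [e.symm_apply_apply] at h2
  rw [toFun_conjFun, edist_dist]
  exact ENNReal.ofReal_le_ofReal h2

lemma IsStage.mono {C C' C'' : Set M} {α α' β β' : ℝ} {ψ : bddUnifHomeo M → I → bddUnifHomeo M}
    (h : IsStage n C C' α β ψ) (hα : α' ≤ α) (hβ : β ≤ β') (hC : C'' ⊆ C') :
    IsStage n C C'' α' β' ψ where
  continuousOn := h.continuousOn.mono fun _ hp => lt_of_lt_of_le hp (ENNReal.ofReal_le_ofReal hα)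
  zero := h.zero
  one k hk x hx := h.one k (hk.trans_le (ENNReal.ofReal_le_ofReal hα)) x (hC hx)
  eq_off := h.eq_off
  supDist_le k t hk := (h.supDist_le k t (hk.trans_le (ENNReal.ofReal_le_ofReal hα))).trans
    (ENNReal.ofReal_le_ofReal hβ)
  eq_self := h.eq_self
  boundary := h.boundary

namespace ProperProductEndIn

variable {E : ProperProductEndIn n M} {a b s : ℝ}

lemma continuous_radialMap_stretch (hint : E.tail 2 ⊆ interior E.L) (ha : 2 ≤ a) (hab : a < b) :
    Continuous fun p : Ici b × M => E.radialMap (stretch a b p.1) p.2 :=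
  continuous_radialMap hint (γ := fun s : Ici b => stretch a b s) (continuous_stretch hab)
    fun s _ hr => stretch_of_le hab s.2 (hr.trans ha)

lemma continuous_radialMap_unstretch (hint : E.tail 2 ⊆ interior E.L) (ha : 2 ≤ a) (hab : a < b) :
    Continuous fun p : Ici b × M => E.radialMap (unstretch a b p.1) p.2 :=
  continuous_radialMap hint (γ := fun s : Ici b => unstretch a b s) (continuous_unstretch hab)
    fun s _ hr => unstretch_of_le hab s.2 (hr.trans ha)

/-- The uniform homeomorphism of `M` which stretches the radial coordinate of the end, moving
level `b` to level `s`, with support in `θ(S × [a, s + 1])`. -/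
noncomputable def stretchEquiv (hint : E.tail 2 ⊆ interior E.L) (ha : 2 ≤ a) (hab : a < b)
    (hbs : b ≤ s) : M ≃ᵤ M where
  toFun := E.radialMap (stretch a b s)
  invFun := E.radialMap (unstretch a b s)
  left_inv := E.radialMap_radialMap (fun r _ => unstretch_stretch hab hbs r)
    fun r hr => hr.trans (le_stretch r)
  right_inv := E.radialMap_radialMap (fun r _ => stretch_unstretch hab hbs r)
    fun r hr => one_le_unstretch hab hbs (by linarith) hr
  uniformContinuous_toFun := uniformContinuous_of_eq_id_off_compact
    ((continuous_radialMap_stretch hint ha hab).comp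
      (continuous_const.prodMk continuous_id : Continuous fun x : M => ((⟨s, hbs⟩ : Ici b), x)))
    (E.isCompact_shell (s + 1))
    fun _ hx => radialMap_eq_self_of_not_mem_shell (fun _ hr => stretch_of_ge hbs hr) hx
  uniformContinuous_invFun := uniformContinuous_of_eq_id_off_compact
    ((continuous_radialMap_unstretch hint ha hab).comp
      (continuous_const.prodMk continuous_id : Continuous fun x : M => ((⟨s, hbs⟩ : Ici b), x)))
    (E.isCompact_shell (s + 1))
    fun _ hx => radialMap_eq_self_of_not_mem_shell (fun _ hr => unstretch_of_ge hab hbs hr) hx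

/-- The displacement of the stretching homeomorphisms is bounded, locally uniformly in the
parameter. -/
lemma exists_dist_radialMap_stretch_le (hint : E.tail 2 ⊆ interior E.L) (ha : 2 ≤ a) (hab : a < b)
    (C : ℝ) :
    ∃ D : ℝ, ∀ s ∈ Icc b C, ∀ x, dist (E.radialMap (stretch a b s) x) x ≤ D := by
  have hK : IsCompact ((Subtype.val ⁻¹' Icc b C : Set (Ici b)) ×ˢ E.shell (C + 1)) := by
    refine IsCompact.prod ?_ (E.isCompact_shell _)
    rw [Subtype.isCompact_iff, Subtype.image_preimage_coe]
    exact isCompact_Icc.inter_left isClosed_Ici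
  obtain ⟨D, hD⟩ := hK.exists_bound_of_continuousOn
    (f := fun p : Ici b × M => dist (E.radialMap (stretch a b p.1) p.2) p.2)
    ((continuous_radialMap_stretch hint ha hab).dist continuous_snd).continuousOn
  refine ⟨max D 0, fun s hs x => ?_⟩
  by_cases hx : x ∈ E.shell (C + 1)
  · exact (le_abs_self _).trans ((hD (⟨s, hs.1⟩, x) ⟨hs, hx⟩).trans (le_max_left _ _))
  · rw [radialMap_eq_self_of_not_mem_shell
      (fun r hr => stretch_of_ge hs.1 (by linarith [hs.2])) hx, dist_self]
    exact le_max_right _ _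

section

variable (hint : E.tail 2 ⊆ interior E.L) (ha : 2 ≤ a) (hab : a < b) (hbs : b ≤ s)

lemma stretchEquiv_apply (x : M) :
    stretchEquiv hint ha hab hbs x = E.radialMap (stretch a b s) x := rfl

lemma stretchEquiv_eq_self {x : M} (hx : x ∈ E.tail a → x ∉ interior (E.tail a)) :
    stretchEquiv hint ha hab hbs x = x := by
  rw [stretchEquiv_apply]
  by_cases hL : x ∈ E.L
  · refine E.radialMap_eq_self ⟨x, hL⟩ (stretch_of_le hab hbs ?_)
    by_cases hxa : x ∈ E.tail a
    · exact (rad_eq_of_not_mem_interior hint ha (x := ⟨x, hL⟩) hxa (hx hxa)).le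
    · by_contra h
      exact hxa (E.mem_tail_iff.2 ⟨hL, (not_le.1 h).le⟩)
  · exact E.radialMap_of_not_mem hL

lemma stretchEquiv_mem_tail {x : M} (hx : x ∈ E.tail b) :
    stretchEquiv hint ha hab hbs x ∈ E.tail s :=
  radialMap_mem_tail (fun _ => le_stretch_of_ge hab hbs) hx

lemma stretchEquiv_mem_tail_iff (x : M) :
    stretchEquiv hint ha hab hbs x ∈ E.tail a ↔ x ∈ E.tail a := by
  constructor
  · intro h
    rw [← (stretchEquiv hint ha hab hbs).symm_apply_apply x]
    exact radialMap_mem_tail (fun _ => le_unstretch_of_ge hab hbs) h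
  · exact radialMap_mem_tail fun _ hr => hr.trans (le_stretch _)

lemma isBddEquiv_stretchEquiv : IsBddEquiv (stretchEquiv hint ha hab hbs) := by
  obtain ⟨D, hD⟩ := exists_dist_radialMap_stretch_le hint ha hab s
  exact ⟨D, hD s ⟨hbs, le_rfl⟩⟩

end

/-- For any two levels there is a deformation stage between them, defined for homeomorphisms with
sufficiently small displacement and keeping the displacement small: stretch the region between
the levels so that the stage given by the end deformation property applies. -/
theorem exists_isStage_of_lt (hiso : E.IsIsolated) (hint : E.tail 2 ⊆ interior E.L)
    (hED : HasED n E.L) {c c' : ℝ} (hc : 2 ≤ c) (hcc' : c < c') {β : ℝ} (hβ : 0 < β) :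
    ∃ α : ℝ, 0 < α ∧ ∃ ψ : bddUnifHomeo M → I → bddUnifHomeo M,
      IsStage n (E.tail c) (E.tail c') α β ψ := by
  obtain ⟨α₀, hα₀, hdist⟩ := hiso.exists_pos_dist_ge hint
  obtain ⟨s, hs, β₀, ψ, hψ, hsmall⟩ := E.exists_isStage_of_hasED hiso hint hED hc hα₀
    (fun x hx => hdist x (E.tail_anti hc hx)) c'
  set e : M ≃ᵤ M := stretchEquiv hint hc hcc' hs with he
  have heb : IsBddEquiv e := isBddEquiv_stretchEquiv hint hc hcc' hs
  have heC : ∀ x, e x ∈ E.tail c ↔ x ∈ E.tail c := stretchEquiv_mem_tail_iff hint hc hcc' hs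
  have heC' : ∀ x, e.symm x ∈ E.tail c ↔ x ∈ E.tail c := fun x => by
    rw [← heC, e.apply_symm_apply]
  obtain ⟨ε, hε, hεβ⟩ := Metric.uniformContinuous_iff.1 e.symm.uniformContinuous β hβ
  obtain ⟨δ, hδ, hδε⟩ := hsmall (ε / 2) (by positivity)
  obtain ⟨α, hα, hαδ⟩ := Metric.uniformContinuous_iff.1 e.uniformContinuous (min δ α₀ / 2)
    (by positivity)
  have hmin : 0 < min δ α₀ := by positivity
  have hin : ∀ {h : bddUnifHomeo M}, supDist (E.tail c) h.1 < ENNReal.ofReal α →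
      supDist (E.tail c) (conj e.symm heb.symm h).1 < ENNReal.ofReal (min δ α₀) := fun {h} hh =>
    (supDist_conjFun_le heC' (ε := min δ α₀ / 2) (fun x y hxy => (hαδ hxy).le) hh).trans_lt
      ((ENNReal.ofReal_lt_ofReal_iff hmin).2 (by linarith))
  refine ⟨α, hα, fun h t => conj e heb (ψ (conj e.symm heb.symm h) t),
    ?_, fun h => ?_, fun h hh x hx => ?_, fun h t x hx => ?_, fun h t hh => ?_, fun h hh t => ?_,
    fun h hh t x hx => ?_⟩
  · refine (continuous_conj e heb).comp_continuousOn (hψ.continuousOn.comp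
      (f := fun p : bddUnifHomeo M × I => (conj e.symm heb.symm p.1, p.2))
      (((continuous_conj _ heb.symm).comp continuous_fst).prodMk continuous_snd).continuousOn ?_)
    intro p hp
    exact (hin hp).trans_le (ENNReal.ofReal_le_ofReal (min_le_right _ _))
  · simp only [hψ.zero, conj_conj_symm]
  · change e.symm (UniformFun.toFun (ψ _ 1).1 (e x)) = x
    rw [hψ.one _ ((hin hh).trans_le (ENNReal.ofReal_le_ofReal (min_le_right _ _))) (e x)
      (stretchEquiv_mem_tail hint hc hcc' hs hx), e.symm_apply_apply]
  · change e.symm (UniformFun.toFun (ψ _ t).1 (e x)) = _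
    rw [hψ.eq_off _ t (e x) (fun h => hx ((heC x).1 h))]
    change e.symm (e (UniformFun.toFun h.1 (e.symm (e x)))) = _
    simp
  · refine supDist_conjFun_le heC (α := ε) (fun x y hxy => (hεβ hxy).le) ?_
    refine (hδε _ t ((hin hh).trans_le (ENNReal.ofReal_le_ofReal (min_le_left _ _)))).trans_lt ?_
    exact (ENNReal.ofReal_lt_ofReal_iff hε).2 (by linarith)
  · rw [hψ.eq_self, conj_conj_symm]
    intro x hx
    change e (UniformFun.toFun h.1 (e.symm x)) = x
    rw [hh _ ((heC' x).2 hx), e.apply_symm_apply]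
  · change e.symm (UniformFun.toFun (ψ _ t).1 (e x)) = x
    rw [hψ.boundary _ _ t (e x) ((mem_manifoldBoundary_homeomorph e.toHomeomorph x).2 hx),
      e.symm_apply_apply]
    intro y hy
    change e (UniformFun.toFun h.1 (e.symm y)) = y
    have h1 := hh (e.symm y) ((mem_manifoldBoundary_homeomorph e.symm.toHomeomorph y).2 hy)
    rw [h1, e.apply_symm_apply]

end ProperProductEndIn

end Conjugation

/-! ### Bi-infinite chains of deformation stages -/

section Chain

open Set Filter Topology

universe u

variable {n : ℕ} {M : Type u} [MetricSpace M]

/-- A bi-infinite chain of deformation stages along an end. The `j`-th stage applies to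
homeomorphisms with displacement less than `2 α j` on `L_{c j}` and makes them the identity on
`L_{c (j + 1)}`, in such a way that the result is admissible for the next stage. The levels `c j`
tend to `3` as `j → -∞`. -/
structure StageChain (E : ProperProductEndIn n M) where
  c : ℤ → ℝ
  α : ℤ → ℝ
  β : ℤ → ℝ
  ψ : ℤ → bddUnifHomeo M → I → bddUnifHomeo M
  stage : ∀ j, IsStage n (E.tail (c j)) (E.tail (c (j + 1))) (2 * α j) (β j) (ψ j)
  three_le : ∀ j, 3 ≤ c j
  c_mono : Monotone c
  c_lim : ∀ ε : ℝ, 0 < ε → ∃ j, c j < 3 + ε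
  α_pos : ∀ j, 0 < α j
  α_mono : StrictMono α
  α_lim : ∀ ε : ℝ, 0 < ε → ∃ j, α j < ε
  α_unbounded : ∀ r : ℝ, ∃ j, r < α j
  β_le : ∀ j, β j ≤ α (j + 1)

/-- Two one-sided chains for a relation which start at the same element combine to a chain indexed
by the integers. -/
lemma exists_int_chain {S : Type*} {r : S → S → Prop} {u v : ℕ → S} (h0 : u 0 = v 0)
    (hu : ∀ k, r (u k) (u (k + 1))) (hv : ∀ k, r (v (k + 1)) (v k)) :
    ∃ w : ℤ → S, (∀ k : ℕ, w k = u k) ∧ (∀ k : ℕ, w (-k) = v k) ∧ ∀ j, r (w j) (w (j + 1)) := by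
  let w : ℤ → S := fun j => if 0 ≤ j then u j.toNat else v (-j).toNat
  have h1 : ∀ k : ℕ, w k = u k := fun k => by simp [w]
  have h2 : ∀ k : ℕ, w (-k) = v k := by
    rintro (_ | k)
    · simpa [w] using h0
    · have : ¬ (0 : ℤ) ≤ -((k + 1 : ℕ) : ℤ) := by omega
      simp only [w, this, if_false, neg_neg, Int.toNat_natCast]
  refine ⟨w, h1, h2, fun j => ?_⟩
  rcases le_or_gt 0 j with h | h
  · obtain ⟨k, rfl⟩ := Int.eq_ofNat_of_zero_le h
    have := hu k
    rw [← h1, ← h1] at this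
    exact_mod_cast this
  · obtain ⟨k, rfl⟩ : ∃ k : ℕ, j = -((k + 1 : ℕ) : ℤ) := ⟨(-j).toNat - 1, by omega⟩
    have := hv k
    rw [← h2, ← h2] at this
    have e : -((k + 1 : ℕ) : ℤ) + 1 = -(k : ℤ) := by push_cast; ring
    rw [e]
    exact this

/-- Sequences of states subject to a step condition and an invariant. -/
lemma exists_nat_chain {S : Type*} {p : ℕ → S → Prop} {r : ℕ → S → S → Prop} {s : S} (hs : p 0 s)
    (hstep : ∀ k s, p k s → ∃ s', p (k + 1) s' ∧ r k s s') :
    ∃ u : ℕ → S, u 0 = s ∧ (∀ k, p k (u k)) ∧ ∀ k, r k (u k) (u (k + 1)) := by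
  choose! F hF using hstep
  let u : ℕ → S := fun k => Nat.rec s (fun k s => F k s) k
  have hu : ∀ k, p k (u k) := by
    intro k
    induction k with
    | zero => exact hs
    | succ k ih => exact (hF k _ ih).1
  exact ⟨u, rfl, hu, fun k => (hF k _ (hu k)).2⟩

/-- Isolated ends with the end deformation property carry chains of stages: upwards the
displacement bounds grow as required by the end deformation property, downwards they are chosen
small enough for stages between levels decreasing to `3`. -/
theorem ProperProductEndIn.nonempty_stageChain (E : ProperProductEndIn n M) (hiso : E.IsIsolated)
    (hint : E.tail 2 ⊆ interior E.L) (hED : HasED n E.L) : Nonempty (StageChain E) := by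
  obtain ⟨α₀, hα₀, hdist₀⟩ := hiso.exists_pos_dist_ge hint
  -- a state is a pair `(c, α)`
  let r : ℝ × ℝ → ℝ × ℝ → Prop := fun s s' => s.1 ≤ s'.1 ∧ s.2 < s'.2 ∧
    ∃ β ψ, IsStage n (E.tail s.1) (E.tail s'.1) (2 * s.2) β ψ ∧ β ≤ s'.2
  obtain ⟨u, hu0, hup, hur⟩ := exists_nat_chain (s := ((4, α₀ / 2) : ℝ × ℝ))
    (p := fun k s => 4 ≤ s.1 ∧ 0 < s.2 ∧ (k : ℝ) < s.2 + 1 ∧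
      ∀ x ∈ E.tail s.1, ∀ y ∉ E.L, 2 * s.2 ≤ dist x y)
    (r := fun _ s s' => r s s')
    ⟨le_rfl, by positivity, by simp; positivity, fun x hx y hy => by
      have := hdist₀ x (E.tail_anti (by norm_num) hx) y hy
      simp only
      linarith⟩ (by
      rintro k ⟨c, α⟩ ⟨hc, hα, hk, hd⟩
      simp only at hc hα hk hd
      obtain ⟨c₁, hc₁, β, ψ, hψ, -⟩ := E.exists_isStage_of_hasED hiso hint hED
        (by linarith : (2 : ℝ) ≤ c) (by positivity : (0 : ℝ) < 2 * α) hd c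
      have hα' : 0 < max β (α + 1) := lt_max_of_lt_right (by linarith)
      obtain ⟨R, hR⟩ := hiso.exists_dist_ge (c := 2 * max β (α + 1)) (by positivity)
      refine ⟨(max c₁ R, max β (α + 1)), ⟨?_, hα', ?_, ?_⟩, ?_, ?_, β, ψ, ?_, ?_⟩
      · exact hc.trans (hc₁.trans (le_max_left _ _))
      · push_cast
        linarith [le_max_right β (α + 1)]
      · exact fun x hx => hR x (E.tail_anti (le_max_right _ _) hx)
      · exact hc₁.trans (le_max_left _ _)
      · exact lt_of_lt_of_le (by simp) (le_max_right β (α + 1))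
      · exact hψ.mono le_rfl le_rfl (E.tail_anti (le_max_left _ _))
      · exact le_max_left _ _)
  obtain ⟨v, hv0, hvp, hvr⟩ := exists_nat_chain (s := ((4, α₀ / 2) : ℝ × ℝ))
    (p := fun k s => s.1 = 3 + 1 / ((k : ℝ) + 1) ∧ 0 < s.2 ∧ (k = 0 ∨ s.2 ≤ 1 / ((k : ℝ) + 1)))
    (r := fun _ s s' => r s' s)
    ⟨by norm_num, by positivity, Or.inl rfl⟩ (by
      rintro k ⟨c, α⟩ ⟨hc, hα, -⟩
      simp only at hc hα
      have hlt : 3 + 1 / (((k + 1 : ℕ) : ℝ) + 1) < c := by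
        rw [hc]
        have : 1 / (((k + 1 : ℕ) : ℝ) + 1) < 1 / ((k : ℝ) + 1) := by
          apply one_div_lt_one_div_of_lt <;> push_cast <;> linarith [(k.cast_nonneg : (0 : ℝ) ≤ k)]
        linarith
      have h3 : (0 : ℝ) < 1 / (((k + 1 : ℕ) : ℝ) + 1) := by positivity
      obtain ⟨α', hα', ψ, hψ⟩ := ProperProductEndIn.exists_isStage_of_lt hiso hint hED
        (by linarith : (2 : ℝ) ≤ 3 + 1 / (((k + 1 : ℕ) : ℝ) + 1)) hlt hα
      refine ⟨(3 + 1 / (((k + 1 : ℕ) : ℝ) + 1),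
        min (min (α' / 2) (α / 2)) (1 / (((k + 1 : ℕ) : ℝ) + 1))), ⟨rfl, ?_, ?_⟩, hlt.le, ?_,
        α, ψ, ?_, le_rfl⟩
      · simp only; positivity
      · exact Or.inr (min_le_right _ _)
      · have : min (min (α' / 2) (α / 2)) (1 / (((k + 1 : ℕ) : ℝ) + 1)) ≤ α / 2 :=
          (min_le_left _ _).trans (min_le_right _ _)
        simp only
        linarith
      · refine hψ.mono ?_ le_rfl subset_rfl
        have : min (min (α' / 2) (α / 2)) (1 / (((k + 1 : ℕ) : ℝ) + 1)) ≤ α' / 2 :=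
          (min_le_left _ _).trans (min_le_left _ _)
        simp only
        linarith)
  obtain ⟨w, hwu, hwv, hw⟩ := exists_int_chain (hu0.trans hv0.symm) hur hvr
  choose h1 h2 β ψ hψ hβ using hw
  have hcmono : Monotone fun j => (w j).1 := monotone_int_of_le_succ h1
  have hcase : ∀ j : ℤ, (∃ k : ℕ, j = k) ∨ ∃ k : ℕ, j = -k := fun j => by
    obtain ⟨k, h | h⟩ := Int.eq_nat_or_neg j
    · exact Or.inl ⟨k, h⟩
    · exact Or.inr ⟨k, h⟩
  refine ⟨⟨fun j => (w j).1, fun j => (w j).2, β, ψ, hψ, fun j => ?_, hcmono, fun ε hε => ?_,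
    fun j => ?_, strictMono_int_of_lt_succ h2, fun ε hε => ?_, fun r => ?_, hβ⟩⟩
  · rcases hcase j with ⟨k, rfl⟩ | ⟨k, rfl⟩
    · simp only [hwu]; linarith [(hup k).1]
    · simp only [hwv, (hvp k).1]
      have : (0 : ℝ) < 1 / ((k : ℝ) + 1) := by positivity
      linarith
  · obtain ⟨k, hk⟩ := exists_nat_one_div_lt hε
    refine ⟨-k, ?_⟩
    simp only [hwv, (hvp k).1]
    linarith
  · rcases hcase j with ⟨k, rfl⟩ | ⟨k, rfl⟩
    · simp only [hwu]; exact (hup k).2.1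
    · simp only [hwv]; exact (hvp k).2.1
  · obtain ⟨k, hk⟩ := exists_nat_one_div_lt hε
    refine ⟨-((k + 1 : ℕ) : ℤ), ?_⟩
    simp only [hwv]
    rcases (hvp (k + 1)).2.2 with h | h
    · omega
    · refine h.trans_lt (lt_trans ?_ hk)
      apply one_div_lt_one_div_of_lt <;> push_cast <;> linarith [(k.cast_nonneg : (0 : ℝ) ≤ k)]
  · obtain ⟨k, hk⟩ := exists_nat_gt (r + 1)
    refine ⟨k, ?_⟩
    simp only [hwu]
    linarith [(hup k).2.2.1]

end Chain

/-! ### Composing a chain of stages -/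

section Compose

open Set Filter Topology

universe u

variable {n : ℕ} {M : Type u} [MetricSpace M] {E : ProperProductEndIn n M}

/-- The continuous function which is `0` up to `a`, `1` from `b` on, and affine in between. -/
noncomputable def ramp (a b x : ℝ) : ℝ := max 0 (min 1 ((x - a) / (b - a)))

lemma continuous_ramp (a b : ℝ) : Continuous (ramp a b) := by
  unfold ramp; fun_prop

lemma ramp_nonneg (a b x : ℝ) : 0 ≤ ramp a b x := le_max_left _ _

lemma ramp_le_one (a b x : ℝ) : ramp a b x ≤ 1 := max_le zero_le_one (min_le_left _ _)

lemma ramp_eq_zero {a b x : ℝ} (hab : a < b) (hx : x ≤ a) : ramp a b x = 0 :=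
  max_eq_left (min_le_of_right_le (div_nonpos_of_nonpos_of_nonneg (by linarith) (by linarith)))

lemma ramp_eq_one {a b x : ℝ} (hab : a < b) (hx : b ≤ x) : ramp a b x = 1 := by
  have : 1 ≤ (x - a) / (b - a) := (one_le_div (by linarith)).2 (by linarith)
  rw [ramp, min_eq_left this, max_eq_right zero_le_one]

/-- The displacement on `L_3` as a real number. -/
noncomputable def ProperProductEndIn.eta (E : ProperProductEndIn n M) (h : bddUnifHomeo M) : ℝ :=
  (supDist (E.tail 3) h.1).toReal

lemma supDist_ne_top (C : Set M) (h : bddUnifHomeo M) : supDist C h.1 ≠ ⊤ :=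
  ((supDist_le_edist C h.1).trans_lt h.2.2).ne

lemma ofReal_eta (h : bddUnifHomeo M) :
    ENNReal.ofReal (E.eta h) = supDist (E.tail 3) h.1 :=
  ENNReal.ofReal_toReal (supDist_ne_top _ _)

lemma eta_nonneg (h : bddUnifHomeo M) : 0 ≤ E.eta h := ENNReal.toReal_nonneg

lemma continuous_eta : Continuous E.eta := by
  rw [continuous_iff_continuousAt]
  intro h
  exact (ENNReal.tendsto_toReal (supDist_ne_top _ _)).comp
    ((continuous_supDist _).comp continuous_subtype_val).continuousAt

lemma eta_eq_zero_iff {h : bddUnifHomeo M} :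
    E.eta h = 0 ↔ ∀ x ∈ E.tail 3, UniformFun.toFun h.1 x = x := by
  rw [← supDist_eq_zero, ← ofReal_eta, ENNReal.ofReal_eq_zero]
  exact ⟨fun h => h.le, fun h => le_antisymm h (eta_nonneg _)⟩

namespace StageChain

variable (S : StageChain E)

/-- Stage `j` runs during the time interval `[τ j, τ (j + 1)]`. -/
noncomputable def τ (j : ℤ) : ℝ := S.α j / (1 + S.α j)

lemma τ_pos (j : ℤ) : 0 < S.τ j := by
  have := S.α_pos j
  unfold τ; positivity

lemma τ_lt_one (j : ℤ) : S.τ j < 1 := by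
  have := S.α_pos j
  rw [τ, div_lt_one (by linarith)]; linarith

lemma τ_lt (j : ℤ) : S.τ j < S.τ (j + 1) := by
  have h1 := S.α_pos j
  have h2 := S.α_mono (lt_add_one j)
  rw [τ, τ, div_lt_div_iff₀ (by linarith) (by linarith)]
  nlinarith

/-- How far stage `j` has been carried out at time `t` on homeomorphisms with displacement `η`:
the stage is omitted if `α j ≤ η` and completed if `η ≤ α (j - 1)`. -/
noncomputable def time (j : ℤ) (η : ℝ) (t : I) : I :=
  ⟨min (1 - ramp (S.α (j - 1)) (S.α j) η) (ramp (S.τ j) (S.τ (j + 1)) t),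
    le_min (sub_nonneg.2 (ramp_le_one _ _ _)) (ramp_nonneg _ _ _),
    (min_le_right _ _).trans (ramp_le_one _ _ _)⟩

lemma continuous_time (j : ℤ) : Continuous fun p : ℝ × I => S.time j p.1 p.2 :=
  Continuous.subtype_mk ((continuous_const.sub ((continuous_ramp _ _).comp continuous_fst)).min
    ((continuous_ramp _ _).comp (continuous_subtype_val.comp continuous_snd))) _

lemma α_lt (j : ℤ) : S.α (j - 1) < S.α j := S.α_mono (by omega)

lemma time_eq_zero {j : ℤ} {η : ℝ} (h : S.α j ≤ η) (t : I) : S.time j η t = 0 := by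
  apply Subtype.ext
  simp only [time, ramp_eq_one (S.α_lt j) h, sub_self, Icc.coe_zero]
  exact min_eq_left (ramp_nonneg _ _ _)

lemma time_zero (j : ℤ) (η : ℝ) : S.time j η 0 = 0 := by
  apply Subtype.ext
  simp only [time, Icc.coe_zero, ramp_eq_zero (S.τ_lt j) (S.τ_pos j).le]
  exact min_eq_right (sub_nonneg.2 (ramp_le_one _ _ _))

lemma time_one {j : ℤ} {η : ℝ} (h : η ≤ S.α (j - 1)) : S.time j η 1 = 1 := by
  apply Subtype.ext
  simp [time, ramp_eq_zero (S.α_lt j) h, ramp_eq_one (S.τ_lt j) (S.τ_lt_one _).le]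

/-- A stage starts only after the preceding one has been completed. -/
lemma time_eq_one_or {j : ℤ} {η : ℝ} (h : η ≤ S.α (j - 1)) (t : I) :
    S.time j η t = 1 ∨ S.time (j + 1) η t = 0 := by
  rcases le_total (S.τ (j + 1)) t with ht | ht
  · left
    apply Subtype.ext
    simp [time, ramp_eq_zero (S.α_lt j) h, ramp_eq_one (S.τ_lt j) ht]
  · right
    apply Subtype.ext
    simp only [time, ramp_eq_zero (S.τ_lt (j + 1)) ht, Icc.coe_zero]
    exact min_eq_right (sub_nonneg.2 (ramp_le_one _ _ _))

lemma tail_c_subset (j : ℤ) : E.tail (S.c j) ⊆ E.tail 3 := E.tail_anti (S.three_le j)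

lemma supDist_c_lt {j : ℤ} {g : bddUnifHomeo M}
    (hg : supDist (E.tail 3) g.1 ≤ ENNReal.ofReal (S.α j)) :
    supDist (E.tail (S.c j)) g.1 < ENNReal.ofReal (2 * S.α j) := by
  have := S.α_pos j
  exact ((supDist_mono (S.tail_c_subset j) _).trans hg).trans_lt
    ((ENNReal.ofReal_lt_ofReal_iff (by linarith)).2 (by linarith))

lemma eq_off_three (j : ℤ) (g : bddUnifHomeo M) (t : I) {x : M} (hx : x ∉ E.tail 3) :
    UniformFun.toFun (S.ψ j g t).1 x = UniformFun.toFun g.1 x :=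
  (S.stage j).eq_off g t x fun h => hx (S.tail_c_subset j h)

lemma supDist_ψ_le {j : ℤ} {g : bddUnifHomeo M}
    (hg : supDist (E.tail 3) g.1 ≤ ENNReal.ofReal (S.α j)) (t : I) :
    supDist (E.tail 3) (S.ψ j g t).1 ≤ ENNReal.ofReal (S.α (j + 1)) := by
  refine supDist_le_iff.2 fun x hx => ?_
  by_cases hxc : x ∈ E.tail (S.c j)
  · exact (edist_le_supDist _ hxc).trans (((S.stage j).supDist_le g t (S.supDist_c_lt hg)).trans
      (ENNReal.ofReal_le_ofReal (S.β_le j)))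
  · rw [(S.stage j).eq_off g t x hxc]
    exact (edist_le_supDist _ hx).trans (hg.trans
      (ENNReal.ofReal_le_ofReal (S.α_mono (lt_add_one j)).le))

lemma continuousAt_ψ {T : Type*} [TopologicalSpace T] {j : ℤ} {g : T → bddUnifHomeo M} {s : T → I}
    {p : T} (hg : ContinuousAt g p) (hs : ContinuousAt s p)
    (hgp : supDist (E.tail (S.c j)) (g p).1 < ENNReal.ofReal (2 * S.α j)) :
    ContinuousAt (fun q => S.ψ j (g q) (s q)) p := by
  have hopen : IsOpen {q : bddUnifHomeo M × I |
      supDist (E.tail (S.c j)) q.1.1 < ENNReal.ofReal (2 * S.α j)} :=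
    isOpen_lt ((continuous_supDist _).comp (continuous_subtype_val.comp continuous_fst))
      continuous_const
  have h1 : ContinuousAt (fun q : bddUnifHomeo M × I => S.ψ j q.1 q.2) (g p, s p) :=
    (S.stage j).continuousOn.continuousAt (hopen.mem_nhds hgp)
  exact h1.comp (f := fun q => (g q, s q)) (hg.prodMk hs)

/-- The first possibly nontrivial stage, carried out according to `time`. -/
noncomputable def step₁ (k : ℤ) (h : bddUnifHomeo M) (t : I) : bddUnifHomeo M :=
  S.ψ k h (S.time k (E.eta h) t)

/-- Stages `k` and `k + 1`. -/
noncomputable def step₂ (k : ℤ) (h : bddUnifHomeo M) (t : I) : bddUnifHomeo M :=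
  S.ψ (k + 1) (S.step₁ k h t) (S.time (k + 1) (E.eta h) t)

/-- Stages `k`, `k + 1` and `k + 2`. -/
noncomputable def step₃ (k : ℤ) (h : bddUnifHomeo M) (t : I) : bddUnifHomeo M :=
  S.ψ (k + 2) (S.step₂ k h t) (S.time (k + 2) (E.eta h) t)

lemma step₁_of_le {k : ℤ} {h : bddUnifHomeo M} (hk : S.α k ≤ E.eta h) (t : I) :
    S.step₁ k h t = h := by
  rw [step₁, S.time_eq_zero hk, (S.stage k).zero]

lemma supDist_step₁_le {k : ℤ} {h : bddUnifHomeo M} (hk : E.eta h ≤ S.α (k + 1)) (t : I) :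
    supDist (E.tail 3) (S.step₁ k h t).1 ≤ ENNReal.ofReal (S.α (k + 1)) := by
  rcases le_total (S.α k) (E.eta h) with h1 | h1
  · rw [S.step₁_of_le h1, ← ofReal_eta]
    exact ENNReal.ofReal_le_ofReal hk
  · exact S.supDist_ψ_le (by rw [← ofReal_eta]; exact ENNReal.ofReal_le_ofReal h1) _

lemma supDist_step₂_le {k : ℤ} {h : bddUnifHomeo M} (hk : E.eta h ≤ S.α (k + 1)) (t : I) :
    supDist (E.tail 3) (S.step₂ k h t).1 ≤ ENNReal.ofReal (S.α (k + 2)) := by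
  have := S.supDist_ψ_le (S.supDist_step₁_le hk t) (S.time (k + 1) (E.eta h) t)
  rwa [add_assoc] at this

lemma continuousAt_time_eta (k : ℤ) (p : bddUnifHomeo M × I) :
    ContinuousAt (fun q : bddUnifHomeo M × I => S.time k (E.eta q.1) q.2) p :=
  ((S.continuous_time k).comp
    ((continuous_eta.comp continuous_fst).prodMk continuous_snd)).continuousAt

lemma continuousAt_step₁ (k : ℤ) (p : bddUnifHomeo M × I) :
    ContinuousAt (fun q : bddUnifHomeo M × I => S.step₁ k q.1 q.2) p := by
  have hα := S.α_pos k
  rcases lt_or_ge (S.α k) (E.eta p.1) with h | h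
  · refine continuousAt_fst.congr ?_
    filter_upwards [(continuous_eta.comp continuous_fst).continuousAt.eventually
      (lt_mem_nhds h)] with q hq
    exact (S.step₁_of_le hq.le q.2).symm
  · refine S.continuousAt_ψ continuousAt_fst (S.continuousAt_time_eta k p) (S.supDist_c_lt ?_)
    rw [← ofReal_eta]
    exact ENNReal.ofReal_le_ofReal h

lemma continuousAt_step₃ {k : ℤ} {p : bddUnifHomeo M × I} (hk : E.eta p.1 ≤ S.α (k + 1)) :
    ContinuousAt (fun q : bddUnifHomeo M × I => S.step₃ k q.1 q.2) p :=
  S.continuousAt_ψ (S.continuousAt_ψ (S.continuousAt_step₁ k p) (S.continuousAt_time_eta _ p)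
    (S.supDist_c_lt (S.supDist_step₁_le hk p.2))) (S.continuousAt_time_eta _ p)
    (S.supDist_c_lt (S.supDist_step₂_le hk p.2))

lemma exists_index {η : ℝ} (hη : 0 < η) : ∃ k : ℤ, S.α (k - 1) ≤ η ∧ η < S.α k := by
  obtain ⟨j₀, hj₀⟩ := S.α_lim η hη
  obtain ⟨j₁, hj₁⟩ := S.α_unbounded η
  obtain ⟨k, hk, hmin⟩ := Int.exists_least_of_bdd (P := fun k => η < S.α k)
    ⟨j₀, fun z hz => S.α_mono.le_iff_le.1 (hj₀.le.trans (le_of_lt hz))⟩ ⟨j₁, hj₁⟩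
  refine ⟨k, ?_, hk⟩
  by_contra h
  have := hmin (k - 1) (not_le.1 h)
  omega

lemma index_le {η : ℝ} {k j : ℤ} (hk : S.α (k - 1) ≤ η) (hj : η < S.α j) : k ≤ j := by
  have := S.α_mono.lt_iff_lt.1 (hk.trans_lt hj)
  omega

open Classical in
/-- The index `k` with `α (k - 1) ≤ η < α k`. -/
noncomputable def index (η : ℝ) : ℤ := if hη : 0 < η then (S.exists_index hη).choose else 0

lemma index_spec {η : ℝ} (hη : 0 < η) : S.α (S.index η - 1) ≤ η ∧ η < S.α (S.index η) := by
  rw [index, dif_pos hη]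
  exact (S.exists_index hη).choose_spec

open Classical in
/-- The composition of all stages. On maps with `α (k - 1) ≤ η < α k` only the stages `k` and
`k + 1` have an effect: the preceding ones are omitted, and stage `k + 1` is completed before the
later ones, which fix its result. -/
noncomputable def deform (h : bddUnifHomeo M) (t : I) : bddUnifHomeo M :=
  if 0 < E.eta h then S.step₂ (S.index (E.eta h)) h t else h

lemma deform_of_eta_eq_zero {h : bddUnifHomeo M} (h0 : E.eta h = 0) (t : I) : S.deform h t = h :=
  if_neg (by rw [h0]; exact lt_irrefl _)

lemma deform_of_pos {h : bddUnifHomeo M} (h0 : 0 < E.eta h) (t : I) :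
    S.deform h t = S.step₂ (S.index (E.eta h)) h t := if_pos h0

/-- The result of a completed stage is fixed by the following one. -/
lemma ψ_succ_eq_self {j : ℤ} {g : bddUnifHomeo M} {η : ℝ} {t : I} (hη : η ≤ S.α (j - 1))
    (hg : supDist (E.tail 3) g.1 ≤ ENNReal.ofReal (S.α j)) :
    S.ψ (j + 1) (S.ψ j g (S.time j η t)) (S.time (j + 1) η t) = S.ψ j g (S.time j η t) := by
  rcases S.time_eq_one_or hη t with h | h
  · rw [h]
    exact (S.stage (j + 1)).eq_self _ ((S.stage j).one g (S.supDist_c_lt hg)) _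
  · rw [h, (S.stage (j + 1)).zero]

lemma deform_eq_step₃ {k : ℤ} {h : bddUnifHomeo M} (h1 : S.α (k - 1) < E.eta h)
    (h2 : E.eta h < S.α (k + 1)) (t : I) : S.deform h t = S.step₃ k h t := by
  have hpos : 0 < E.eta h := (S.α_pos _).trans h1
  obtain ⟨i1, i2⟩ := S.index_spec hpos
  rw [S.deform_of_pos hpos]
  rcases lt_or_ge (E.eta h) (S.α k) with h3 | h3
  · have hi : S.index (E.eta h) = k := le_antisymm (S.index_le i1 h3) (S.index_le h1.le i2)
    rw [hi]
    have := S.ψ_succ_eq_self (j := k + 1) (g := S.step₁ k h t) (η := E.eta h) (t := t)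
      (by rw [add_sub_cancel_right]; exact h3.le) (S.supDist_step₁_le h2.le t)
    rw [add_assoc] at this
    exact this.symm
  · have hi : S.index (E.eta h) = k + 1 :=
      le_antisymm (S.index_le i1 h2) (S.index_le (by rwa [add_sub_cancel_right]) i2)
    rw [hi, step₃, step₂, step₂, step₁, S.step₁_of_le h3, add_assoc]
    rfl

lemma deform_zero (h : bddUnifHomeo M) : S.deform h 0 = h := by
  rcases (eta_nonneg (E := E) h).eq_or_lt with h0 | h0
  · exact S.deform_of_eta_eq_zero h0.symm _
  · rw [S.deform_of_pos h0, step₂, step₁, S.time_zero, S.time_zero, (S.stage _).zero,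
      (S.stage _).zero]

lemma deform_one {h : bddUnifHomeo M} (h0 : 0 < E.eta h) {x : M}
    (hx : x ∈ E.tail (S.c (S.index (E.eta h) + 2))) : UniformFun.toFun (S.deform h 1).1 x = x := by
  obtain ⟨i1, i2⟩ := S.index_spec h0
  rw [S.deform_of_pos h0, step₂, S.time_one (by rw [add_sub_cancel_right]; exact i2.le)]
  refine (S.stage _).one _ (S.supDist_c_lt (S.supDist_step₁_le ?_ _)) x ?_
  · exact (i2.trans (S.α_mono (lt_add_one _))).le
  · rwa [add_assoc]

lemma deform_off (h : bddUnifHomeo M) (t : I) {x : M} (hx : x ∉ E.tail 3) :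
    UniformFun.toFun (S.deform h t).1 x = UniformFun.toFun h.1 x := by
  rcases (eta_nonneg (E := E) h).eq_or_lt with h0 | h0
  · rw [S.deform_of_eta_eq_zero h0.symm]
  · rw [S.deform_of_pos h0, step₂, S.eq_off_three _ _ _ hx, step₁, S.eq_off_three _ _ _ hx]

lemma deform_boundary {h : bddUnifHomeo M}
    (hh : ∀ x ∈ manifoldBoundary n M, UniformFun.toFun h.1 x = x) (t : I) :
    ∀ x ∈ manifoldBoundary n M, UniformFun.toFun (S.deform h t).1 x = x := by
  rcases (eta_nonneg (E := E) h).eq_or_lt with h0 | h0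
  · rwa [S.deform_of_eta_eq_zero h0.symm]
  · rw [S.deform_of_pos h0]
    exact (S.stage _).boundary _ ((S.stage _).boundary _ hh _) _

lemma supDist_deform_le {h : bddUnifHomeo M} {k : ℤ} (hk : E.eta h < S.α k) (t : I) :
    supDist (E.tail 3) (S.deform h t).1 ≤ ENNReal.ofReal (S.α (k + 2)) := by
  rcases (eta_nonneg (E := E) h).eq_or_lt with h0 | h0
  · rw [S.deform_of_eta_eq_zero h0.symm, ← ofReal_eta]
    exact ENNReal.ofReal_le_ofReal (hk.trans (S.α_mono (by omega))).le
  · obtain ⟨i1, i2⟩ := S.index_spec h0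
    rw [S.deform_of_pos h0]
    refine (S.supDist_step₂_le (i2.trans (S.α_mono (lt_add_one _))).le t).trans
      (ENNReal.ofReal_le_ofReal (S.α_mono.monotone ?_))
    have := S.index_le i1 hk
    omega

lemma edist_deform_id_le {h : bddUnifHomeo M} {k : ℤ} (hk : E.eta h < S.α k) (t : I) :
    edist (S.deform h t).1 (idFun M) ≤ max (ENNReal.ofReal (S.α (k + 2))) (edist h.1 (idFun M)) := by
  refine UniformFun.edist_le.2 fun x => ?_
  by_cases hx : x ∈ E.tail 3
  · exact le_max_of_le_left ((edist_le_supDist _ hx).trans (S.supDist_deform_le hk t))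
  · rw [S.deform_off h t hx]
    exact le_max_of_le_right (UniformFun.edist_eval_le (f := h.1) (g := idFun M))

lemma edist_deform_le {h : bddUnifHomeo M} {k : ℤ} (hk : E.eta h < S.α k) (t : I) :
    edist (S.deform h t).1 h.1 ≤ ENNReal.ofReal (S.α (k + 2)) + ENNReal.ofReal (S.α (k + 2)) := by
  refine UniformFun.edist_le.2 fun x => ?_
  by_cases hx : x ∈ E.tail 3
  · refine (edist_triangle_right _ _ x).trans ?_
    refine add_le_add ((edist_le_supDist _ hx).trans (S.supDist_deform_le hk t))
      ((edist_le_supDist _ hx).trans ?_)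
    rw [← ofReal_eta]
    exact ENNReal.ofReal_le_ofReal (hk.trans (S.α_mono (by omega))).le
  · rw [S.deform_off h t hx, edist_self]
    exact zero_le

/-- The composed deformation is continuous. At maps which are the identity on `L_3` this holds
since the displacements produced by the stages `j` tend to zero as `j → -∞`. -/
lemma continuous_deform : Continuous fun p : bddUnifHomeo M × I => S.deform p.1 p.2 := by
  rw [continuous_iff_continuousAt]
  intro p
  rcases (eta_nonneg (E := E) p.1).eq_or_lt with h0 | h0
  · rw [ContinuousAt, S.deform_of_eta_eq_zero h0.symm, EMetric.tendsto_nhds]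
    intro ε hε
    obtain ⟨r, hr0, hr⟩ := ENNReal.lt_iff_exists_nnreal_btwn.1 hε
    obtain ⟨j, hj⟩ := S.α_lim (r / 3) (by
      have : (0 : ℝ) < r := by exact_mod_cast hr0
      positivity)
    have hα := S.α_pos j
    have h1 : ∀ᶠ q : bddUnifHomeo M × I in 𝓝 p, E.eta q.1 < S.α (j - 2) :=
      (continuous_eta.comp continuous_fst).continuousAt.eventually (gt_mem_nhds (by
        simp only [Function.comp]
        rw [← h0]; exact S.α_pos _))
    have h2 : ∀ᶠ q : bddUnifHomeo M × I in 𝓝 p, edist q.1 p.1 < ENNReal.ofReal (S.α j) :=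
      EMetric.tendsto_nhds.1 (continuousAt_fst (p := p)) _ (ENNReal.ofReal_pos.2 hα)
    filter_upwards [h1, h2] with q hq1 hq2
    have h3 := S.edist_deform_le hq1 q.2
    rw [sub_add_cancel] at h3
    have hr3 : (r : ENNReal) = ENNReal.ofReal r := (ENNReal.ofReal_coe_nnreal).symm
    calc edist (S.deform q.1 q.2) p.1 ≤ edist (S.deform q.1 q.2) q.1 + edist q.1 p.1 :=
          edist_triangle _ _ _
      _ ≤ (ENNReal.ofReal (S.α j) + ENNReal.ofReal (S.α j)) + ENNReal.ofReal (S.α j) :=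
          add_le_add h3 hq2.le
      _ = ENNReal.ofReal (S.α j + S.α j + S.α j) := by
          rw [ENNReal.ofReal_add (by linarith) hα.le, ENNReal.ofReal_add hα.le hα.le]
      _ ≤ r := by
          rw [hr3]
          exact ENNReal.ofReal_le_ofReal (by linarith)
      _ < ε := hr
  · obtain ⟨k, hk1, hk2⟩ : ∃ k : ℤ, S.α (k - 1) < E.eta p.1 ∧ E.eta p.1 < S.α (k + 1) := by
      obtain ⟨i1, i2⟩ := S.index_spec h0
      rcases i1.eq_or_lt with h | h
      · refine ⟨S.index (E.eta p.1) - 1, ?_, by rwa [sub_add_cancel]⟩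
        exact (S.α_lt _).trans_eq h
      · exact ⟨_, h, i2.trans (S.α_mono (lt_add_one _))⟩
    refine (S.continuousAt_step₃ hk2.le).congr ?_
    have hc : ContinuousAt (fun q : bddUnifHomeo M × I => E.eta q.1) p :=
      (continuous_eta.comp continuous_fst).continuousAt
    filter_upwards [hc.eventually (lt_mem_nhds hk1), hc.eventually (gt_mem_nhds hk2)] with q h1 h2
    exact (S.deform_eq_step₃ h1 h2 q.2).symm

/-- There is a continuous choice of a level beyond which the result of the deformation is the
identity, tending to `3` as the displacement tends to zero. -/
lemma exists_level : ∃ κ : ℝ → ℝ, Continuous κ ∧ (∀ η, 3 ≤ κ η) ∧ κ 0 = 3 ∧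
    (∀ η, 0 < η → S.c (S.index η + 2) ≤ κ η) ∧ ∀ η k, η < S.α k → κ η ≤ S.c (k + 4) := by
  obtain ⟨g, hg⟩ := exists_continuous_forall_mem_convex_of_local_const
    (X := Ioi (0 : ℝ)) (E := ℝ)
    (t := fun η => Icc (S.c (S.index η + 2)) (S.c (S.index η + 4)))
    (fun η => convex_Icc _ _) (fun η => by
      obtain ⟨i1, i2⟩ := S.index_spec η.2
      refine ⟨S.c (S.index η + 3), ?_⟩
      have h1 : ∀ᶠ η' : Ioi (0 : ℝ) in 𝓝 η, (η' : ℝ) < S.α (S.index η) :=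
        continuous_subtype_val.continuousAt.eventually (gt_mem_nhds i2)
      have h2 : ∀ᶠ η' : Ioi (0 : ℝ) in 𝓝 η, S.α (S.index η - 1 - 1) < (η' : ℝ) :=
        continuous_subtype_val.continuousAt.eventually (lt_mem_nhds ((S.α_lt _).trans_le i1))
      filter_upwards [h1, h2] with η' h1 h2
      obtain ⟨j1, j2⟩ := S.index_spec η'.2
      have h3 := S.index_le j1 h1
      have h4 := S.index_le h2.le j2
      exact ⟨S.c_mono (by omega), S.c_mono (by omega)⟩)
  classical
  let κ : ℝ → ℝ := fun η => if hη : 0 < η then g ⟨η, hη⟩ else 3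
  have hκ : ∀ η (hη : 0 < η), κ η = g ⟨η, hη⟩ := fun η hη => dif_pos hη
  have hκ0 : ∀ η, η ≤ 0 → κ η = 3 := fun η hη => dif_neg (not_lt.2 hη)
  have h3 : ∀ η, 3 ≤ κ η := fun η => by
    rcases lt_or_ge 0 η with h | h
    · rw [hκ η h]; exact (S.three_le _).trans (hg ⟨η, h⟩).1
    · rw [hκ0 η h]
  have hup : ∀ η k, η < S.α k → κ η ≤ S.c (k + 4) := fun η k hk => by
    rcases lt_or_ge 0 η with h | h
    · rw [hκ η h]
      have := S.index_le (S.index_spec h).1 hk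
      exact (hg ⟨η, h⟩).2.trans (S.c_mono (by simpa using this))
    · rw [hκ0 η h]; exact S.three_le _
  refine ⟨κ, ?_, h3, hκ0 0 le_rfl, fun η hη => by rw [hκ η hη]; exact (hg ⟨η, hη⟩).1, hup⟩
  rw [continuous_iff_continuousAt]
  intro η
  rcases lt_or_ge 0 η with h | h
  · have h1 : ContinuousOn κ (Ioi 0) := by
      rw [continuousOn_iff_continuous_domRestrict]
      exact g.continuous.congr fun x => (hκ x x.2).symm
    exact h1.continuousAt (isOpen_Ioi.mem_nhds h)
  · rw [Metric.continuousAt_iff']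
    intro ε hε
    obtain ⟨j, hj⟩ := S.c_lim ε hε
    filter_upwards [gt_mem_nhds (h.trans_lt (S.α_pos (j - 4)))] with y hy
    have h1 := hup y _ hy
    rw [sub_add_cancel] at h1
    rw [hκ0 η h, Real.dist_eq, abs_of_nonneg (by linarith [h3 y])]
    linarith

end StageChain

end Compose

/-! ### Retracting the homeomorphism group -/

section Retraction

open Set Filter Topology

universe u

variable {n : ℕ} {M : Type u} [MetricSpace M]

/-- `φ` is a strong deformation retraction of the group of bounded uniform homeomorphisms onto the
subgroup of those which are the identity on `A`; it modifies `h` only at points which lie in the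
interior of `B` or are mapped there by `h`, and it respects the boundary and boundedness. -/
structure IsEndRetraction (n : ℕ) (A B : Set M) (φ : bddUnifHomeo M × I → bddUnifHomeo M) :
    Prop where
  retraction : IsStrongDeformationRetraction (bddUnifHomeo M) (bddUnifHomeoRel A) φ
  eq_off : ∀ h t x, UniformFun.toFun h.1 x ∉ interior B → x ∉ interior B →
    UniformFun.toFun (φ (h, t)).1 x = UniformFun.toFun h.1 x
  boundary : ∀ h t, (∀ x ∈ manifoldBoundary n M, UniformFun.toFun h.1 x = x) →
    ∀ x ∈ manifoldBoundary n M, UniformFun.toFun (φ (h, t)).1 x = x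
  bound : ∀ α : ℝ, 0 < α → ∃ β : ℝ, 0 < β ∧ ∀ (h : bddUnifHomeo M) (t : I),
    h.1 ∈ unifHomeoBall M α → (φ (h, t)).1 ∈ unifHomeoBall M β

lemma isEndRetraction_fst : IsEndRetraction n (∅ : Set M) ∅ Prod.fst where
  retraction :=
    { subset := fun _ h => h.1
      continuous := continuous_fst
      zero := fun _ => rfl
      one := fun y => ⟨y.2, fun _ hx => hx.elim⟩
      fixed := fun _ _ _ => rfl }
  eq_off _ _ _ _ _ := rfl
  boundary _ _ h := h
  bound α hα := ⟨α, hα, fun _ _ h => h⟩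

/-- Retractions with disjoint supports can be composed at each time. -/
lemma IsEndRetraction.comp {A₁ A₂ B₁ B₂ : Set M} {φ₁ φ₂ : bddUnifHomeo M × I → bddUnifHomeo M}
    (h₁ : IsEndRetraction n A₁ B₁ φ₁) (h₂ : IsEndRetraction n A₂ B₂ φ₂) (hd : Disjoint A₁ B₂) :
    IsEndRetraction n (A₁ ∪ A₂) (B₁ ∪ B₂) fun p => φ₂ (φ₁ p, p.2) where
  retraction :=
    { subset := fun _ h => h.1
      continuous := h₂.retraction.continuous.comp
        (h₁.retraction.continuous.prodMk continuous_snd)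
      zero := fun y => by rw [h₁.retraction.zero, h₂.retraction.zero]
      one := fun y => by
        refine ⟨Subtype.property _, fun x hx => ?_⟩
        rcases hx with hx | hx
        · have h := (h₁.retraction.one y).2 x hx
          have hx' : x ∉ interior B₂ := fun h' => hd.notMem_of_mem_left hx (interior_subset h')
          rw [h₂.eq_off _ _ _ (by rwa [h]) hx', h]
        · exact (h₂.retraction.one _).2 x hx
      fixed := fun y hy t => by
        rw [h₁.retraction.fixed y ⟨hy.1, fun x hx => hy.2 x (Or.inl hx)⟩ t]
        exact h₂.retraction.fixed y ⟨hy.1, fun x hx => hy.2 x (Or.inr hx)⟩ t }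
  eq_off h t x hx hx' := by
    have h1 := h₁.eq_off h t x (fun h' => hx (interior_mono subset_union_left h'))
      (fun h' => hx' (interior_mono subset_union_left h'))
    rw [h₂.eq_off _ t x (fun h' => hx (interior_mono subset_union_right (by rwa [h1] at h')))
      (fun h' => hx' (interior_mono subset_union_right h')), h1]
  boundary h t hh := h₂.boundary _ t (h₁.boundary h t hh)
  bound α hα := by
    obtain ⟨β, hβ, h⟩ := h₁.bound α hα
    obtain ⟨γ, hγ, h'⟩ := h₂.bound β hβ
    exact ⟨γ, hγ, fun k t hk => h' _ t (h k t hk)⟩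

namespace ProperProductEndIn

variable {E : ProperProductEndIn n M} {a b : ℝ}

lemma continuous_ofFun_stretch (hint : E.tail 2 ⊆ interior E.L) (ha : 2 ≤ a) (hab : a < b) :
    Continuous fun s : Ici b => UniformFun.ofFun (E.radialMap (stretch a b s)) := by
  rw [continuous_iff_continuousAt]
  intro s₀
  refine continuousAt_ofFun_of_eq_id_off_compact (continuous_radialMap_stretch hint ha hab)
    (E.isCompact_shell (s₀ + 2)) ?_
  filter_upwards [continuous_subtype_val.continuousAt.eventually
    (gt_mem_nhds (lt_add_one (s₀ : ℝ)))] with s hs x hx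
  exact radialMap_eq_self_of_not_mem_shell
    (fun r hr => stretch_of_ge s.2 (by linarith)) hx

lemma continuous_ofFun_unstretch (hint : E.tail 2 ⊆ interior E.L) (ha : 2 ≤ a) (hab : a < b) :
    Continuous fun s : Ici b => UniformFun.ofFun (E.radialMap (unstretch a b s)) := by
  rw [continuous_iff_continuousAt]
  intro s₀
  refine continuousAt_ofFun_of_eq_id_off_compact (continuous_radialMap_unstretch hint ha hab)
    (E.isCompact_shell (s₀ + 2)) ?_
  filter_upwards [continuous_subtype_val.continuousAt.eventually
    (gt_mem_nhds (lt_add_one (s₀ : ℝ)))] with s hs x hx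
  exact radialMap_eq_self_of_not_mem_shell
    (fun r hr => unstretch_of_ge hab s.2 (by linarith)) hx

/-- Conjugation by the stretching homeomorphisms is jointly continuous in the level and the
conjugated homeomorphism. -/
lemma continuous_conj_stretchEquiv (hint : E.tail 2 ⊆ interior E.L) (ha : 2 ≤ a) (hab : a < b) :
    Continuous fun p : Ici b × bddUnifHomeo M =>
      conj (stretchEquiv hint ha hab p.1.2) (isBddEquiv_stretchEquiv hint ha hab p.1.2) p.2 := by
  refine Continuous.subtype_mk ?_ _
  rw [continuous_iff_continuousAt]
  intro p
  refine tendsto_ofFun_comp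
    (F := fun q : Ici b × bddUnifHomeo M => UniformFun.ofFun (E.radialMap (unstretch a b q.1)))
    (((continuous_ofFun_unstretch hint ha hab).comp continuous_fst).continuousAt (x := p))
    (tendsto_ofFun_comp (F := fun q : Ici b × bddUnifHomeo M => q.2.1)
      (G := fun q => UniformFun.ofFun (E.radialMap (stretch a b q.1)))
      (continuous_subtype_val.comp continuous_snd).continuousAt
      ((continuous_ofFun_stretch hint ha hab).comp continuous_fst).continuousAt ?_)
    (stretchEquiv hint ha hab p.1.2).symm.uniformContinuous
  obtain ⟨k, hk⟩ := p.2.2.1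
  simp only [hk]
  exact k.uniformContinuous

lemma conj_stretchEquiv_self (hint : E.tail 2 ⊆ interior E.L) (ha : 2 ≤ a) (hab : a < b) {s : ℝ}
    (hbs : b ≤ s) (hs : s = b) (h : bddUnifHomeo M) :
    conj (stretchEquiv hint ha hab hbs) (isBddEquiv_stretchEquiv hint ha hab hbs) h = h := by
  subst hs
  have h1 : ∀ x, stretchEquiv hint ha hab hbs x = x := fun x => by
    rw [stretchEquiv_apply]
    by_cases hL : x ∈ E.L
    · exact E.radialMap_eq_self ⟨x, hL⟩ (stretch_self hab _)
    · exact E.radialMap_of_not_mem hL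
  apply Subtype.ext
  apply UniformFun.toFun.injective
  funext x
  change (stretchEquiv hint ha hab hbs).symm (UniformFun.toFun h.1 _) = _
  rw [h1]
  exact (stretchEquiv hint ha hab hbs).toEquiv.symm_apply_eq.2 (h1 _).symm

end ProperProductEndIn

open ProperProductEndIn

/-- The retraction for a single end: run the stages, and at the same time conjugate by a radial
stretching which moves the level beyond which the result of the stages is the identity back
to `3`. -/
theorem ProperProductEndIn.exists_isEndRetraction (E : ProperProductEndIn n M)
    (hiso : E.IsIsolated) (hint : E.tail 2 ⊆ interior E.L) (hED : HasED n E.L) :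
    ∃ φ, IsEndRetraction n (E.tail 3) (E.tail 2) φ := by
  obtain ⟨S⟩ := E.nonempty_stageChain hiso hint hED
  obtain ⟨κ, hκc, hκ3, hκ0, hκ, hκS⟩ := S.exists_level
  have h23 : (2 : ℝ) < 3 := by norm_num
  obtain ⟨s, hs, hsv⟩ : ∃ s : bddUnifHomeo M × I → Ici (3 : ℝ), Continuous s ∧
      ∀ p, (s p : ℝ) = 3 + p.2 * (κ (E.eta p.1) - 3) := by
    have h1 : Continuous fun p : bddUnifHomeo M × I => κ (E.eta p.1) :=
      hκc.comp (continuous_eta.comp continuous_fst)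
    have h2 : Continuous fun p : bddUnifHomeo M × I => (p.2 : ℝ) :=
      continuous_subtype_val.comp continuous_snd
    exact ⟨fun p => ⟨_, le_add_of_nonneg_right
      (mul_nonneg p.2.2.1 (sub_nonneg.2 (hκ3 (E.eta p.1))))⟩,
      Continuous.subtype_mk (continuous_const.add (h2.mul (h1.sub continuous_const))) _,
      fun _ => rfl⟩
  let e : bddUnifHomeo M × I → M ≃ᵤ M := fun p => stretchEquiv hint le_rfl h23 (s p).2
  have he : ∀ p, IsBddEquiv (e p) := fun p => isBddEquiv_stretchEquiv hint le_rfl h23 (s p).2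
  have htail : E.tail 3 ⊆ interior (E.tail 2) := fun x hx => by
    obtain ⟨hL, hr⟩ := E.mem_tail_iff.1 hx
    exact mem_interior_tail hint le_rfl (x := ⟨x, hL⟩) (h23.trans_le hr)
  have hfix : ∀ p x, x ∉ interior (E.tail 2) → e p x = x := fun p x hx =>
    stretchEquiv_eq_self hint le_rfl h23 (s p).2 fun _ => hx
  refine ⟨fun p => conj (e p) (he p) (S.deform p.1 p.2),
    ⟨fun _ h => h.1, ?_, fun h => ?_, fun h => ⟨Subtype.property _, fun x hx => ?_⟩,
      fun h hh t => ?_⟩,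
    fun h t x hhx hx => ?_, fun h t hh x hx => ?_, fun α hα => ?_⟩
  · have h1 : Continuous fun p : bddUnifHomeo M × I => (s p, S.deform p.1 p.2) :=
      hs.prodMk S.continuous_deform
    have h2 := (continuous_conj_stretchEquiv hint le_rfl h23).comp h1
    exact h2
  · change conj _ _ (S.deform h 0) = h
    rw [S.deform_zero]
    exact conj_stretchEquiv_self hint le_rfl h23 (s (h, 0)).2 (by simp [hsv]) h
  · change (e (h, 1)).symm (UniformFun.toFun (S.deform h 1).1 (e (h, 1) x)) = x
    have h1 : e (h, 1) x ∈ E.tail (κ (E.eta h)) :=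
      E.tail_anti (by simp [hsv]) (stretchEquiv_mem_tail hint le_rfl h23 (s (h, 1)).2 hx)
    have h2 : UniformFun.toFun (S.deform h 1).1 (e (h, 1) x) = e (h, 1) x := by
      rcases (eta_nonneg (E := E) h).eq_or_lt with h0 | h0
      · rw [S.deform_of_eta_eq_zero h0.symm]
        exact eta_eq_zero_iff.1 h0.symm _ (E.tail_anti (hκ3 _) h1)
      · exact S.deform_one h0 (E.tail_anti (hκ _ h0) h1)
    rw [h2, UniformEquiv.symm_apply_apply]
  · have h0 : E.eta h = 0 := eta_eq_zero_iff.2 hh.2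
    change conj _ _ (S.deform h t) = h
    rw [S.deform_of_eta_eq_zero h0]
    exact conj_stretchEquiv_self hint le_rfl h23 (s (h, t)).2 (by simp [hsv, h0, hκ0]) h
  · change (e (h, t)).symm (UniformFun.toFun (S.deform h t).1 (e (h, t) x)) = _
    rw [hfix _ x hx, S.deform_off h t (fun h' => hx (htail h'))]
    exact (e (h, t)).toEquiv.symm_apply_eq.2 (hfix _ _ hhx).symm
  · change (e (h, t)).symm (UniformFun.toFun (S.deform h t).1 (e (h, t) x)) = x
    rw [S.deform_boundary hh t (e (h, t) x)
      ((mem_manifoldBoundary_homeomorph (e (h, t)).toHomeomorph x).2 hx),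
      UniformEquiv.symm_apply_apply]
  · obtain ⟨k, hk⟩ := S.α_unbounded α
    obtain ⟨D, hD⟩ := exists_dist_radialMap_stretch_le hint le_rfl h23 (S.c (k + 4))
    have hD' : ∀ r ∈ Icc 3 (S.c (k + 4)), ∀ x, dist (E.radialMap (stretch 2 3 r) x) x ≤ max D 0 :=
      fun r hr x => (hD r hr x).trans (le_max_left _ _)
    have hpos : 0 < max (S.α (k + 2)) α := lt_max_of_lt_right hα
    have hD0 : 0 ≤ 2 * max D 0 := by positivity
    refine ⟨2 * max D 0 + max (S.α (k + 2)) α + 1, by linarith, fun h t hh => ?_⟩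
    have hη : E.eta h < S.α k := by
      have h1 : ENNReal.ofReal (E.eta h) < ENNReal.ofReal α := by
        rw [ofReal_eta]
        exact (supDist_le_edist _ _).trans_lt hh.2
      exact ((ENNReal.ofReal_lt_ofReal_iff hα).1 h1).trans hk
    have hst : (s (h, t) : ℝ) ∈ Icc 3 (S.c (k + 4)) := by
      refine ⟨(s (h, t)).2, ?_⟩
      have h1 := hκS _ k hη
      have h2 := hκ3 (E.eta h)
      have h3 : (t : ℝ) * (κ (E.eta h) - 3) ≤ 1 * (κ (E.eta h) - 3) :=
        mul_le_mul_of_nonneg_right t.2.2 (sub_nonneg.2 h2)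
      rw [hsv]
      linarith
    refine ⟨conjFun_mem_unifHomeo _ (S.deform h t).2.1, ?_⟩
    calc edist (conjFun (e (h, t)) (S.deform h t).1) (idFun M)
        ≤ ENNReal.ofReal (2 * max D 0) + edist (S.deform h t).1 (idFun M) :=
          edist_conjFun_le (hD' _ hst) _
      _ ≤ ENNReal.ofReal (2 * max D 0) +
          max (ENNReal.ofReal (S.α (k + 2))) (ENNReal.ofReal α) := by
          gcongr
          exact (S.edist_deform_id_le hη t).trans (max_le_max le_rfl hh.2.le)
      _ = ENNReal.ofReal (2 * max D 0 + max (S.α (k + 2)) α) := by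
          rw [ENNReal.ofReal_add hD0 hpos.le, ENNReal.ofReal_max]
      _ < _ := (ENNReal.ofReal_lt_ofReal_iff (by linarith)).2 (by linarith)

/-- The retractions of pairwise disjoint ends compose to one for their union. -/
theorem exists_isEndRetraction_iUnion (m : ℕ) (E : Fin m → ProperProductEndIn n M)
    (hdisj : ∀ i j, i ≠ j → Disjoint (E i).L (E j).L) (hiso : ∀ i, (E i).IsIsolated)
    (hED : ∀ i, HasED n (E i).L) (hint : ∀ i, (E i).tail 2 ⊆ interior (E i).L) :
    ∃ φ, IsEndRetraction n (⋃ i, (E i).tail 3) (⋃ i, (E i).tail 2) φ := by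
  induction m with
  | zero =>
    refine ⟨Prod.fst, ?_⟩
    rw [iUnion_of_empty, iUnion_of_empty]
    exact isEndRetraction_fst
  | succ m ih =>
    obtain ⟨φ₁, h₁⟩ := (E 0).exists_isEndRetraction (hiso 0) (hint 0) (hED 0)
    obtain ⟨φ₂, h₂⟩ := ih (fun i => E i.succ)
      (fun i j hij => hdisj _ _ fun h => hij (Fin.succ_injective _ h))
      (fun i => hiso _) (fun i => hED _) fun i => hint _
    have h := h₁.comp h₂ (disjoint_iUnion_right.2 fun i =>
      (hdisj 0 i.succ (Fin.succ_ne_zero i).symm).mono ((E 0).tail_subset _)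
        ((E i.succ).tail_subset _))
    have hU : ∀ r : ℝ, ⋃ i, (E i).tail r = (E 0).tail r ∪ ⋃ i : Fin m, (E i.succ).tail r :=
      fun r => by ext x; simp only [mem_iUnion, mem_union, Fin.exists_fin_succ]
    rw [hU, hU]
    exact ⟨_, h⟩

end Retraction

end EndDeformation

theorem mainTheorem1 {n : ℕ} {M : Type*} [MetricSpace M]
    (hM : EndDeformation.IsTopManifold n M)
    (m : ℕ) (E : Fin m → EndDeformation.ProperProductEndIn n M)
    (hdisj : ∀ i j, i ≠ j → Disjoint (E i).L (E j).L)
    (hiso : ∀ i, (E i).IsIsolated)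
    (hED : ∀ i, EndDeformation.HasED n (E i).L)
    (hint : ∀ i, (E i).tail 2 ⊆ interior (E i).L) :
    ∃ φ : EndDeformation.bddUnifHomeo M × unitInterval → EndDeformation.bddUnifHomeo M,
      EndDeformation.IsStrongDeformationRetraction (EndDeformation.bddUnifHomeo M)
        (EndDeformation.bddUnifHomeoRel (⋃ i, (E i).tail 3)) φ ∧
      (∀ (h : EndDeformation.bddUnifHomeo M) (t : unitInterval),
        (∀ x ∈ (UniformFun.toFun h.1 ⁻¹' (interior (⋃ i, (E i).tail 2))ᶜ) \
            interior (⋃ i, (E i).tail 2),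
          UniformFun.toFun (φ (h, t)).1 x = UniformFun.toFun h.1 x) ∧
        ((∀ x ∈ EndDeformation.manifoldBoundary n M, UniformFun.toFun h.1 x = x) →
          ∀ x ∈ EndDeformation.manifoldBoundary n M, UniformFun.toFun (φ (h, t)).1 x = x)) ∧
      (∀ α : ℝ, 0 < α → ∃ β : ℝ, 0 < β ∧
        ∀ (h : EndDeformation.bddUnifHomeo M) (t : unitInterval),
          h.1 ∈ EndDeformation.unifHomeoBall M α →
          (φ (h, t)).1 ∈ EndDeformation.unifHomeoBall M β) := by
  obtain ⟨φ, hφ⟩ := EndDeformation.exists_isEndRetraction_iUnion m E hdisj hiso hED hint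
  exact ⟨φ, hφ.retraction,
    fun h t => ⟨fun x hx => hφ.eq_off h t x hx.1 hx.2, hφ.boundary h t⟩, hφ.bound⟩
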